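/- **Theorem 1.2.** Let $p\ge 1$, $q\ge 0$ be integers. For $\mathbf u=(s_0,\dots,s_p,t_1,\dots,t_q)\in\mathbb R^{p+q+1}$ put $c_0(\mathbf u)=s_0/(1-(t_1+\dots+t_q))$ and, for $i\ge 1$, $$c_i(\mathbf u)=s_i+\sum_{j=1}^{\min(q,i-1)}t_j\,c_{i-j}(\mathbf u),\qquad\text{where } s_i:=0 \text{ for } i>p .$$ Let $0<\underline u<\bar u$, $0<\rho_0<1$, $q\underline u<\rho_0$, and $$\Theta=\{\mathbf u:\ t_1+\dots+t_q\le\rho_0,\ \underline u\le\min_{i,j}(s_i,t_j)\le\max_{i,j}(s_i,t_j)\le\bar u\}.$$ Let $\theta=(\alpha_0,\dots,\alpha_p,\beta_1,\dots,\beta_q)$ lie in the interior of $\Theta$. Let $\{\varepsilon_t\}_{t\in\mathbb Z}$ be i.i.d. random variables with mean $0$ and variance $1$ such that $$\lim_{x\downarrow 0}x^{-\zeta}P\{|\varepsilon_0|\le x\}=0\quad\text{for some }\zeta>0 .$$ Suppose that the Bougerol–Picard condition holds: the top Lyapunov exponent of the i.i.d. random matrices $A_t$ in $z_t=A_tz_{t-1}+b_t$,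 the vector form of the equations below with state $z_t=(X_t^2,\dots,X_{t-p+1}^2,\sigma_t^2,\dots,\sigma_{t-q+1}^2)$, is negative. Let $\{(X_t,\sigma_t)\}_{t\in\mathbb Z}$, $\sigma_t\ge 0$, be a strictly stationary solution of the GARCH$(p,q)$ equations $$X_t=\sigma_t\varepsilon_t,\qquad \sigma_t^2=\alpha_0+\sum_{i=1}^p\alpha_iX_{t-i}^2+\sum_{j=1}^q\beta_j\sigma_{t-j}^2 .$$ Let $\hat\theta_n$ be random vectors in $\mathbb R^{p+q+1}$ (for example, estimators based on $X_0,\dots,X_n$) with $\sqrt n\,|\hat\theta_n-\theta|=O_P(1)$. For $1\le t\le n$ define $$\hat\sigma_t^2=c_0(\hat\theta_n)+\sum_{i=1}^{t}c_i(\hat\theta_n)X_{t-i}^2,\qquad \hat\varepsilon_t=X_t/\hat\sigma_t,$$ and for an integer $k\ge 1$ and $0\le u\le 1$ let $$\hat S_n^{(k)}(u)=\sum_{t=1}^{\lfloor nu\rfloor}\hat\varepsilon_t^{\,k},\qquad S_n^{(k)}(u)=\sum_{t=1}^{\lfloor nu\rfloor}\varepsilon_t^{k}.$$ If $E|\varepsilon_0|^k<\infty$,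 then, as $n\to\infty$, $$\sup_{0\le u\le 1}\frac1{\sqrt n}\Big|\big(\hat S_n^{(k)}(u)-u\hat S_n^{(k)}(1)\big)-\big(S_n^{(k)}(u)-uS_n^{(k)}(1)\big)\Big|=o_P(1).$$ -/

import Mathlib

open MeasureTheory ProbabilityTheory Filter Topology

namespace GARCH

/-- Parameter vectors `u = (s, t)` with `s = (s₀, …, s_p)` and `t = (t₁, …, t_q)`; `t_j` is stored
at index `j - 1`. The norm of this product is the maximum norm on `ℝ^(p+q+1)`. -/
abbrev Param (p q : ℕ) : Type := (Fin (p + 1) → ℝ) × (Fin q → ℝ)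

/-- The parameter space `Θ`: `t₁ + ⋯ + t_q ≤ ρ₀`, and all coordinates lie in `[ulow, uupp]`. -/
def paramSpace (p q : ℕ) (ulow uupp ρ₀ : ℝ) : Set (Param p q) :=
  {u | ∑ j, u.2 j ≤ ρ₀ ∧ (∀ i, ulow ≤ u.1 i ∧ u.1 i ≤ uupp) ∧ ∀ j, ulow ≤ u.2 j ∧ u.2 j ≤ uupp}

/-- The coefficients `c_i(u)`: `c₀(u) = s₀ / (1 - (t₁ + ⋯ + t_q))`, and for `i ≥ 1`
`c_i(u) = s_i + ∑ t_j c_{i-j}(u)`, the sum over `1 ≤ j ≤ min (q, i - 1)`, with `s_i = 0` for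
`i > p`. -/
noncomputable def coeff {p q : ℕ} (u : Param p q) : ℕ → ℝ
  | 0 => u.1 0 / (1 - ∑ j, u.2 j)
  | i + 1 => (if h : i < p then u.1 ⟨i + 1, Nat.succ_lt_succ h⟩ else 0)
      + ∑ j : Fin q, if (j : ℕ) < i then u.2 j * coeff u (i - j) else 0
  termination_by i => i

/-- `e` is a two-sided sequence of i.i.d. random variables with mean `0` and variance `1`. -/
structure IsInnovation {Ω : Type*} [MeasurableSpace Ω] (μ : Measure Ω) (e : ℤ → Ω → ℝ) :
    Prop where
  measurable : ∀ t, Measurable (e t)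
  indep : iIndepFun e μ
  identDistrib : ∀ t, IdentDistrib (e t) (e 0) μ μ
  memLp_two : MemLp (e 0) 2 μ
  mean_zero : ∫ ω, e 0 ω ∂μ = 0
  variance_one : ∫ ω, e 0 ω ^ 2 ∂μ = 1

/-- `(X, σ)` is a strictly stationary solution of the `GARCH(p, q)` equations
`X_t = σ_t ε_t` and `σ_t² = α₀ + ∑_{i=1}^p α_i X_{t-i}² + ∑_{j=1}^q β_j σ_{t-j}²`, `t ∈ ℤ`,
with parameter `θ = (α₀, …, α_p, β₁, …, β_q)` and innovations `ε`. -/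
structure IsStationaryGARCH {Ω : Type*} [MeasurableSpace Ω] (μ : Measure Ω) {p q : ℕ}
    (θ : Param p q) (ε X σ : ℤ → Ω → ℝ) : Prop where
  measurable_X : ∀ t, Measurable (X t)
  measurable_σ : ∀ t, Measurable (σ t)
  σ_nonneg : ∀ t, ∀ᵐ ω ∂μ, 0 ≤ σ t ω
  eq_X : ∀ t, ∀ᵐ ω ∂μ, X t ω = σ t ω * ε t ω
  eq_σ : ∀ t, ∀ᵐ ω ∂μ, σ t ω ^ 2 = θ.1 0
    + ∑ i : Fin p, θ.1 i.succ * X (t - ((i : ℤ) + 1)) ω ^ 2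
    + ∑ j : Fin q, θ.2 j * σ (t - ((j : ℤ) + 1)) ω ^ 2
  stationary : ∀ h : ℤ, IdentDistrib (fun ω (t : ℤ) => (X (t + h) ω, σ (t + h) ω))
    (fun ω (t : ℤ) => (X t ω, σ t ω)) μ μ

/-- The random matrix of the GARCH recursion: for the state
`z_t = (X_t², …, X_{t-p+1}², σ_t², …, σ_{t-q+1}²)` the GARCH equations read
`z_t = stepMatrix θ ε_t * z_{t-1} + b_t`, where `b_t` has entries `α₀ ε_t²`, `α₀` in the rows of
`X_t²`, `σ_t²` and `0` elsewhere. -/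
def stepMatrix {p q : ℕ} (θ : Param p q) (e : ℝ) : Matrix (Fin p ⊕ Fin q) (Fin p ⊕ Fin q) ℝ
  | Sum.inl i, Sum.inl j =>
      if (i : ℕ) = 0 then e ^ 2 * θ.1 j.succ else if (i : ℕ) = (j : ℕ) + 1 then 1 else 0
  | Sum.inl i, Sum.inr j => if (i : ℕ) = 0 then e ^ 2 * θ.2 j else 0
  | Sum.inr i, Sum.inl j => if (i : ℕ) = 0 then θ.1 j.succ else 0
  | Sum.inr i, Sum.inr j =>
      if (i : ℕ) = 0 then θ.2 j else if (i : ℕ) = (j : ℕ) + 1 then 1 else 0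

section

attribute [local instance] Matrix.linftyOpNormedAddCommGroup

/-- The top Lyapunov exponent `γ = inf_{n ≥ 0} E log ‖A_0 A_{-1} ⋯ A_{-n}‖ / (n + 1)` of the
matrices `A_t = stepMatrix θ ε_t`, in terms of the operator norm for the maximum norm. The
Bougerol–Picard condition for the existence of a strictly stationary solution is `γ < 0`. -/
noncomputable def lyapunovExponent {Ω : Type*} [MeasurableSpace Ω] (μ : Measure Ω) {p q : ℕ}
    (θ : Param p q) (ε : ℤ → Ω → ℝ) : EReal :=
  ⨅ n : ℕ, (((∫ ω, Real.log
    ‖((List.range (n + 1)).map fun i => stepMatrix θ (ε (-(i : ℤ)) ω)).prod‖ ∂μ) / (n + 1) : ℝ) :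
      EReal)

end

/-- `Y_n = O_P(1)`. -/
def IsBoundedInProb {Ω : Type*} [MeasurableSpace Ω] (μ : Measure Ω) (Y : ℕ → Ω → ℝ) : Prop :=
  ∀ η : ℝ, 0 < η → ∃ M : ℝ, ∀ᶠ n in atTop, μ.real {ω | M < |Y n ω|} ≤ η

/-- The truncated conditional variance estimate
`σ̂_t² = c₀(u) + ∑_{i=1}^t c_i(u) X_{t-i}²` (with `u = θ̂_n`), for a path `x` of `X`. -/
noncomputable def condVarEst {p q : ℕ} (u : Param p q) (x : ℤ → ℝ) (t : ℕ) : ℝ :=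
  coeff u 0 + ∑ i ∈ Finset.Icc 1 t, coeff u i * x ((t : ℤ) - i) ^ 2

/-- The residual `ε̂_t = X_t / σ̂_t`. -/
noncomputable def residual {p q : ℕ} (u : Param p q) (x : ℤ → ℝ) (t : ℕ) : ℝ :=
  x t / √(condVarEst u x t)

/-- The `k`-th moment partial sum `∑_{t=1}^{⌊n u⌋} e_t^k`. -/
noncomputable def momentSum (e : ℕ → ℝ) (k n : ℕ) (u : ℝ) : ℝ :=
  ∑ t ∈ Finset.Icc 1 ⌊(n : ℝ) * u⌋₊, e t ^ k

/-- The CUSUM process `S_n^{(k)}(u) - u S_n^{(k)}(1)` of the sequence `e`. -/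
noncomputable def cusum (e : ℕ → ℝ) (k n : ℕ) (u : ℝ) : ℝ :=
  momentSum e k n u - u * momentSum e k n 1

/-- The real supremum in `sup_{0 ≤ u ≤ 1} n^{-1/2} |cusum e - cusum e'|` is a true supremum. -/
theorem bddAbove_cusum_sub (e e' : ℕ → ℝ) (k n : ℕ) :
    BddAbove (Set.range fun u : Set.Icc (0 : ℝ) 1 =>
      (1 / √(n : ℝ)) * |cusum e k n u - cusum e' k n u|) := by
  have key : ∀ (f : ℕ → ℝ) (u : ℝ), u ≤ 1 →
      |momentSum f k n u| ≤ ∑ t ∈ Finset.Icc 1 n, |f t ^ k| := by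
    intro f u hu
    refine (Finset.abs_sum_le_sum_abs _ _).trans
      (Finset.sum_le_sum_of_subset_of_nonneg ?_ fun _ _ _ => abs_nonneg _)
    refine Finset.Icc_subset_Icc le_rfl ?_
    refine (Nat.floor_le_floor (?_ : (n : ℝ) * u ≤ (n : ℝ))).trans (Nat.floor_natCast n).le
    exact mul_le_of_le_one_right (Nat.cast_nonneg n) hu
  have key2 : ∀ (f : ℕ → ℝ) (u : Set.Icc (0 : ℝ) 1),
      |cusum f k n u| ≤ 2 * ∑ t ∈ Finset.Icc 1 n, |f t ^ k| := by
    intro f u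
    have h1 := key f u u.2.2
    have h2 := key f 1 le_rfl
    have h3 : |(u : ℝ) * momentSum f k n 1| ≤ |momentSum f k n 1| := by
      rw [abs_mul, abs_of_nonneg u.2.1]
      exact mul_le_of_le_one_left (abs_nonneg _) u.2.2
    have h4 := abs_sub (momentSum f k n u) ((u : ℝ) * momentSum f k n 1)
    unfold cusum
    linarith
  refine ⟨(1 / √(n : ℝ)) * (2 * ∑ t ∈ Finset.Icc 1 n, |e t ^ k|
    + 2 * ∑ t ∈ Finset.Icc 1 n, |e' t ^ k|), ?_⟩
  rintro _ ⟨u, rfl⟩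
  refine mul_le_mul_of_nonneg_left ?_ (by positivity)
  have := abs_sub (cusum e k n u) (cusum e' k n u)
  have h1 := key2 e u
  have h2 := key2 e' u
  linarith

end GARCH

/-! Write V_t for the estimated conditional variance at θ̂_n, W_t = σ_t² and h = θ̂_n - θ, so that
‖h‖ = O_P(n^{-1/2}). The residual power is ε_t^k (V_t / W_t)^{-k/2}, which to first order is ε_t^k -
(k/2) ε_t^k D_t(h) / W_t, where D_t(h) is the differential of the volatility series at θ. Since D_t
is linear in h, the partial sums of the linear term are combinations, with coefficients
O_P(n^{-1/2}), of the partial sums of the p + q + 1 stationary sequences ε_t^k D_t(e_a) / W_t. By a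
law of large numbers uniform in j ≤ n (`IsCausal.eventually_measureReal_max_le`) these are j m_a +
o_P(n). The CUSUM transform annihilates j m_a up to the rounding of n u, and what is left is
o_P(√n). All remaining terms of the expansion sum to O_P(1).

The remainders are delicate because X_t is only known to have a fractional moment, so every error is
measured relative to W_t. For i ≥ 1, c_i is a polynomial with nonnegative coefficients and degree at
most i. Hence a small relative change of θ moves c_i, and its linear part, by a controlled multiple
of c_i itself (`IsRelSmall.abs_coeff_sub_sub_le`). Since W_t dominates both c_0 and each c_i
X_{t-i}², the ratio c_i X_{t-i}² / W_t is geometrically small in i, up to Q_t^{1/4} for an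
integrable envelope Q_t (`IsAdmissible.coeff_mul_le`). The fourth root serves two purposes. With
high probability the maximum of Q_t over t ≤ n is at most a small multiple of n², so ‖h‖ Q_t^{1/4}
stays in the range of the expansion. Also the square of Q_t^{1/4} is at most Q_t, so the quadratic
errors sum to ‖h‖² O_P(n) = O_P(1). Truncating the series at X_0 costs λ^t times a finite random
variable.

The probabilistic input comes from the Lyapunov exponent: its negativity gives a block of step
matrices with s-th moment of the norm below one, for some s ≤ 1. Iterating the state recursion then
exhibits the state as a limit of functions of past innovations with finite s-th moment. So X² grows
subexponentially into the past, σ² is the volatility series by uniqueness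
(`IsAdmissible.eq_fullVar`), and Q_t and D_t / W_t depend on ε_{t-1}, ε_{t-2}, … only, independently
of ε_t. -/

namespace GARCH

open scoped ENNReal NNReal Matrix

/-! ### Perturbation and decay of the coefficients c_i -/

section Coefficients

variable {p q : ℕ}

/-- All coordinates are positive and the `GARCH` coefficients sum to less than one. -/
structure IsAdmissible (θ : Param p q) : Prop where
  fst_pos : ∀ i, 0 < θ.1 i
  snd_pos : ∀ j, 0 < θ.2 j
  sum_lt_one : ∑ j, θ.2 j < 1

/-- The `ARCH` coordinate `s_{i+1}`, extended by zero. -/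
noncomputable def archCoord (i : ℕ) : Param p q →ₗ[ℝ] ℝ :=
  if h : i < p then LinearMap.proj ⟨i + 1, Nat.succ_lt_succ h⟩ ∘ₗ LinearMap.fst ℝ _ _ else 0

/-- The `GARCH` coordinate `t_{j+1}`. -/
noncomputable def garchCoord (j : Fin q) : Param p q →ₗ[ℝ] ℝ :=
  LinearMap.proj j ∘ₗ LinearMap.snd ℝ _ _

theorem garchCoord_apply (u : Param p q) (j : Fin q) : garchCoord j u = u.2 j := rfl

theorem archCoord_apply (u : Param p q) (i : ℕ) :
    archCoord i u = if h : i < p then u.1 ⟨i + 1, Nat.succ_lt_succ h⟩ else 0 := by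
  unfold archCoord
  split_ifs <;> rfl

theorem coeff_zero (u : Param p q) : coeff u 0 = u.1 0 / (1 - ∑ j, u.2 j) := by
  rw [coeff]

theorem coeff_succ (u : Param p q) (i : ℕ) :
    coeff u (i + 1) = archCoord i u
      + ∑ j : Fin q, if (j : ℕ) < i then u.2 j * coeff u (i - j) else 0 := by
  rw [coeff, archCoord_apply]

/-- The differential of `u ↦ coeff u i` at `θ`. -/
noncomputable def coeffDeriv (θ : Param p q) : ℕ → (Param p q →ₗ[ℝ] ℝ)
  | 0 => (1 - ∑ j, θ.2 j)⁻¹ • (LinearMap.proj 0 ∘ₗ LinearMap.fst ℝ _ _)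
      + (θ.1 0 / (1 - ∑ j, θ.2 j) ^ 2) • ∑ j, garchCoord j
  | i + 1 => archCoord i + ∑ j : Fin q,
      if (j : ℕ) < i then coeff θ (i - j) • garchCoord j + θ.2 j • coeffDeriv θ (i - j) else 0
  termination_by i => i

theorem coeffDeriv_zero_apply (θ h : Param p q) :
    coeffDeriv θ 0 h = (1 - ∑ j, θ.2 j)⁻¹ * h.1 0
      + (θ.1 0 / (1 - ∑ j, θ.2 j) ^ 2) * ∑ j, h.2 j := by
  rw [coeffDeriv]
  simp [garchCoord_apply]

theorem coeffDeriv_succ_apply (θ h : Param p q) (i : ℕ) :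
    coeffDeriv θ (i + 1) h = archCoord i h + ∑ j : Fin q,
      if (j : ℕ) < i then coeff θ (i - j) * h.2 j + θ.2 j * coeffDeriv θ (i - j) h else 0 := by
  rw [coeffDeriv]
  simp only [LinearMap.add_apply, LinearMap.sum_apply]
  congr 1
  refine Finset.sum_congr rfl fun j _ => ?_
  split_ifs <;> simp [garchCoord_apply]

theorem archCoord_nonneg {u : Param p q} (hu : ∀ i, 0 ≤ u.1 i) (i : ℕ) : 0 ≤ archCoord i u := by
  rw [archCoord_apply]
  split_ifs
  · exact hu _
  · exact le_rfl

theorem coeff_succ_nonneg {u : Param p q} (h1 : ∀ i, 0 ≤ u.1 i) (h2 : ∀ j, 0 ≤ u.2 j) (m : ℕ) :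
    0 ≤ coeff u (m + 1) := by
  induction m using Nat.strong_induction_on with
  | _ m ih =>
    rw [coeff_succ]
    refine add_nonneg (archCoord_nonneg h1 m) (Finset.sum_nonneg fun j _ => ?_)
    split_ifs with hj
    · obtain ⟨l, hl⟩ : ∃ l, m - j = l + 1 := ⟨m - j - 1, by omega⟩
      rw [hl]
      exact mul_nonneg (h2 j) (ih l (by omega))
    · exact le_rfl

theorem IsAdmissible.coeff_succ_nonneg {θ : Param p q} (hθ : IsAdmissible θ) (m : ℕ) :
    0 ≤ coeff θ (m + 1) :=
  GARCH.coeff_succ_nonneg (fun i => (hθ.fst_pos i).le) (fun j => (hθ.snd_pos j).le) m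

theorem IsAdmissible.coeff_zero_pos {θ : Param p q} (hθ : IsAdmissible θ) : 0 < coeff θ 0 := by
  rw [coeff_zero]
  exact div_pos (hθ.fst_pos 0) (by linarith [hθ.sum_lt_one])

/-- The increment `h` is at most `η` times `θ`, coordinate by coordinate. -/
def IsRelSmall (θ h : Param p q) (η : ℝ) : Prop :=
  (∀ i, |h.1 i| ≤ η * θ.1 i) ∧ ∀ j, |h.2 j| ≤ η * θ.2 j

theorem IsRelSmall.abs_archCoord_le {θ h : Param p q} {η : ℝ} (hh : IsRelSmall θ h η) (i : ℕ) :
    |archCoord i h| ≤ η * archCoord i θ := by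
  rw [archCoord_apply, archCoord_apply]
  split_ifs
  · exact hh.1 _
  · simp

/-- At positive index m + 1 the coefficient is a polynomial of degree at most m + 1 with nonnegative
coefficients, so each monomial changes by a relative amount of at most (1 + η)^(m+1) - 1. The
induction works because t_j c_{m-j} has degree at most m - j + 1 for its zero-based j. -/
theorem IsRelSmall.abs_coeff_sub_le {θ h : Param p q} {η : ℝ} (hθ : IsAdmissible θ) (hη : 0 ≤ η)
    (hh : IsRelSmall θ h η) (m : ℕ) :
    |coeff (θ + h) (m + 1) - coeff θ (m + 1)| ≤ ((1 + η) ^ (m + 1) - 1) * coeff θ (m + 1) := by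
  induction m using Nat.strong_induction_on with
  | _ m ih =>
    have h1 : (1 : ℝ) ≤ 1 + η := by linarith
    have hpow : 1 + η ≤ (1 + η) ^ (m + 1) := le_self_pow₀ h1 (by omega)
    rw [coeff_succ, coeff_succ, map_add, mul_add, Finset.mul_sum]
    have : archCoord m θ + archCoord m h
        + (∑ j : Fin q, if (j : ℕ) < m then (θ + h).2 j * coeff (θ + h) (m - j) else 0)
        - (archCoord m θ + ∑ j : Fin q, if (j : ℕ) < m then θ.2 j * coeff θ (m - j) else 0)
        = archCoord m h + ∑ j : Fin q, ((if (j : ℕ) < m then (θ + h).2 j * coeff (θ + h) (m - j)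
          else 0) - if (j : ℕ) < m then θ.2 j * coeff θ (m - j) else 0) := by
      rw [Finset.sum_sub_distrib]; ring
    rw [this]
    refine (abs_add_le _ _).trans (add_le_add ?_ ((Finset.abs_sum_le_sum_abs _ _).trans
      (Finset.sum_le_sum fun j _ => ?_)))
    · refine (hh.abs_archCoord_le m).trans ?_
      exact mul_le_mul_of_nonneg_right (by linarith)
        (archCoord_nonneg (fun i => (hθ.fst_pos i).le) m)
    · split_ifs with hj
      · obtain ⟨l, hl⟩ : ∃ l, m - j = l + 1 := ⟨m - j - 1, by omega⟩
        rw [hl]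
        have hi := ih l (by omega)
        have hc := hθ.coeff_succ_nonneg l
        set c := coeff θ (l + 1)
        set c' := coeff (θ + h) (l + 1)
        have hc' : |c'| ≤ (1 + η) ^ (l + 1) * c := by
          have := abs_sub_abs_le_abs_sub c' c
          rw [abs_of_nonneg hc] at this
          linarith
        have hb := hθ.snd_pos j
        have hsnd : (θ + h).2 j = θ.2 j + h.2 j := rfl
        have e : (θ + h).2 j * c' - θ.2 j * c = θ.2 j * (c' - c) + h.2 j * c' := by
          rw [hsnd]; ring
        rw [e]
        refine (abs_add_le _ _).trans ?_
        rw [abs_mul, abs_mul, abs_of_pos hb]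
        have e1 : θ.2 j * |c' - c| ≤ θ.2 j * (((1 + η) ^ (l + 1) - 1) * c) :=
          mul_le_mul_of_nonneg_left hi hb.le
        have e2 : |h.2 j| * |c'| ≤ (η * θ.2 j) * ((1 + η) ^ (l + 1) * c) :=
          mul_le_mul (hh.2 j) hc' (abs_nonneg _) (by positivity)
        have e3 : (1 + η) ^ (l + 1 + 1) ≤ (1 + η) ^ (m + 1) :=
          pow_le_pow_right₀ h1 (by omega)
        have e4 : ((1 + η) ^ (l + 1 + 1) - 1) * (θ.2 j * c)
            ≤ ((1 + η) ^ (m + 1) - 1) * (θ.2 j * c) :=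
          mul_le_mul_of_nonneg_right (by linarith) (by positivity)
        refine (add_le_add e1 e2).trans (le_trans (le_of_eq ?_) e4)
        ring
      · simp

/-- Euler's relation: the logarithmic differential of a monomial in such a direction is at most η
times its degree. -/
theorem IsRelSmall.abs_coeffDeriv_le {θ h : Param p q} {η : ℝ} (hθ : IsAdmissible θ) (hη : 0 ≤ η)
    (hh : IsRelSmall θ h η) (m : ℕ) :
    |coeffDeriv θ (m + 1) h| ≤ (m + 1 : ℕ) * η * coeff θ (m + 1) := by
  induction m using Nat.strong_induction_on with
  | _ m ih =>
    rw [coeff_succ, coeffDeriv_succ_apply, mul_add, Finset.mul_sum]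
    refine (abs_add_le _ _).trans (add_le_add ?_ ((Finset.abs_sum_le_sum_abs _ _).trans
      (Finset.sum_le_sum fun j _ => ?_)))
    · refine (hh.abs_archCoord_le m).trans ?_
      refine mul_le_mul_of_nonneg_right ?_ (archCoord_nonneg (fun i => (hθ.fst_pos i).le) m)
      push_cast
      nlinarith [mul_nonneg (Nat.cast_nonneg (α := ℝ) m) hη]
    · split_ifs with hj
      · obtain ⟨l, hl⟩ : ∃ l, m - j = l + 1 := ⟨m - j - 1, by omega⟩
        rw [hl]
        have hi := ih l (by omega)
        have hc := hθ.coeff_succ_nonneg l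
        set c := coeff θ (l + 1)
        have hb := hθ.snd_pos j
        refine (abs_add_le _ _).trans ?_
        rw [abs_mul, abs_mul, abs_of_pos hb, abs_of_nonneg hc]
        have e1 := mul_le_mul_of_nonneg_left hi hb.le
        have e2 := mul_le_mul_of_nonneg_left (hh.2 j) hc
        have e3 : ((l + 1 + 1 : ℕ) : ℝ) * (η * (θ.2 j * c)) ≤ (m + 1 : ℕ) * (η * (θ.2 j * c)) :=
          mul_le_mul_of_nonneg_right (by exact_mod_cast (by omega)) (by positivity)
        refine (add_le_add e2 e1).trans ((le_of_eq ?_).trans (e3.trans (le_of_eq ?_)))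
        · push_cast; ring
        · ring
      · simp

/-- Allows the error bound of a summand of lower degree to be replaced by that of degree m + 1. -/
theorem one_add_mul_le_pow_mono {η : ℝ} (hη : 0 ≤ η) :
    Monotone fun n : ℕ => (1 + η) ^ n - 1 - n * η := by
  refine monotone_nat_of_le_succ fun n => ?_
  have : (1 : ℝ) ≤ (1 + η) ^ n := one_le_pow₀ (by linarith)
  simp only [pow_succ]
  push_cast
  nlinarith

/-- Monomial by monomial, what remains after removing the linear part is the part of (1 + η)^deg of
order at least two. The bound is relative to the coefficient, which is what permits comparison with
the terms of W_t. -/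
theorem IsRelSmall.abs_coeff_sub_sub_le {θ h : Param p q} {η : ℝ} (hθ : IsAdmissible θ)
    (hη : 0 ≤ η) (hh : IsRelSmall θ h η) (m : ℕ) :
    |coeff (θ + h) (m + 1) - coeff θ (m + 1) - coeffDeriv θ (m + 1) h|
      ≤ ((1 + η) ^ (m + 1) - 1 - (m + 1 : ℕ) * η) * coeff θ (m + 1) := by
  induction m using Nat.strong_induction_on with
  | _ m ih =>
    have hmono := one_add_mul_le_pow_mono hη
    rw [coeff_succ, coeff_succ, coeffDeriv_succ_apply, map_add, mul_add, Finset.mul_sum]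
    have : archCoord m θ + archCoord m h
        + (∑ j : Fin q, if (j : ℕ) < m then (θ + h).2 j * coeff (θ + h) (m - j) else 0)
        - (archCoord m θ + ∑ j : Fin q, if (j : ℕ) < m then θ.2 j * coeff θ (m - j) else 0)
        - (archCoord m h + ∑ j : Fin q, if (j : ℕ) < m then
          coeff θ (m - j) * h.2 j + θ.2 j * coeffDeriv θ (m - j) h else 0)
        = ∑ j : Fin q, ((if (j : ℕ) < m then (θ + h).2 j * coeff (θ + h) (m - j)
          else 0) - (if (j : ℕ) < m then θ.2 j * coeff θ (m - j) else 0)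
          - if (j : ℕ) < m then
          coeff θ (m - j) * h.2 j + θ.2 j * coeffDeriv θ (m - j) h else 0) := by
      rw [Finset.sum_sub_distrib, Finset.sum_sub_distrib]; ring
    rw [this]
    refine ((Finset.abs_sum_le_sum_abs _ _).trans
      (Finset.sum_le_sum fun j _ => ?_)).trans (le_add_of_nonneg_left ?_)
    · split_ifs with hj
      · obtain ⟨l, hl⟩ : ∃ l, m - j = l + 1 := ⟨m - j - 1, by omega⟩
        rw [hl]
        have hi := ih l (by omega)
        have hd := hh.abs_coeff_sub_le hθ hη l
        have hc := hθ.coeff_succ_nonneg l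
        have hsnd : (θ + h).2 j = θ.2 j + h.2 j := rfl
        rw [hsnd]
        set c := coeff θ (l + 1)
        set c' := coeff (θ + h) (l + 1)
        have hb := hθ.snd_pos j
        have e : (θ.2 j + h.2 j) * c' - θ.2 j * c - (c * h.2 j + θ.2 j * coeffDeriv θ (l + 1) h)
            = θ.2 j * (c' - c - coeffDeriv θ (l + 1) h) + h.2 j * (c' - c) := by ring
        rw [e]
        refine (abs_add_le _ _).trans ?_
        rw [abs_mul, abs_mul, abs_of_pos hb]
        have e1 := mul_le_mul_of_nonneg_left hi hb.le
        have e2 : |h.2 j| * |c' - c| ≤ (η * θ.2 j) * (((1 + η) ^ (l + 1) - 1) * c) :=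
          mul_le_mul (hh.2 j) hd (abs_nonneg _) (by positivity)
        have e3 := mul_le_mul_of_nonneg_right (hmono (show l + 1 + 1 ≤ m + 1 by omega))
          (mul_nonneg hb.le hc)
        refine (add_le_add e1 e2).trans (le_trans (le_of_eq ?_) e3)
        push_cast
        ring
      · simp
    · refine mul_nonneg ?_ (archCoord_nonneg (fun i => (hθ.fst_pos i).le) m)
      have := hmono (Nat.zero_le (m + 1))
      simpa using this

/-- Isolates the quadratic factor η²; the growth (1 + η)^n is later absorbed by geometric decay. -/
theorem one_add_pow_sub_one_sub_le {η : ℝ} (hη : 0 ≤ η) (n : ℕ) :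
    (1 + η) ^ n - 1 - n * η ≤ n ^ 2 * η ^ 2 * (1 + η) ^ n := by
  have h0 : ∀ n : ℕ, (1 + η) ^ n - 1 ≤ n * η * (1 + η) ^ n := by
    intro n
    induction n with
    | zero => simp
    | succ n ih =>
      have : (1 : ℝ) ≤ (1 + η) ^ n := one_le_pow₀ (by linarith)
      have h2 : 0 ≤ (n : ℝ) * η * (1 + η) ^ n := by positivity
      rw [pow_succ]
      push_cast
      nlinarith [mul_nonneg hη h2, mul_nonneg hη (mul_nonneg hη (zero_le_one.trans this))]
  induction n with
  | zero => simp
  | succ n ih =>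
    have h1 : (1 : ℝ) ≤ (1 + η) ^ n := one_le_pow₀ (by linarith)
    have h2 := mul_le_mul_of_nonneg_left (h0 n) hη
    have h3 : 0 ≤ (n : ℝ) ^ 2 * η ^ 2 * (1 + η) ^ n := by positivity
    have h4 : 0 ≤ (n : ℝ) * η ^ 2 * (1 + η) ^ n := by positivity
    have h5 : 0 ≤ η ^ 2 * (1 + η) ^ n := by positivity
    rw [pow_succ]
    push_cast
    nlinarith [mul_nonneg hη h3, mul_nonneg hη h4, mul_nonneg hη h5]

/-- The inequality is strict at ρ = 1, hence persists slightly to the left of 1. -/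
theorem IsAdmissible.exists_rate {θ : Param p q} (hθ : IsAdmissible θ) :
    ∃ ρ : ℝ, 0 < ρ ∧ ρ < 1 ∧ ∑ j : Fin q, θ.2 j * (ρ⁻¹) ^ ((j : ℕ) + 1) < 1 := by
  have hc : ContinuousAt (fun ρ : ℝ => ∑ j : Fin q, θ.2 j * (ρ⁻¹) ^ ((j : ℕ) + 1)) 1 := by
    refine tendsto_finsetSum _ fun j _ => ?_
    exact (((continuousAt_id.inv₀ one_ne_zero).pow _).const_mul (θ.2 j))
  have h1 : ∀ᶠ ρ in 𝓝 (1 : ℝ), ∑ j : Fin q, θ.2 j * (ρ⁻¹) ^ ((j : ℕ) + 1) < 1 :=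
    hc.eventually_lt_const (by simpa using hθ.sum_lt_one)
  have h2 : ∀ᶠ ρ in 𝓝[<] (1 : ℝ), 0 < ρ ∧ ρ < 1 ∧
      ∑ j : Fin q, θ.2 j * (ρ⁻¹) ^ ((j : ℕ) + 1) < 1 := by
    filter_upwards [nhdsWithin_le_nhds h1, self_mem_nhdsWithin,
      nhdsWithin_le_nhds (lt_mem_nhds zero_lt_one)] with ρ a b c
    exact ⟨c, b, a⟩
  exact h2.exists

theorem IsAdmissible.coeff_le {θ : Param p q} (hθ : IsAdmissible θ) {ρ : ℝ} (hρ : 0 < ρ)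
    (hρ1 : ρ < 1) (hsum : ∑ j : Fin q, θ.2 j * (ρ⁻¹) ^ ((j : ℕ) + 1) < 1) :
    ∃ C : ℝ, 0 < C ∧ ∀ m, coeff θ (m + 1) ≤ C * ρ ^ (m + 1) := by
  set f := ∑ j : Fin q, θ.2 j * (ρ⁻¹) ^ ((j : ℕ) + 1) with hf
  set S := ∑ i, θ.1 i with hS
  have hSpos : 0 < S := Finset.sum_pos (fun i _ => hθ.fst_pos i) ⟨0, Finset.mem_univ _⟩
  have hf1 : 0 < 1 - f := by linarith
  have hC0 : 0 < S * (ρ⁻¹) ^ p / (1 - f) := by positivity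
  -- The constant is the fixed point of C = S ρ^{-p} + C f, so the coefficient recursion reproduces
  -- the bound.
  refine ⟨S * (ρ⁻¹) ^ p / (1 - f), hC0, fun m => ?_⟩
  set C := S * (ρ⁻¹) ^ p / (1 - f) with hC
  have hCeq : S * (ρ⁻¹) ^ p + C * f = C := by
    have : 1 - f ≠ 0 := by linarith
    rw [hC]; field_simp; ring
  induction m using Nat.strong_induction_on with
  | _ m ih =>
    rw [coeff_succ]
    have h1 : archCoord m θ ≤ S * (ρ⁻¹) ^ p * ρ ^ (m + 1) := by
      rw [archCoord_apply]
      split_ifs with h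
      · have a1 : θ.1 ⟨m + 1, Nat.succ_lt_succ h⟩ ≤ S :=
          Finset.single_le_sum (f := θ.1) (fun i _ => (hθ.fst_pos i).le) (Finset.mem_univ _)
        have a2 : 1 ≤ (ρ⁻¹) ^ p * ρ ^ (m + 1) := by
          rw [inv_pow, ← div_eq_inv_mul, le_div_iff₀ (by positivity), one_mul]
          exact pow_le_pow_of_le_one hρ.le hρ1.le h
        nlinarith
      · positivity
    have h2 : (∑ j : Fin q, if (j : ℕ) < m then θ.2 j * coeff θ (m - j) else 0)
        ≤ C * f * ρ ^ (m + 1) := by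
      rw [hf, Finset.mul_sum, Finset.sum_mul]
      refine Finset.sum_le_sum fun j _ => ?_
      have hb := hθ.snd_pos j
      split_ifs with hj
      · obtain ⟨l, hl⟩ : ∃ l, m - j = l + 1 := ⟨m - j - 1, by omega⟩
        rw [hl]
        have hi := mul_le_mul_of_nonneg_left (ih l (by omega)) hb.le
        refine hi.trans (le_of_eq ?_)
        have hm : ρ ^ (m + 1) = ρ ^ ((j : ℕ) + 1) * ρ ^ (l + 1) := by
          rw [← pow_add]; congr 1; omega
        rw [hm, inv_pow]
        field_simp
      · positivity
    calc _ ≤ S * (ρ⁻¹) ^ p * ρ ^ (m + 1) + C * f * ρ ^ (m + 1) := add_le_add h1 h2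
      _ = _ := by rw [← add_mul, hCeq]

/-- Coordinatewise smallness from smallness in norm. -/
theorem isRelSmall_of_norm_le {θ h : Param p q} {a η : ℝ} (h1 : ∀ i, a ≤ θ.1 i)
    (h2 : ∀ j, a ≤ θ.2 j) (hη : 0 ≤ η) (hh : ‖h‖ ≤ η * a) : IsRelSmall θ h η := by
  constructor
  · intro i
    have : |h.1 i| ≤ ‖h‖ := (norm_le_pi_norm h.1 i).trans (norm_fst_le h)
    exact (this.trans hh).trans (mul_le_mul_of_nonneg_left (h1 i) hη)
  · intro i
    have : |h.2 i| ≤ ‖h‖ := (norm_le_pi_norm h.2 i).trans (norm_snd_le h)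
    exact (this.trans hh).trans (mul_le_mul_of_nonneg_left (h2 i) hη)

theorem abs_sum_snd_le (h : Param p q) : |∑ j, h.2 j| ≤ q * ‖h‖ := by
  refine (Finset.abs_sum_le_sum_abs _ _).trans ?_
  refine (Finset.sum_le_card_nsmul _ _ ‖h‖ fun j _ =>
    (norm_le_pi_norm h.2 j).trans (norm_snd_le h)).trans ?_
  simp

/-- Second order expansion of `u ↦ c₀(u)`. -/
theorem IsAdmissible.exists_abs_coeff_zero_sub_le {θ : Param p q} (hθ : IsAdmissible θ) :
    ∃ δ > 0, ∃ C : ℝ, 0 < C ∧ ∀ h : Param p q, ‖h‖ ≤ δ →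
      |coeff (θ + h) 0 - coeff θ 0 - coeffDeriv θ 0 h| ≤ C * ‖h‖ ^ 2
      ∧ coeff θ 0 / 2 ≤ coeff (θ + h) 0 := by
  set A := 1 - ∑ j, θ.2 j with hA
  have hApos : 0 < A := by linarith [hθ.sum_lt_one]
  have hs := hθ.fst_pos 0
  set s := θ.1 0
  have hq : (0 : ℝ) ≤ q := Nat.cast_nonneg q
  -- The first bound keeps the perturbed denominator above A / 2; the last one keeps c₀(θ + h) above
  -- c₀(θ) / 2.
  obtain ⟨δ, hδ, hδ1, hδ2⟩ : ∃ δ > 0, q * δ ≤ A / 2 ∧ (s / 2) * q * δ ≤ s / 2 * A ∧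
      A * δ + (s / 2) * (q * δ) ≤ s / 2 * A := by
    refine ⟨min (A / 2 / (q + 1)) (s / 2 * A / (A + (s / 2) * q)), by positivity, ?_, ?_⟩
    · calc q * min (A / 2 / (q + 1)) (s / 2 * A / (A + (s / 2) * q))
          ≤ (q + 1) * (A / 2 / (q + 1)) := by
            refine mul_le_mul (by linarith) (min_le_left _ _) (by positivity) (by positivity)
        _ = A / 2 := by field_simp
    · have h0 : (A + s / 2 * q) * min (A / 2 / (q + 1)) (s / 2 * A / (A + (s / 2) * q))
          ≤ s / 2 * A := by
        calc _ ≤ (A + s / 2 * q) * (s / 2 * A / (A + (s / 2) * q)) :=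
              mul_le_mul_of_nonneg_left (min_le_right _ _) (by positivity)
          _ = _ := by field_simp
      have h1 : 0 ≤ min (A / 2 / (q + 1)) (s / 2 * A / (A + (s / 2) * q)) := by positivity
      constructor
      · nlinarith [mul_nonneg hApos.le h1]
      · linarith
  set C1 := (q * A + s * q ^ 2) * 2 / A ^ 3 with hC1
  have hC1' : 0 ≤ C1 := by positivity
  -- The summand 1 keeps the constant positive when q = 0, where C1 vanishes.
  refine ⟨δ, hδ, C1 + 1, by linarith, fun h hh => ?_⟩
  have hn := norm_nonneg h
  have hH := abs_sum_snd_le h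
  have h0 : |h.1 0| ≤ ‖h‖ := (norm_le_pi_norm h.1 0).trans (norm_fst_le h)
  have hsum : ∑ j, (θ + h).2 j = ∑ j, θ.2 j + ∑ j, h.2 j := by
    rw [← Finset.sum_add_distrib]; rfl
  have hfst : (θ + h).1 0 = s + h.1 0 := rfl
  set H := ∑ j, h.2 j
  have hH2 : |H| ≤ A / 2 := hH.trans ((mul_le_mul_of_nonneg_left hh hq).trans hδ1)
  have hAH : A / 2 ≤ A - H := by linarith [(abs_le.1 hH2).2]
  have hAH0 : 0 < A - H := by linarith
  have hden : 1 - (∑ j, θ.2 j + H) = A - H := by rw [hA]; ring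
  rw [coeff_zero, coeff_zero, coeffDeriv_zero_apply, hsum, hfst, hden, ← hA]
  refine ⟨?_, ?_⟩
  · have e : (s + h.1 0) / (A - H) - s / A - (A⁻¹ * h.1 0 + s / A ^ 2 * H)
        = (h.1 0 * H * A + s * H ^ 2) / (A ^ 2 * (A - H)) := by
      field_simp
      ring
    rw [e, abs_div, abs_of_pos (by positivity : 0 < A ^ 2 * (A - H))]
    have n1 : |h.1 0 * H * A + s * H ^ 2| ≤ (q * A + s * q ^ 2) * ‖h‖ ^ 2 := by
      refine (abs_add_le _ _).trans ?_
      rw [abs_mul, abs_mul, abs_mul, abs_of_pos hApos, abs_of_pos hs, abs_pow]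
      have a1 : |h.1 0| * |H| ≤ ‖h‖ * (q * ‖h‖) := mul_le_mul h0 hH (abs_nonneg _) hn
      have a2 : |H| ^ 2 ≤ (q * ‖h‖) ^ 2 := pow_le_pow_left₀ (abs_nonneg _) hH 2
      nlinarith
    have n2 : A ^ 3 / 2 ≤ A ^ 2 * (A - H) := by nlinarith [sq_nonneg A]
    calc _ ≤ ((q * A + s * q ^ 2) * ‖h‖ ^ 2) / (A ^ 3 / 2) := by gcongr
      _ = C1 * ‖h‖ ^ 2 := by rw [hC1]; field_simp
      _ ≤ _ := by gcongr; linarith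
  · have b1 := (abs_le.1 h0).1
    have b2 := (abs_le.1 hH).1
    rw [div_div, div_le_div_iff₀ (by positivity) hAH0]
    have b3 : A * ‖h‖ + (s / 2) * (q * ‖h‖) ≤ s / 2 * A := by
      refine le_trans ?_ hδ2.2
      gcongr
    nlinarith

theorem IsAdmissible.exists_abs_coeffDeriv_zero_le {θ : Param p q} (hθ : IsAdmissible θ) :
    ∃ C : ℝ, 0 < C ∧ ∀ h : Param p q, |coeffDeriv θ 0 h| ≤ C * ‖h‖ := by
  have hA : 0 < 1 - ∑ j, θ.2 j := by linarith [hθ.sum_lt_one]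
  have hs := hθ.fst_pos 0
  refine ⟨(1 - ∑ j, θ.2 j)⁻¹ + θ.1 0 / (1 - ∑ j, θ.2 j) ^ 2 * q, by positivity, fun h => ?_⟩
  have h0 : |h.1 0| ≤ ‖h‖ := (norm_le_pi_norm h.1 0).trans (norm_fst_le h)
  have hH := abs_sum_snd_le h
  rw [coeffDeriv_zero_apply]
  refine (abs_add_le _ _).trans ?_
  rw [abs_mul, abs_mul, abs_of_pos (inv_pos.2 hA), abs_of_pos (by positivity :
    0 < θ.1 0 / (1 - ∑ j, θ.2 j) ^ 2), add_mul, mul_assoc _ (q : ℝ)]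
  gcongr

end Coefficients

/-! ### Processes that are functions of past innovations -/

section Causal

/-- The sequence with its first `n` terms removed. -/
def shift (n : ℕ) (x : ℕ → ℝ) : ℕ → ℝ := fun i => x (i + n)

@[fun_prop]
theorem measurable_shift (n : ℕ) : Measurable (shift n) := by
  unfold shift
  fun_prop

theorem measurePreserving_shift (m : Measure ℝ) [IsProbabilityMeasure m] (n : ℕ) :
    MeasurePreserving (shift n) (Measure.infinitePi fun _ : ℕ => m)
      (Measure.infinitePi fun _ : ℕ => m) :=
  ⟨measurable_shift n, Measure.map_infinitePi_infinitePi_of_inj (P := fun _ : ℕ => m)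
    (f := fun i : ℕ => i + n) (add_left_injective n)⟩

/-- The function `F` of a sequence depends on the first `n` terms only. -/
def IsWindow {E : Type*} (n : ℕ) (F : (ℕ → ℝ) → E) : Prop :=
  ∀ x y, (∀ i < n, x i = y i) → F x = F y

/-- The two functions are measurable with respect to disjoint sets of coordinates of a product
measure. -/
theorem indepFun_window_shift (m : Measure ℝ) [IsProbabilityMeasure m] {n : ℕ} {E E' : Type*}
    [MeasurableSpace E] [MeasurableSpace E'] {F : (ℕ → ℝ) → E} {G : (ℕ → ℝ) → E'}
    (hF : Measurable F) (hG : Measurable G) (hFn : IsWindow n F) :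
    IndepFun F (fun x => G (shift n x)) (Measure.infinitePi fun _ : ℕ => m) := by
  set ν := Measure.infinitePi fun _ : ℕ => m
  have hi : iIndepFun (fun (i : ℕ) (x : ℕ → ℝ) => x i) ν :=
    iIndepFun_infinitePi (X := fun _ x => x) (P := fun _ : ℕ => m) (by fun_prop)
  have hind := indep_iSup_of_disjoint (fun i => (measurable_pi_apply i).comap_le) hi
    (S := {i | i < n}) (T := {i | n ≤ i})
    (Set.disjoint_left.2 fun i (h1 : i < n) (h2 : n ≤ i) => absurd h1 (not_lt.2 h2))
  set mS : MeasurableSpace (ℕ → ℝ) :=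
    ⨆ i ∈ {i | i < n}, MeasurableSpace.comap (fun x : ℕ → ℝ => x i) inferInstance
  set mT : MeasurableSpace (ℕ → ℝ) :=
    ⨆ i ∈ {i | n ≤ i}, MeasurableSpace.comap (fun x : ℕ → ℝ => x i) inferInstance
  have h1 : ∀ i, i < n → Measurable[mS] fun x : ℕ → ℝ => x i := fun i hin =>
    (comap_measurable _).mono (le_iSup₂_of_le i hin le_rfl) le_rfl
  have h2 : ∀ i, n ≤ i → Measurable[mT] fun x : ℕ → ℝ => x i := fun i hin =>
    (comap_measurable _).mono (le_iSup₂_of_le i hin le_rfl) le_rfl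
  have hS : Measurable[mS, MeasurableSpace.pi] (fun (x : ℕ → ℝ) (i : ℕ) => if i < n then x i else 0) := by
    refine @measurable_pi_lambda _ _ _ mS (fun _ => inferInstance) _ fun i => ?_
    by_cases hin : i < n
    · simpa [hin] using h1 i hin
    · simp [hin]
  have hT : Measurable[mT, MeasurableSpace.pi] (shift n) :=
    @measurable_pi_lambda _ _ _ mT (fun _ => inferInstance) _ fun i => h2 (i + n) (by omega)
  have hFS : Measurable[mS] F := by
    -- Composing with the truncation map shows that F is measurable for the σ-algebra of the first n
    -- coordinates.
    have : F = fun x => F (fun i => if i < n then x i else 0) := by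
      funext x
      exact hFn _ _ fun i hin => by simp [hin]
    rw [this]
    exact hF.comp hS
  rw [IndepFun_iff_Indep]
  exact indep_of_indep_of_le_left (indep_of_indep_of_le_right hind (hG.comp hT).comap_le)
    hFS.comap_le

theorem lintegral_window_mul_shift (m : Measure ℝ) [IsProbabilityMeasure m] {n : ℕ}
    {F G : (ℕ → ℝ) → ENNReal} (hF : Measurable F) (hG : Measurable G) (hFn : IsWindow n F) :
    ∫⁻ x, F x * G (shift n x) ∂(Measure.infinitePi fun _ : ℕ => m)
      = (∫⁻ x, F x ∂(Measure.infinitePi fun _ : ℕ => m))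
        * ∫⁻ x, G x ∂(Measure.infinitePi fun _ : ℕ => m) := by
  have := lintegral_mul_eq_lintegral_mul_lintegral_of_indepFun hF
    (hG.comp (measurable_shift n)) (indepFun_window_shift m hF hG hFn)
  rw [← (measurePreserving_shift m n).lintegral_comp hG]
  exact this

variable {Ω : Type*} [MeasurableSpace Ω] {μ : Measure Ω} {ε : ℤ → Ω → ℝ}

/-- The sequence `(ε_t, ε_{t-1}, …)`. -/
def past (ε : ℤ → Ω → ℝ) (t : ℤ) (ω : Ω) : ℕ → ℝ := fun i => ε (t - i) ω

omit [MeasurableSpace Ω] in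
theorem shift_past (t : ℤ) (n : ℕ) (ω : Ω) : shift n (past ε t ω) = past ε (t - n) ω := by
  funext i
  simp only [shift, past]
  congr 1
  push_cast
  ring

/-- The law of `(ε_t, ε_{t-1}, …)`. -/
noncomputable def pastLaw (μ : Measure Ω) (ε : ℤ → Ω → ℝ) : Measure (ℕ → ℝ) :=
  Measure.infinitePi fun _ : ℕ => μ.map (ε 0)

theorem IsInnovation.isProbabilityMeasure_map [IsProbabilityMeasure μ] (hε : IsInnovation μ ε) :
    IsProbabilityMeasure (μ.map (ε 0)) :=
  Measure.isProbabilityMeasure_map (hε.measurable 0).aemeasurable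

theorem IsInnovation.isProbabilityMeasure_pastLaw [IsProbabilityMeasure μ]
    (hε : IsInnovation μ ε) : IsProbabilityMeasure (pastLaw μ ε) := by
  have := hε.isProbabilityMeasure_map
  unfold pastLaw
  infer_instance

theorem IsInnovation.measurable_past (hε : IsInnovation μ ε) (t : ℤ) : Measurable (past ε t) :=
  measurable_pi_lambda _ fun _ => hε.measurable _

theorem IsInnovation.measurePreserving_past [IsProbabilityMeasure μ] (hε : IsInnovation μ ε)
    (t : ℤ) : MeasurePreserving (past ε t) μ (pastLaw μ ε) := by
  refine ⟨hε.measurable_past t, ?_⟩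
  have hinj : Function.Injective fun i : ℕ => t - (i : ℤ) := fun i j h => by
    simpa using h
  have h := (hε.indep.precomp hinj).map_fun_eq_infinitePi_map fun i => hε.measurable _
  unfold pastLaw
  change μ.map (fun ω (i : ℕ) => ε (t - i) ω) = _
  rw [h]
  congr 1
  funext i
  exact (hε.identDistrib _).map_eq

/-- The process `Y` is a fixed measurable function of `(ε_t, ε_{t-1}, …)`, for every `t`. -/
def IsCausal {E : Type*} [MeasurableSpace E] (μ : Measure Ω) (ε : ℤ → Ω → ℝ) (Y : ℤ → Ω → E) :
    Prop :=
  ∃ f : (ℕ → ℝ) → E, Measurable f ∧ ∀ t, Y t =ᵐ[μ] fun ω => f (past ε t ω)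

variable {E E' : Type*} [MeasurableSpace E] [MeasurableSpace E'] {Y : ℤ → Ω → E} {Z : ℤ → Ω → E'}

theorem isCausal_innovation : IsCausal μ ε ε :=
  ⟨fun x => x 0, measurable_pi_apply 0, fun t => by
    refine Eventually.of_forall fun ω => ?_
    simp [past]⟩

theorem IsCausal.comp (hY : IsCausal μ ε Y) {g : E → E'} (hg : Measurable g) :
    IsCausal μ ε fun t ω => g (Y t ω) := by
  obtain ⟨f, hf, h⟩ := hY
  exact ⟨fun x => g (f x), hg.comp hf, fun t => (h t).mono fun ω hω => by simp [hω]⟩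

theorem IsCausal.prodMk (hY : IsCausal μ ε Y) (hZ : IsCausal μ ε Z) :
    IsCausal μ ε fun t ω => (Y t ω, Z t ω) := by
  obtain ⟨f, hf, h⟩ := hY
  obtain ⟨g, hg, h'⟩ := hZ
  refine ⟨fun x => (f x, g x), hf.prodMk hg, fun t => ?_⟩
  filter_upwards [h t, h' t] with ω h1 h2
  rw [h1, h2]

theorem isCausal_const (c : E) : IsCausal μ ε fun _ _ => c :=
  ⟨fun _ => c, measurable_const, fun _ => Eventually.of_forall fun _ => rfl⟩

theorem IsCausal.lag (hY : IsCausal μ ε Y) (n : ℕ) : IsCausal μ ε fun t => Y (t - n) := by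
  obtain ⟨f, hf, h⟩ := hY
  refine ⟨fun x => f (shift n x), hf.comp (measurable_shift n), fun t => ?_⟩
  filter_upwards [h (t - n)] with ω hω
  rw [hω, shift_past]

theorem IsCausal.add {Y Z : ℤ → Ω → ℝ} (hY : IsCausal μ ε Y) (hZ : IsCausal μ ε Z) :
    IsCausal μ ε fun t ω => Y t ω + Z t ω :=
  (hY.prodMk hZ).comp (g := fun x => x.1 + x.2) (by fun_prop)

theorem IsCausal.mul {Y Z : ℤ → Ω → ℝ} (hY : IsCausal μ ε Y) (hZ : IsCausal μ ε Z) :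
    IsCausal μ ε fun t ω => Y t ω * Z t ω :=
  (hY.prodMk hZ).comp (g := fun x => x.1 * x.2) (by fun_prop)

theorem IsCausal.div {Y Z : ℤ → Ω → ℝ} (hY : IsCausal μ ε Y) (hZ : IsCausal μ ε Z) :
    IsCausal μ ε fun t ω => Y t ω / Z t ω :=
  (hY.prodMk hZ).comp (g := fun x => x.1 / x.2) (by fun_prop)

theorem isCausal_sum {ι : Type*} (s : Finset ι) {Y : ι → ℤ → Ω → ℝ}
    (hY : ∀ i, IsCausal μ ε (Y i)) : IsCausal μ ε fun t ω => ∑ i ∈ s, Y i t ω := by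
  classical
  induction s using Finset.induction_on with
  | empty => simpa using isCausal_const (0 : ℝ)
  | insert a s ha ih =>
    simp only [Finset.sum_insert ha]
    exact (hY a).add ih

theorem IsCausal.aemeasurable (hε : IsInnovation μ ε) (hY : IsCausal μ ε Y) (t : ℤ) :
    AEMeasurable (Y t) μ := by
  obtain ⟨f, hf, h⟩ := hY
  exact ⟨_, hf.comp (hε.measurable_past t), h t⟩

section

variable [IsProbabilityMeasure μ]

theorem IsCausal.identDistrib (hε : IsInnovation μ ε) (hY : IsCausal μ ε Y) (s t : ℤ) :
    IdentDistrib (Y s) (Y t) μ μ := by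
  refine ⟨hY.aemeasurable hε s, hY.aemeasurable hε t, ?_⟩
  obtain ⟨f, hf, h⟩ := hY
  rw [Measure.map_congr (h s), Measure.map_congr (h t)]
  have e : ∀ u, μ.map (fun ω => f (past ε u ω)) = (pastLaw μ ε).map f := fun u => by
    rw [← (hε.measurePreserving_past u).map_eq, Measure.map_map hf (hε.measurable_past u)]
    rfl
  rw [e, e]

omit [IsProbabilityMeasure μ] in
theorem indepFun_comp_of_measurePreserving {α : Type*} [MeasurableSpace α] {ν : Measure α}
    {φ : Ω → α} (hφ : MeasurePreserving φ μ ν) {F : α → E} {G : α → E'} (hF : Measurable F)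
    (hG : Measurable G) (h : IndepFun F G ν) :
    IndepFun (fun ω => F (φ ω)) (fun ω => G (φ ω)) μ := by
  rw [indepFun_iff_measure_inter_preimage_eq_mul] at h ⊢
  intro s t hs ht
  have := h s t hs ht
  rw [← hφ.measure_preimage ((hF hs).inter (hG ht)).nullMeasurableSet,
    ← hφ.measure_preimage (hF hs).nullMeasurableSet,
    ← hφ.measure_preimage (hG ht).nullMeasurableSet] at this
  exact this

/-- The innovation at time `t` is independent of the causal process before `t`. -/
theorem IsCausal.indepFun_innovation (hε : IsInnovation μ ε) (hY : IsCausal μ ε Y) (t : ℤ) :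
    IndepFun (ε t) (Y (t - 1)) μ := by
  obtain ⟨f, hf, h⟩ := hY
  have hp := hε.isProbabilityMeasure_map
  have hi := indepFun_window_shift (μ.map (ε 0)) (n := 1) (measurable_pi_apply 0) hf
    (fun x y hxy => hxy 0 one_pos)
  have h2 := indepFun_comp_of_measurePreserving (hε.measurePreserving_past t)
    (measurable_pi_apply 0) (hf.comp (measurable_shift 1)) hi
  refine h2.congr (Eventually.of_forall fun ω => ?_) ?_
  · simp [past]
  · filter_upwards [h (t - 1)] with ω hω
    rw [hω]
    simp [shift_past]

/-- A limit in probability of causal processes is causal. -/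
theorem isCausal_of_tendstoInMeasure (hε : IsInnovation μ ε) {Yn : ℕ → ℤ → Ω → ℝ}
    {Y : ℤ → Ω → ℝ} (hYn : ∀ n, IsCausal μ ε (Yn n))
    (h : ∀ t, TendstoInMeasure μ (fun n => Yn n t) atTop (Y t)) : IsCausal μ ε Y := by
  choose f hf hfY using hYn
  have h' : ∀ t, TendstoInMeasure μ (fun n ω => f n (past ε t ω)) atTop (Y t) := fun t =>
    (h t).congr_left fun n => hfY n t
  -- A subsequence chosen at time 0 suffices: almost sure convergence transfers to sequence space,
  -- and from there to every t, because all pasts have the same law.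
  obtain ⟨ns, hns, hlim⟩ := (h' 0).exists_seq_tendsto_ae
  have hν : ∀ᵐ x ∂(pastLaw μ ε), ∃ l : ℝ, Tendsto (fun n => f (ns n) x) atTop (𝓝 l) := by
    rw [← (hε.measurePreserving_past 0).map_eq, ae_map_iff (hε.measurable_past 0).aemeasurable
      (measurableSet_exists_tendsto fun n => hf (ns n))]
    exact hlim.mono fun ω hω => ⟨_, hω⟩
  obtain ⟨F, hF, hFlim⟩ := measurable_limit_of_tendsto_metrizable_ae
    (fun n => (hf (ns n)).aemeasurable) hν
  refine ⟨F, hF, fun t => ?_⟩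
  have h1 : ∀ᵐ ω ∂μ, Tendsto (fun n => f (ns n) (past ε t ω)) atTop (𝓝 (F (past ε t ω))) :=
    (hε.measurePreserving_past t).quasiMeasurePreserving.ae hFlim
  have h2 : TendstoInMeasure μ (fun n ω => f (ns n) (past ε t ω)) atTop
      fun ω => F (past ε t ω) :=
    tendstoInMeasure_of_tendsto_ae
      (fun n => ((hf (ns n)).comp (hε.measurable_past t)).aestronglyMeasurable) h1
  exact tendstoInMeasure_ae_unique ((h' t).comp hns.tendsto_atTop) h2

theorem isCausal_of_tendsto_ae (hε : IsInnovation μ ε) {Yn : ℕ → ℤ → Ω → ℝ}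
    {Y : ℤ → Ω → ℝ} (hYn : ∀ n, IsCausal μ ε (Yn n))
    (h : ∀ t, ∀ᵐ ω ∂μ, Tendsto (fun n => Yn n t ω) atTop (𝓝 (Y t ω))) : IsCausal μ ε Y :=
  isCausal_of_tendstoInMeasure hε hYn fun t => tendstoInMeasure_of_tendsto_ae
    (fun n => ((hYn n).aemeasurable hε t).aestronglyMeasurable) (h t)

end

end Causal

/-! ### A weak law of large numbers uniform over partial sums -/

section MaximalLLN

variable {Ω : Type*} [MeasurableSpace Ω] {μ : Measure Ω} [IsProbabilityMeasure μ]

theorem sum_range_mul_add (f : ℕ → ℝ) (L a : ℕ) :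
    ∑ i ∈ Finset.range (a * L), f i
      = ∑ b ∈ Finset.range a, ∑ i ∈ Finset.range L, f (b * L + i) := by
  induction a with
  | zero => simp
  | succ a ih => rw [Finset.sum_range_succ, ← ih, Nat.succ_mul, Finset.sum_range_add]

/-- The right side does not depend on j: complete blocks are added in absolute value up to n, and
the incomplete one is bounded trivially. This replaces a maximal inequality. -/
theorem abs_sum_range_le_blocks (f : ℕ → ℝ) {B : ℝ} (hB : ∀ i, |f i| ≤ B) {L : ℕ} (hL : 0 < L)
    {j n : ℕ} (hj : j ≤ n) :
    |∑ i ∈ Finset.range j, f i|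
      ≤ (∑ b ∈ Finset.range (n / L), |∑ i ∈ Finset.range L, f (b * L + i)|) + L * B := by
  have hB0 : 0 ≤ B := (abs_nonneg _).trans (hB 0)
  conv_lhs => rw [← Nat.div_add_mod' j L, Finset.sum_range_add, sum_range_mul_add]
  refine (abs_add_le _ _).trans (add_le_add ?_ ?_)
  · refine (Finset.abs_sum_le_sum_abs _ _).trans ?_
    exact Finset.sum_le_sum_of_subset_of_nonneg
      (Finset.range_mono (Nat.div_le_div_right hj)) fun _ _ _ => abs_nonneg _
  · refine (Finset.abs_sum_le_sum_abs _ _).trans ?_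
    refine (Finset.sum_le_card_nsmul _ _ B fun i _ => hB _).trans ?_
    rw [Finset.card_range, nsmul_eq_mul]
    exact mul_le_mul_of_nonneg_right (by exact_mod_cast (Nat.mod_lt j hL).le) hB0

/-- Second moment of a sum of bounded variables with correlations of finite range. -/
theorem integral_sq_sum_range_le {Y : ℕ → Ω → ℝ} {B : ℝ} {m : ℕ} (hY : ∀ i, Measurable (Y i))
    (hB : ∀ i ω, |Y i ω| ≤ B) (hcov : ∀ i j, i + m ≤ j → ∫ ω, Y i ω * Y j ω ∂μ = 0) (L : ℕ) :
    ∫ ω, (∑ i ∈ Finset.range L, Y i ω) ^ 2 ∂μ ≤ L * (2 * m * B ^ 2) := by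
  have hint : ∀ i j, Integrable (fun ω => Y i ω * Y j ω) μ := fun i j =>
    Integrable.of_bound ((hY i).mul (hY j)).aestronglyMeasurable (B * B)
      (Eventually.of_forall fun ω => by
        rw [Real.norm_eq_abs, abs_mul]
        exact mul_le_mul (hB i ω) (hB j ω) (abs_nonneg _) ((abs_nonneg _).trans (hB i ω)))
  have hle : ∀ i j, ∫ ω, Y i ω * Y j ω ∂μ ≤ B ^ 2 := fun i j => by
    calc _ ≤ ∫ _, B ^ 2 ∂μ := by
          refine integral_mono (hint i j) (integrable_const _) fun ω => ?_
          refine (le_abs_self _).trans ?_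
          simp only [abs_mul, sq]
          exact mul_le_mul (hB i ω) (hB j ω) (abs_nonneg _) ((abs_nonneg _).trans (hB i ω))
      _ = B ^ 2 := by simp
  simp only [sq, Finset.sum_mul_sum]
  rw [integral_finsetSum _ fun i _ => integrable_finsetSum _ fun j _ => hint i j]
  have hi : ∀ i ∈ Finset.range L,
      ∫ ω, ∑ j ∈ Finset.range L, Y i ω * Y j ω ∂μ ≤ 2 * m * (B * B) := by
    intro i _
    rw [integral_finsetSum _ fun j _ => hint i j]
    -- Only indices at distance less than m from i contribute, at most 2m of them.
    calc ∑ j ∈ Finset.range L, ∫ ω, Y i ω * Y j ω ∂μ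
        ≤ ∑ j ∈ Finset.range L, if j ∈ Finset.Ico (i + 1 - m) (i + m) then B ^ 2 else 0 := by
          refine Finset.sum_le_sum fun j _ => ?_
          split_ifs with h
          · exact hle i j
          · rw [Finset.mem_Ico, not_and_or, not_le, not_lt] at h
            rcases h with h | h
            · have := hcov j i (by omega)
              simp only [mul_comm (Y i _)]
              exact this.le
            · exact (hcov i j h).le
      _ ≤ ∑ j ∈ Finset.Ico (i + 1 - m) (i + m), B ^ 2 := by
          rw [← Finset.sum_filter]
          refine Finset.sum_le_sum_of_subset_of_nonneg (fun j hj => (Finset.mem_filter.1 hj).2)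
            fun _ _ _ => sq_nonneg _
      _ ≤ 2 * m * (B * B) := by
          rw [Finset.sum_const, nsmul_eq_mul, Nat.card_Ico, sq]
          refine mul_le_mul_of_nonneg_right ?_ (mul_self_nonneg B)
          exact_mod_cast (by omega : i + m - (i + 1 - m) ≤ 2 * m)
  refine (Finset.sum_le_card_nsmul _ _ _ hi).trans ?_
  rw [Finset.card_range, nsmul_eq_mul]

theorem integral_abs_sum_range_le {Y : ℕ → Ω → ℝ} {B : ℝ} {m : ℕ} (hY : ∀ i, Measurable (Y i))
    (hB : ∀ i ω, |Y i ω| ≤ B) (hcov : ∀ i j, i + m ≤ j → ∫ ω, Y i ω * Y j ω ∂μ = 0) {L : ℕ}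
    (hL : 0 < L) :
    ∫ ω, |∑ i ∈ Finset.range L, Y i ω| ∂μ ≤ √L * (m * B ^ 2 + 1) := by
  have hs : 0 < √(L : ℝ) := Real.sqrt_pos.2 (by exact_mod_cast hL)
  have hss : √(L : ℝ) * √(L : ℝ) = L := Real.mul_self_sqrt (Nat.cast_nonneg L)
  have hmeas : Measurable fun ω => ∑ i ∈ Finset.range L, Y i ω :=
    Finset.measurable_sum _ fun i _ => hY i
  have hb : ∀ ω, |∑ i ∈ Finset.range L, Y i ω| ≤ L * B := fun ω => by
    refine (Finset.abs_sum_le_sum_abs _ _).trans ?_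
    refine (Finset.sum_le_card_nsmul _ _ B fun i _ => hB _ _).trans ?_
    simp
  have i1 : Integrable (fun ω => |∑ i ∈ Finset.range L, Y i ω|) μ :=
    Integrable.of_bound (by fun_prop) (L * B) (Eventually.of_forall fun ω => by
      simpa using hb ω)
  have i2 : Integrable (fun ω => (∑ i ∈ Finset.range L, Y i ω) ^ 2) μ :=
    Integrable.of_bound (by fun_prop) ((L * B) ^ 2) (Eventually.of_forall fun ω => by
      rw [Real.norm_eq_abs, abs_pow]
      exact pow_le_pow_left₀ (abs_nonneg _) (hb ω) 2)
  have h2 := integral_sq_sum_range_le hY hB hcov L (μ := μ)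
  -- Pointwise |S| ≤ S² / (2√L) + √L / 2, which passes from the second moment to the first.
  calc ∫ ω, |∑ i ∈ Finset.range L, Y i ω| ∂μ
      ≤ ∫ ω, ((∑ i ∈ Finset.range L, Y i ω) ^ 2 * (2 * √L)⁻¹ + √L / 2) ∂μ := by
        refine integral_mono i1 ((i2.mul_const _).add (integrable_const _)) fun ω => ?_
        set S := ∑ i ∈ Finset.range L, Y i ω
        have e : S ^ 2 * (2 * √(L : ℝ))⁻¹ + √L / 2 = (S ^ 2 + √L ^ 2) / (2 * √L) := by
          field_simp
        change |S| ≤ _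
        rw [e, le_div_iff₀ (by positivity)]
        nlinarith [sq_nonneg (|S| - √L), sq_abs S]
    _ = (∫ ω, (∑ i ∈ Finset.range L, Y i ω) ^ 2 ∂μ) * (2 * √L)⁻¹ + √L / 2 := by
        rw [integral_add (i2.mul_const _) (integrable_const _), integral_mul_const]
        simp
    _ ≤ (L * (2 * m * B ^ 2)) * (2 * √L)⁻¹ + √L / 2 := by gcongr
    _ = √L * (m * B ^ 2 + 1 / 2) := by
        clear * - hs hss
        generalize √(L : ℝ) = r at *
        rw [← hss]
        field_simp
    _ ≤ _ := by gcongr; norm_num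

/-- About n / L blocks, each of mean absolute sum O(√L), contribute O(n / √L). Fixing L large makes
this small against δ n by Markov's inequality, and the leftover block, of size L B, is negligible
for large n. -/
theorem eventually_measureReal_max_sum_le {Y : ℕ → Ω → ℝ} {B : ℝ} {m : ℕ}
    (hY : ∀ i, Measurable (Y i)) (hB : ∀ i ω, |Y i ω| ≤ B)
    (hcov : ∀ i j, i + m ≤ j → ∫ ω, Y i ω * Y j ω ∂μ = 0) {δ η : ℝ} (hδ : 0 < δ) (hη : 0 < η) :
    ∀ᶠ n : ℕ in atTop,
      μ.real {ω | ∃ j ≤ n, δ * n < |∑ i ∈ Finset.range j, Y i ω|} ≤ η := by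
  set K := m * B ^ 2 + 1 with hK
  have hK0 : 0 < K := by positivity
  obtain ⟨L, hL, hLη⟩ : ∃ L : ℕ, 0 < L ∧ 2 * K / δ ≤ η * √L := by
    have h := ((Real.tendsto_sqrt_atTop.comp tendsto_natCast_atTop_atTop).const_mul_atTop
      hη).eventually_ge_atTop (2 * K / δ)
    obtain ⟨L, h1, h2⟩ := (h.and (eventually_gt_atTop 0)).exists
    exact ⟨L, h2, h1⟩
  have hLr : (0 : ℝ) < L := by exact_mod_cast hL
  have hs : 0 < √(L : ℝ) := Real.sqrt_pos.2 hLr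
  have hss : √(L : ℝ) * √(L : ℝ) = L := Real.mul_self_sqrt (Nat.cast_nonneg L)
  filter_upwards [(tendsto_natCast_atTop_atTop.const_mul_atTop
    (half_pos hδ)).eventually_ge_atTop (L * B), eventually_gt_atTop 0] with n hn hn0
  have hnr : (0 : ℝ) < n := by exact_mod_cast hn0
  set T : Ω → ℝ := fun ω => ∑ b ∈ Finset.range (n / L), |∑ i ∈ Finset.range L, Y (b * L + i) ω|
  have hbm : ∀ b, Measurable fun ω => |∑ i ∈ Finset.range L, Y (b * L + i) ω| := fun b =>
    (Finset.measurable_sum _ fun i _ => hY _).norm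
  have hbi : ∀ b, Integrable (fun ω => |∑ i ∈ Finset.range L, Y (b * L + i) ω|) μ := fun b =>
    Integrable.of_bound (hbm b).aestronglyMeasurable (L * B) (Eventually.of_forall fun ω => by
      rw [Real.norm_eq_abs, abs_abs]
      refine (Finset.abs_sum_le_sum_abs _ _).trans ?_
      refine (Finset.sum_le_card_nsmul _ _ B fun i _ => hB _ _).trans ?_
      simp)
  have hTi : Integrable T μ := integrable_finsetSum _ fun b _ => hbi b
  have hTint : ∫ ω, T ω ∂μ ≤ n / √L * K := by
    rw [integral_finsetSum _ fun b _ => hbi b]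
    have hb : ∀ b ∈ Finset.range (n / L),
        ∫ ω, |∑ i ∈ Finset.range L, Y (b * L + i) ω| ∂μ ≤ √L * K := fun b _ =>
      integral_abs_sum_range_le (Y := fun i => Y (b * L + i)) (fun i => hY _) (fun i => hB _)
        (fun i j hij => hcov _ _ (by omega)) hL
    refine (Finset.sum_le_card_nsmul _ _ _ hb).trans ?_
    rw [Finset.card_range, nsmul_eq_mul]
    have : ((n / L : ℕ) : ℝ) ≤ n / L := Nat.cast_div_le
    calc _ ≤ (n / L : ℝ) * (√L * K) := by gcongr
      _ = _ := by
        clear * - hs hss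
        generalize √(L : ℝ) = r at *
        rw [← hss]
        field_simp
  have hsub : {ω | ∃ j ≤ n, δ * n < |∑ i ∈ Finset.range j, Y i ω|}
      ⊆ {ω | δ / 2 * n ≤ T ω} := by
    rintro ω ⟨j, hj, hlt⟩
    have := abs_sum_range_le_blocks (fun i => Y i ω) (fun i => hB i ω) hL hj
    change δ / 2 * n ≤ ∑ b ∈ Finset.range (n / L), _
    linarith
  have hM := mul_meas_ge_le_integral_of_nonneg (μ := μ)
    (Eventually.of_forall fun ω => Finset.sum_nonneg fun b _ => abs_nonneg _) hTi (δ / 2 * n)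
  refine (measureReal_mono hsub).trans ?_
  have h3 : δ / 2 * n * μ.real {ω | δ / 2 * n ≤ T ω} ≤ n / √L * K := hM.trans hTint
  have h4 : n / √L * K ≤ δ / 2 * n * η := by
    rw [div_mul_eq_mul_div, div_le_iff₀ hs]
    rw [div_le_iff₀ hδ] at hLη
    nlinarith
  exact le_of_mul_le_mul_left (h3.trans h4) (by positivity)

/-- Approximation in mean by bounded functions of finitely many coordinates. -/
theorem exists_window_approx {ν : Measure (ℕ → ℝ)} [IsProbabilityMeasure ν] {f : (ℕ → ℝ) → ℝ}
    (hf : Integrable f ν) {κ : ℝ} (hκ : 0 < κ) :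
    ∃ (m : ℕ) (g : (ℕ → ℝ) → ℝ) (B : ℝ), Measurable g ∧ (∀ x, |g x| ≤ B) ∧ IsWindow m g ∧
      ∫ x, |f x - g x| ∂ν ≤ κ := by
  obtain ⟨g, hg, hgi⟩ := hf.exists_boundedContinuous_integral_sub_le (half_pos hκ)
  -- Setting all coordinates from m on to zero converges pointwise in the product topology, so
  -- continuity and boundedness of g give convergence in mean.
  set tr : ℕ → (ℕ → ℝ) → (ℕ → ℝ) := fun m x i => if i < m then x i else 0 with htr
  have htrm : ∀ m, Measurable (tr m) := fun m => measurable_pi_lambda _ fun i => by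
    by_cases h : i < m
    · simpa [htr, h] using measurable_pi_apply i
    · simp [htr, h]
  have hgm : ∀ m, Measurable fun x => g (tr m x) := fun m => g.continuous.measurable.comp (htrm m)
  have hb : ∀ x, |g x| ≤ ‖g‖ := fun x => g.norm_coe_le_norm x
  have hlim : Tendsto (fun m => ∫ x, |g x - g (tr m x)| ∂ν) atTop (𝓝 (∫ _, (0 : ℝ) ∂ν)) := by
    refine tendsto_integral_of_dominated_convergence (fun _ => 2 * ‖g‖)
      (fun m => ((g.continuous.measurable.sub (hgm m)).norm).aestronglyMeasurable)
      (integrable_const _) (fun m => Eventually.of_forall fun x => ?_)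
      (Eventually.of_forall fun x => ?_)
    · rw [Real.norm_eq_abs, abs_abs]
      have := abs_sub (g x) (g (tr m x))
      linarith [hb x, hb (tr m x)]
    · have h1 : Tendsto (fun m => tr m x) atTop (𝓝 x) := by
        refine tendsto_pi_nhds.2 fun i => tendsto_const_nhds.congr' ?_
        filter_upwards [eventually_gt_atTop i] with m hm
        simp [htr, hm]
      have h2 := (g.continuous.tendsto x).comp h1
      have h3 := ((tendsto_const_nhds (x := g x)).sub h2).abs
      simpa using h3
  rw [integral_zero] at hlim
  obtain ⟨m, hm⟩ := (hlim.eventually_lt_const (half_pos hκ)).exists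
  refine ⟨m, fun x => g (tr m x), ‖g‖, hgm m, fun x => hb _, fun x y hxy => ?_, ?_⟩
  · have : tr m x = tr m y := by
      funext i
      simp only [htr]
      split_ifs with h
      · exact hxy i h
      · rfl
    simp only [this]
  · have hgi' : Integrable (fun x => g (tr m x)) ν :=
      Integrable.of_bound (hgm m).aestronglyMeasurable ‖g‖ (Eventually.of_forall fun x => hb _)
    calc ∫ x, |f x - g (tr m x)| ∂ν ≤ ∫ x, (‖f x - g x‖ + |g x - g (tr m x)|) ∂ν := by
          refine integral_mono (hf.sub hgi').norm ((hf.sub hgi).norm.add (hgi.sub hgi').norm)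
            fun x => ?_
          exact abs_sub_le _ _ _
      _ = ∫ x, ‖f x - g x‖ ∂ν + ∫ x, |g x - g (tr m x)| ∂ν :=
          integral_add (hf.sub hgi).norm (hgi.sub hgi').norm
      _ ≤ κ := by linarith

variable {ε : ℤ → Ω → ℝ}

theorem IsInnovation.integral_past (hε : IsInnovation μ ε) {f : (ℕ → ℝ) → ℝ} (hf : Measurable f)
    (t : ℤ) : ∫ ω, f (past ε t ω) ∂μ = ∫ x, f x ∂(pastLaw μ ε) := by
  rw [← (hε.measurePreserving_past t).map_eq,
    integral_map (hε.measurable_past t).aemeasurable hf.aestronglyMeasurable]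

/-- Uniform weak law of large numbers for the partial sums of a causal process. -/
theorem IsCausal.eventually_measureReal_max_le (hε : IsInnovation μ ε) {Y : ℤ → Ω → ℝ}
    (hY : IsCausal μ ε Y) (hint : Integrable (Y 0) μ) {δ η : ℝ} (hδ : 0 < δ) (hη : 0 < η) :
    ∀ᶠ n : ℕ in atTop, μ.real {ω | ∃ j ≤ n,
      δ * n < |∑ i ∈ Finset.range j, Y ((i : ℤ) + 1) ω - j * ∫ ω, Y 0 ω ∂μ|} ≤ η := by
  obtain ⟨f, hf, hYf⟩ := hY
  have hp := hε.isProbabilityMeasure_pastLaw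
  have hp' := hε.isProbabilityMeasure_map
  set ν := pastLaw μ ε with hν
  have hmp := hε.measurePreserving_past
  have hfi : Integrable f ν := by
    have := hint.congr (hYf 0)
    exact ((hmp 0).integrable_comp hf.aestronglyMeasurable).1 this
  have hc : ∫ ω, Y 0 ω ∂μ = ∫ x, f x ∂ν := by
    rw [integral_congr_ae (hYf 0), hε.integral_past hf]
  rw [hc]
  -- The first bound controls the drift caused by replacing the mean of f by that of g; the second
  -- makes Markov's inequality for D give η / 2.
  set κ := min (δ / 3) (δ * η / 6) with hκdef
  have hκ : 0 < κ := by positivity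
  have hκ1 : κ ≤ δ / 3 := min_le_left _ _
  have hκ2 : κ ≤ δ * η / 6 := min_le_right _ _
  obtain ⟨m, g, B, hg, hB, hgm, hfg⟩ := exists_window_approx hfi hκ
  have hgi : Integrable g ν :=
    Integrable.of_bound hg.aestronglyMeasurable B (Eventually.of_forall hB)
  set c := ∫ x, f x ∂ν
  set d := ∫ x, g x ∂ν with hd
  have hcd : |c - d| ≤ κ := by
    rw [← integral_sub hfi hgi]
    exact (abs_integral_le_integral_abs).trans hfg
  have hd_le : |d| ≤ B := by
    have h := abs_integral_le_integral_abs (f := g) (μ := ν)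
    have h2 : ∫ x, |g x| ∂ν ≤ ∫ _, B ∂ν :=
      integral_mono hgi.norm (integrable_const _) fun x => hB x
    simp only [integral_const, probReal_univ, one_smul] at h2
    exact h.trans h2
  set G : ℕ → Ω → ℝ := fun i ω => g (past ε ((i : ℤ) + 1) ω) - d with hG
  have hGm : ∀ i, Measurable (G i) := fun i =>
    (hg.comp (hε.measurable_past _)).sub_const d
  have hGB : ∀ i ω, |G i ω| ≤ 2 * B := fun i ω => by
    have := abs_sub (g (past ε ((i : ℤ) + 1) ω)) d
    simp only [hG]
    linarith [hB (past ε ((i : ℤ) + 1) ω)]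
  -- Seen from time j + 1, the earlier factor is a function of the sequence shifted by j - i ≥ m,
  -- hence independent of the window of the later one.
  have hcov : ∀ i j, i + m ≤ j → ∫ ω, G i ω * G j ω ∂μ = 0 := by
    intro i j hij
    set F : (ℕ → ℝ) → ℝ := fun x => g x - d with hF
    have hFm : Measurable F := hg.sub_const d
    have hF0 : ∫ x, F x ∂ν = 0 := by
      rw [integral_sub hgi (integrable_const _)]
      simp [hd]
    have hw : IsWindow (j - i) F := fun x y hxy => by
      simp only [hF, hgm x y fun i' hi' => hxy i' (by omega)]
    have hi := indepFun_window_shift (μ.map (ε 0)) hFm hFm hw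
    have e : ∀ ω, G i ω * G j ω = (fun x => F x * F (shift (j - i) x)) (past ε ((j : ℤ) + 1) ω) := by
      intro ω
      have : (j : ℤ) + 1 - ((j - i : ℕ) : ℤ) = i + 1 := by omega
      simp only [shift_past, this, hG, hF]
      ring
    simp only [e]
    rw [hε.integral_past (f := fun x => F x * F (shift (j - i) x))
      (hFm.mul (hFm.comp (measurable_shift _)))]
    have := hi.integral_fun_mul_eq_mul_integral hFm.aestronglyMeasurable
      (hFm.comp (measurable_shift _)).aestronglyMeasurable
    refine this.trans ?_
    change (∫ x, F x ∂ν) * _ = 0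
    rw [hF0, zero_mul]
  have hY' : ∀ᵐ ω ∂μ, ∀ i : ℕ, Y ((i : ℤ) + 1) ω = f (past ε ((i : ℤ) + 1) ω) :=
    ae_all_iff.2 fun i => hYf _
  filter_upwards [eventually_measureReal_max_sum_le hGm hGB hcov (div_pos hδ three_pos)
    (half_pos hη) (μ := μ), eventually_gt_atTop 0] with n hn hn0
  have hnr : (0 : ℝ) < n := by exact_mod_cast hn0
  set D : Ω → ℝ := fun ω => ∑ i ∈ Finset.range n,
    |f (past ε ((i : ℤ) + 1) ω) - g (past ε ((i : ℤ) + 1) ω)| with hD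
  have hfgm : Measurable fun x => |f x - g x| := (hf.sub hg).norm
  have hDi' : ∀ i : ℕ, Integrable (fun ω => |f (past ε ((i : ℤ) + 1) ω)
      - g (past ε ((i : ℤ) + 1) ω)|) μ := fun i =>
    ((hmp ((i : ℤ) + 1)).integrable_comp hfgm.aestronglyMeasurable).2 (hfi.sub hgi).norm
  have hDi : Integrable D μ := integrable_finsetSum _ fun i _ => hDi' i
  have hDint : ∫ ω, D ω ∂μ ≤ n * κ := by
    rw [integral_finsetSum _ fun i _ => hDi' i]
    refine (Finset.sum_le_card_nsmul _ _ κ fun i _ => ?_).trans (by simp)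
    rw [hε.integral_past hfgm]
    exact hfg
  have hM := mul_meas_ge_le_integral_of_nonneg (μ := μ)
    (Eventually.of_forall fun ω => Finset.sum_nonneg fun b _ => abs_nonneg _) hDi (δ / 3 * n)
  have hM' : μ.real {ω | δ / 3 * n ≤ D ω} ≤ η / 2 := by
    refine le_of_mul_le_mul_left ((hM.trans hDint).trans ?_)
      (by positivity : 0 < δ / 3 * (n : ℝ))
    nlinarith
  have hsub : {ω | ∃ j ≤ n, δ * n < |∑ i ∈ Finset.range j, Y ((i : ℤ) + 1) ω - j * c|}
      ≤ᵐ[μ] ({ω | ∃ j ≤ n, δ / 3 * n < |∑ i ∈ Finset.range j, G i ω|}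
        ∪ {ω | δ / 3 * n ≤ D ω} : Set Ω) := by
    filter_upwards [hY'] with ω hω
    rintro ⟨j, hj, hlt⟩
    by_contra hcon
    have hcon' : ¬ ((∃ j ≤ n, δ / 3 * n < |∑ i ∈ Finset.range j, G i ω|) ∨ δ / 3 * n ≤ D ω) :=
      hcon
    push Not at hcon'
    have h1 := hcon'.1 j hj
    have h2 := hcon'.2
    have hjn : (j : ℝ) ≤ n := by exact_mod_cast hj
    -- Fluctuation of the window process, approximation error and difference of means, each allowed
    -- δ n / 3.
    have e : ∑ i ∈ Finset.range j, Y ((i : ℤ) + 1) ω - j * c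
        = ∑ i ∈ Finset.range j, G i ω + ∑ i ∈ Finset.range j,
          (f (past ε ((i : ℤ) + 1) ω) - g (past ε ((i : ℤ) + 1) ω)) - j * (c - d) := by
      simp only [hω, hG, Finset.sum_sub_distrib, Finset.sum_const, Finset.card_range, nsmul_eq_mul]
      ring
    have h3 : |∑ i ∈ Finset.range j,
        (f (past ε ((i : ℤ) + 1) ω) - g (past ε ((i : ℤ) + 1) ω))| ≤ D ω := by
      refine (Finset.abs_sum_le_sum_abs _ _).trans ?_
      exact Finset.sum_le_sum_of_subset_of_nonneg (Finset.range_mono hj)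
        fun _ _ _ => abs_nonneg _
    have h4 : |(j : ℝ) * (c - d)| ≤ n * (δ / 3) := by
      rw [abs_mul, Nat.abs_cast]
      exact mul_le_mul hjn (hcd.trans hκ1) (abs_nonneg _) hnr.le
    rw [e] at hlt
    have h5 := abs_sub (∑ i ∈ Finset.range j, G i ω + ∑ i ∈ Finset.range j,
          (f (past ε ((i : ℤ) + 1) ω) - g (past ε ((i : ℤ) + 1) ω))) (j * (c - d))
    have h6 := abs_add_le (∑ i ∈ Finset.range j, G i ω) (∑ i ∈ Finset.range j,
          (f (past ε ((i : ℤ) + 1) ω) - g (past ε ((i : ℤ) + 1) ω)))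
    linarith
  have h1 : μ.real {ω | ∃ j ≤ n, δ * n < |∑ i ∈ Finset.range j, Y ((i : ℤ) + 1) ω - j * c|}
      ≤ μ.real ({ω | ∃ j ≤ n, δ / 3 * n < |∑ i ∈ Finset.range j, G i ω|}
        ∪ {ω | δ / 3 * n ≤ D ω}) :=
    ENNReal.toReal_mono (measure_ne_top _ _) (measure_mono_ae hsub)
  refine h1.trans ((measureReal_union_le _ _).trans ?_)
  linarith

end MaximalLLN

/-! ### Products of the random step matrices -/

section MatrixProducts

variable {d : Type*} [Fintype d]

/-- The operator norm of a matrix for the maximum norm. -/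
noncomputable def matNorm (M : Matrix d d ℝ) : ℝ≥0∞ :=
  ((Finset.univ.sup fun i => ∑ j, ‖M i j‖₊ : ℝ≥0) : ℝ≥0∞)

section

attribute [local instance] Matrix.linftyOpNormedAddCommGroup Matrix.linftyOpNormedSpace

theorem matNorm_eq_ofReal_norm (M : Matrix d d ℝ) : matNorm M = ENNReal.ofReal ‖M‖ := by
  rw [Matrix.linfty_opNorm_def, matNorm, ENNReal.ofReal_coe_nnreal]

theorem toReal_matNorm (M : Matrix d d ℝ) : (matNorm M).toReal = ‖M‖ := by
  rw [matNorm_eq_ofReal_norm, ENNReal.toReal_ofReal (norm_nonneg M)]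

theorem matNorm_mul_le (M N : Matrix d d ℝ) : matNorm (M * N) ≤ matNorm M * matNorm N := by
  simp only [matNorm_eq_ofReal_norm]
  rw [← ENNReal.ofReal_mul (norm_nonneg _)]
  exact ENNReal.ofReal_le_ofReal (Matrix.linfty_opNorm_mul M N)

theorem enorm_mulVec_le (M : Matrix d d ℝ) (v : d → ℝ) : ‖M *ᵥ v‖ₑ ≤ matNorm M * ‖v‖ₑ := by
  rw [matNorm_eq_ofReal_norm, ← ofReal_norm, ← ofReal_norm,
    ← ENNReal.ofReal_mul (norm_nonneg _)]
  exact ENNReal.ofReal_le_ofReal (Matrix.linfty_opNorm_mulVec M v)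

theorem matNorm_one_le [DecidableEq d] : matNorm (1 : Matrix d d ℝ) ≤ 1 := by
  rw [matNorm]
  refine ENNReal.coe_le_one_iff.2 (Finset.sup_le fun i _ => ?_)
  rw [Finset.sum_eq_single i]
  · simp
  · intro j _ hj
    simp [Matrix.one_apply_ne hj.symm]
  · simp

theorem matNorm_add_smul_le (M N : Matrix d d ℝ) (a : ℝ) :
    matNorm (M + a • N) ≤ matNorm M + ‖a‖ₑ * matNorm N := by
  simp only [matNorm_eq_ofReal_norm]
  rw [← ofReal_norm, ← ENNReal.ofReal_mul (norm_nonneg _),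
    ← ENNReal.ofReal_add (norm_nonneg _) (by positivity), ← norm_smul]
  exact ENNReal.ofReal_le_ofReal (norm_add_le _ _)

end

theorem matNorm_ne_top (M : Matrix d d ℝ) : matNorm M ≠ ∞ := ENNReal.coe_ne_top

theorem measurable_matNorm {α : Type*} [MeasurableSpace α] {M : α → Matrix d d ℝ}
    (hM : ∀ i j, Measurable fun x => M x i j) : Measurable fun x => matNorm (M x) := by
  unfold matNorm
  refine Measurable.coe_nnreal_ennreal ?_
  have : (fun x => Finset.univ.sup fun i => ∑ j, ‖M x i j‖₊)
      = Finset.univ.sup fun i x => ∑ j, ‖M x i j‖₊ := by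
    funext x
    rw [Finset.sup_apply]
  rw [this]
  exact Finset.sup_induction measurable_const (fun f hf g hg => hf.sup hg) fun i _ =>
    Finset.measurable_sum _ fun j _ => (hM i j).nnnorm

variable {p q : ℕ}

/-- The product `A(x₀) A(x₁) ⋯ A(x_{N-1})` of step matrices. -/
noncomputable def stepProd (θ : Param p q) (N : ℕ) (x : ℕ → ℝ) :
    Matrix (Fin p ⊕ Fin q) (Fin p ⊕ Fin q) ℝ :=
  ((List.range N).map fun i => stepMatrix θ (x i)).prod

theorem stepProd_zero (θ : Param p q) (x : ℕ → ℝ) : stepProd θ 0 x = 1 := by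
  simp [stepProd]

theorem stepProd_succ (θ : Param p q) (N : ℕ) (x : ℕ → ℝ) :
    stepProd θ (N + 1) x = stepProd θ N x * stepMatrix θ (x N) := by
  simp [stepProd, List.range_succ]

theorem stepProd_add (θ : Param p q) (N M : ℕ) (x : ℕ → ℝ) :
    stepProd θ (N + M) x = stepProd θ N x * stepProd θ M (shift N x) := by
  induction M with
  | zero => simp [stepProd_zero]
  | succ M ih =>
    rw [← add_assoc, stepProd_succ, ih, stepProd_succ, mul_assoc]
    congr 3
    simp [shift, add_comm]

theorem isWindow_stepProd (θ : Param p q) (N : ℕ) : IsWindow N (stepProd θ N) := by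
  intro x y hxy
  unfold stepProd
  congr 1
  refine List.map_congr_left fun i hi => ?_
  rw [hxy i (List.mem_range.1 hi)]

/-- Being affine in e² gives both measurability and a norm with finite mean. -/
theorem stepMatrix_eq_add_smul (θ : Param p q) (e : ℝ) :
    stepMatrix θ e = stepMatrix θ 0 + (e ^ 2) • (stepMatrix θ 1 - stepMatrix θ 0) := by
  ext i j
  rcases i with i | i <;> rcases j with j | j <;>
    simp only [stepMatrix, Matrix.add_apply, Matrix.smul_apply, Matrix.sub_apply, smul_eq_mul] <;>
    split_ifs <;> ring

theorem measurable_stepProd (θ : Param p q) (N : ℕ) (i j : Fin p ⊕ Fin q) :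
    Measurable fun x => stepProd θ N x i j := by
  induction N generalizing i j with
  | zero => simp only [stepProd_zero]; exact measurable_const
  | succ N ih =>
    simp only [stepProd_succ, Matrix.mul_apply]
    refine Finset.measurable_sum _ fun l _ => (ih i l).mul ?_
    have : ∀ x : ℕ → ℝ, stepMatrix θ (x N) l j = stepMatrix θ 0 l j
        + x N ^ 2 * (stepMatrix θ 1 - stepMatrix θ 0) l j := fun x => by
      conv_lhs => rw [stepMatrix_eq_add_smul]
      rfl
    simp only [this]
    fun_prop

theorem measurable_matNorm_stepProd (θ : Param p q) (N : ℕ) :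
    Measurable fun x => matNorm (stepProd θ N x) :=
  measurable_matNorm (measurable_stepProd θ N)

/-- The inhomogeneous term of the state recursion. -/
def stepVec (θ : Param p q) (e : ℝ) : Fin p ⊕ Fin q → ℝ
  | Sum.inl i => if (i : ℕ) = 0 then e ^ 2 * θ.1 0 else 0
  | Sum.inr i => if (i : ℕ) = 0 then θ.1 0 else 0

theorem stepVec_eq_add_smul (θ : Param p q) (e : ℝ) :
    stepVec θ e = stepVec θ 0 + (e ^ 2) • (stepVec θ 1 - stepVec θ 0) := by
  ext i
  rcases i with i | i <;>
    simp only [stepVec, Pi.add_apply, Pi.smul_apply, Pi.sub_apply, smul_eq_mul] <;>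
    split_ifs <;> ring

/-- The sum `∑_{j < N} A(x₀) ⋯ A(x_{j-1}) b(x_j)`. -/
noncomputable def stepSum (θ : Param p q) (N : ℕ) (x : ℕ → ℝ) : Fin p ⊕ Fin q → ℝ :=
  ∑ j ∈ Finset.range N, stepProd θ j x *ᵥ stepVec θ (x j)

/-- Composition rule of the affine random maps: a block of N steps acts on the sum built from the
remaining, independent innovations. -/
theorem stepSum_add (θ : Param p q) (N M : ℕ) (x : ℕ → ℝ) :
    stepSum θ (N + M) x = stepSum θ N x + stepProd θ N x *ᵥ stepSum θ M (shift N x) := by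
  unfold stepSum
  rw [Finset.sum_range_add]
  congr 1
  rw [Matrix.mulVec_sum]
  refine Finset.sum_congr rfl fun j _ => ?_
  rw [stepProd_add, Matrix.mulVec_mulVec]
  congr 2
  simp [shift, add_comm]

theorem measurable_stepVec (θ : Param p q) : Measurable (stepVec θ) := by
  have : stepVec θ = fun e => stepVec θ 0 + (e ^ 2) • (stepVec θ 1 - stepVec θ 0) :=
    funext fun e => stepVec_eq_add_smul θ e
  rw [this]
  refine measurable_pi_lambda _ fun i => ?_
  simp only [Pi.add_apply, Pi.smul_apply, smul_eq_mul]
  fun_prop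

theorem measurable_stepSum (θ : Param p q) (N : ℕ) : Measurable (stepSum θ N) := by
  unfold stepSum
  refine Finset.measurable_fun_sum _ fun j _ => measurable_pi_lambda _ fun i => ?_
  simp only [Matrix.mulVec, dotProduct]
  refine Finset.measurable_sum _ fun l _ => (measurable_stepProd θ j i l).mul ?_
  exact (measurable_pi_apply l).comp ((measurable_stepVec θ).comp (measurable_pi_apply j))

end MatrixProducts

/-! ### Moments of the products and of the iterated sums -/

section Moments

variable {p q : ℕ} {m : Measure ℝ} [IsProbabilityMeasure m]

theorem lintegral_eval (g : ℝ → ℝ≥0∞) (hg : Measurable g) (j : ℕ) :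
    ∫⁻ x, g (x j) ∂(Measure.infinitePi fun _ : ℕ => m) = ∫⁻ e, g e ∂m :=
  (measurePreserving_eval_infinitePi (fun _ : ℕ => m) j).lintegral_comp hg

theorem rpow_le_one_add {s : ℝ} (hs : 0 ≤ s) (hs1 : s ≤ 1) (a : ℝ≥0∞) : a ^ s ≤ 1 + a := by
  rcases le_total a 1 with h | h
  · exact (ENNReal.rpow_le_one h hs).trans le_self_add
  · calc a ^ s ≤ a ^ (1 : ℝ) := ENNReal.rpow_le_rpow_of_exponent_le h hs1
      _ = a := ENNReal.rpow_one a
      _ ≤ _ := le_add_self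

theorem lintegral_matNorm_stepMatrix_lt_top (θ : Param p q)
    (hm : ∫⁻ e, ‖e ^ 2‖ₑ ∂m < ∞) : ∫⁻ e, matNorm (stepMatrix θ e) ∂m < ∞ := by
  calc ∫⁻ e, matNorm (stepMatrix θ e) ∂m
      ≤ ∫⁻ e, (matNorm (stepMatrix θ 0)
        + ‖e ^ 2‖ₑ * matNorm (stepMatrix θ 1 - stepMatrix θ 0)) ∂m := by
        refine lintegral_mono fun e => ?_
        conv_lhs => rw [stepMatrix_eq_add_smul]
        exact matNorm_add_smul_le _ _ _
    _ < ∞ := by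
        rw [lintegral_add_left measurable_const, lintegral_mul_const _ (by fun_prop),
          lintegral_const]
        simp only [measure_univ, mul_one]
        exact ENNReal.add_lt_top.2 ⟨(matNorm_ne_top _).lt_top,
          ENNReal.mul_lt_top hm (matNorm_ne_top _).lt_top⟩

theorem lintegral_enorm_stepVec_lt_top (θ : Param p q)
    (hm : ∫⁻ e, ‖e ^ 2‖ₑ ∂m < ∞) : ∫⁻ e, ‖stepVec θ e‖ₑ ∂m < ∞ := by
  calc ∫⁻ e, ‖stepVec θ e‖ₑ ∂m
      ≤ ∫⁻ e, (‖stepVec θ 0‖ₑ + ‖e ^ 2‖ₑ * ‖stepVec θ 1 - stepVec θ 0‖ₑ) ∂m := by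
        refine lintegral_mono fun e => ?_
        conv_lhs => rw [stepVec_eq_add_smul]
        refine (enorm_add_le _ _).trans ?_
        rw [enorm_smul]
    _ < ∞ := by
        rw [lintegral_add_left measurable_const, lintegral_mul_const _ (by fun_prop),
          lintegral_const]
        simp only [measure_univ, mul_one]
        exact ENNReal.add_lt_top.2 ⟨enorm_lt_top, ENNReal.mul_lt_top hm enorm_lt_top⟩

theorem lintegral_matNorm_stepProd_lt_top (θ : Param p q)
    (hm : ∫⁻ e, ‖e ^ 2‖ₑ ∂m < ∞) (N : ℕ) :
    ∫⁻ x, matNorm (stepProd θ N x) ∂(Measure.infinitePi fun _ : ℕ => m) < ∞ := by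
  induction N with
  | zero =>
    simp only [stepProd_zero, lintegral_const, measure_univ, mul_one]
    exact (matNorm_ne_top _).lt_top
  | succ N ih =>
    have hone : ∀ x : ℕ → ℝ, stepProd θ 1 x = stepMatrix θ (x 0) := fun x => by
      rw [stepProd_succ, stepProd_zero, one_mul]
    calc _ ≤ ∫⁻ x, matNorm (stepProd θ N x) * matNorm (stepProd θ 1 (shift N x))
            ∂(Measure.infinitePi fun _ : ℕ => m) :=
          lintegral_mono fun x => by
            rw [stepProd_add]
            exact matNorm_mul_le _ _
      _ = _ := lintegral_window_mul_shift m (measurable_matNorm_stepProd θ N)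
            (measurable_matNorm_stepProd θ 1) fun x y hxy => congrArg matNorm (isWindow_stepProd θ N x y hxy)
      _ < ∞ := by
        refine ENNReal.mul_lt_top ih ?_
        simp only [hone]
        have hmm : Measurable fun e => matNorm (stepMatrix θ e) := by
          refine measurable_matNorm fun i j => ?_
          have : (fun e => stepMatrix θ e i j) = fun e => stepMatrix θ 0 i j
              + e ^ 2 * (stepMatrix θ 1 - stepMatrix θ 0) i j := by
            funext e
            conv_lhs => rw [stepMatrix_eq_add_smul]
            rfl
          rw [this]
          fun_prop
        rw [lintegral_eval (fun e => matNorm (stepMatrix θ e)) hmm 0]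
        exact lintegral_matNorm_stepMatrix_lt_top θ hm

theorem lintegral_rpow_lt_top {α : Type*} [MeasurableSpace α] {ν : Measure α}
    [IsProbabilityMeasure ν] {f : α → ℝ≥0∞} (hf : ∫⁻ x, f x ∂ν < ∞) {s : ℝ} (hs : 0 ≤ s)
    (hs1 : s ≤ 1) : ∫⁻ x, f x ^ s ∂ν < ∞ := by
  calc _ ≤ ∫⁻ x, (1 + f x) ∂ν := lintegral_mono fun x => rpow_le_one_add hs hs1 _
    _ < ∞ := by
      rw [lintegral_add_left measurable_const]
      simpa using hf

theorem lintegral_enorm_stepSum_rpow_lt_top (θ : Param p q) (hm : ∫⁻ e, ‖e ^ 2‖ₑ ∂m < ∞)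
    {s : ℝ} (hs : 0 ≤ s) (hs1 : s ≤ 1) (N : ℕ) :
    ∫⁻ x, ‖stepSum θ N x‖ₑ ^ s ∂(Measure.infinitePi fun _ : ℕ => m) < ∞ := by
  refine lintegral_rpow_lt_top ?_ hs hs1
  have hv := (measurable_stepVec θ).enorm
  calc ∫⁻ x, ‖stepSum θ N x‖ₑ ∂(Measure.infinitePi fun _ : ℕ => m)
      ≤ ∫⁻ x, ∑ j ∈ Finset.range N, matNorm (stepProd θ j x) * ‖stepVec θ (shift j x 0)‖ₑ
        ∂(Measure.infinitePi fun _ : ℕ => m) := by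
        refine lintegral_mono fun x => ?_
        refine (enorm_sum_le _ _).trans (Finset.sum_le_sum fun j _ => ?_)
        have : shift j x 0 = x j := by simp [shift]
        rw [this]
        exact enorm_mulVec_le _ _
    _ = ∑ j ∈ Finset.range N, ∫⁻ x, matNorm (stepProd θ j x) * ‖stepVec θ (shift j x 0)‖ₑ
        ∂(Measure.infinitePi fun _ : ℕ => m) := by
        refine lintegral_finsetSum _ fun j _ => ?_
        refine (measurable_matNorm_stepProd θ j).mul ?_
        exact hv.comp ((measurable_pi_apply 0).comp (measurable_shift j))
    _ < ∞ := by
        refine ENNReal.sum_lt_top.2 fun j _ => ?_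
        have h := lintegral_window_mul_shift m (measurable_matNorm_stepProd θ j)
          (G := fun x => ‖stepVec θ (x 0)‖ₑ) (hv.comp (measurable_pi_apply 0))
          (fun x y hxy => by rw [isWindow_stepProd θ j x y hxy])
        rw [h, lintegral_eval (fun e => ‖stepVec θ e‖ₑ) hv 0]
        exact ENNReal.mul_lt_top (lintegral_matNorm_stepProd_lt_top θ hm j)
          (lintegral_enorm_stepVec_lt_top θ hm)

/-- The l blocks of length N are independent and identically distributed, and the norm is
submultiplicative. -/
theorem lintegral_matNorm_stepProd_mul_le (θ : Param p q) {s : ℝ} (hs : 0 ≤ s) (N l : ℕ) :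
    ∫⁻ x, matNorm (stepProd θ (N * l) x) ^ s ∂(Measure.infinitePi fun _ : ℕ => m)
      ≤ (∫⁻ x, matNorm (stepProd θ N x) ^ s ∂(Measure.infinitePi fun _ : ℕ => m)) ^ l := by
  induction l with
  | zero =>
    simp only [mul_zero, stepProd_zero, lintegral_const, measure_univ, mul_one, pow_zero]
    exact ENNReal.rpow_le_one matNorm_one_le hs
  | succ l ih =>
    have e : N * (l + 1) = N + N * l := by ring
    rw [e, pow_succ']
    refine le_trans ?_ (mul_le_mul_right ih _)
    rw [← lintegral_window_mul_shift m ((measurable_matNorm_stepProd θ N).pow_const s)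
      ((measurable_matNorm_stepProd θ (N * l)).pow_const s)
      (fun x y hxy => by rw [isWindow_stepProd θ N x y hxy])]
    refine lintegral_mono fun x => ?_
    rw [stepProd_add, ← ENNReal.mul_rpow_of_nonneg _ _ hs]
    exact ENNReal.rpow_le_rpow (matNorm_mul_le _ _) hs

/-- For s ≤ 1 the function x ↦ x^s is subadditive, so `stepSum_add` and independence yield a scalar
affine recursion whose solution is a geometric sum. -/
theorem lintegral_enorm_stepSum_mul_le (θ : Param p q) {s : ℝ} (hs0 : 0 < s) (hs1 : s ≤ 1)
    (N l : ℕ) :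
    ∫⁻ x, ‖stepSum θ (N * l) x‖ₑ ^ s ∂(Measure.infinitePi fun _ : ℕ => m)
      ≤ (∫⁻ x, ‖stepSum θ N x‖ₑ ^ s ∂(Measure.infinitePi fun _ : ℕ => m))
        * ∑ i ∈ Finset.range l,
          (∫⁻ x, matNorm (stepProd θ N x) ^ s ∂(Measure.infinitePi fun _ : ℕ => m)) ^ i := by
  have hs := hs0.le
  induction l with
  | zero => simp [stepSum, hs0]
  | succ l ih =>
    have e : N * (l + 1) = N + N * l := by ring
    set κ := ∫⁻ x, matNorm (stepProd θ N x) ^ s ∂(Measure.infinitePi fun _ : ℕ => m)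
    set β := ∫⁻ x, ‖stepSum θ N x‖ₑ ^ s ∂(Measure.infinitePi fun _ : ℕ => m)
    have hS := (measurable_stepSum θ (N * l)).enorm.pow_const s
    calc ∫⁻ x, ‖stepSum θ (N * (l + 1)) x‖ₑ ^ s ∂(Measure.infinitePi fun _ : ℕ => m)
        ≤ ∫⁻ x, (‖stepSum θ N x‖ₑ ^ s + matNorm (stepProd θ N x) ^ s
          * ‖stepSum θ (N * l) (shift N x)‖ₑ ^ s) ∂(Measure.infinitePi fun _ : ℕ => m) := by
          refine lintegral_mono fun x => ?_
          rw [e, stepSum_add, ← ENNReal.mul_rpow_of_nonneg _ _ hs]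
          refine le_trans ?_ (ENNReal.rpow_add_le_add_rpow _ _ hs hs1)
          refine ENNReal.rpow_le_rpow ((enorm_add_le _ _).trans ?_) hs
          gcongr
          exact enorm_mulVec_le _ _
      _ = β + κ * ∫⁻ x, ‖stepSum θ (N * l) x‖ₑ ^ s ∂(Measure.infinitePi fun _ : ℕ => m) := by
          rw [lintegral_add_left ((measurable_stepSum θ N).enorm.pow_const s),
            ← lintegral_window_mul_shift m ((measurable_matNorm_stepProd θ N).pow_const s) hS
              (fun x y hxy => by rw [isWindow_stepProd θ N x y hxy])]
      _ ≤ β + κ * (β * ∑ i ∈ Finset.range l, κ ^ i) := by gcongr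
      _ = _ := by
          rw [Finset.sum_range_succ', pow_zero, mul_add, mul_one, add_comm]
          congr 1
          simp only [pow_succ]
          rw [← Finset.sum_mul]
          ring

end Moments

/-! ### From a negative Lyapunov exponent to a contracting fractional moment -/

section FractionalMoment

/-- Convexity of exp between 0 and L; it supplies integrable bounds uniform in s. -/
theorem exp_mul_le_of_le_one {s L : ℝ} (hs : 0 ≤ s) (hs1 : s ≤ 1) :
    Real.exp (s * L) ≤ 1 - s + s * Real.exp L := by
  have h := convexOn_exp.2 (Set.mem_univ 0) (Set.mem_univ L) (sub_nonneg.2 hs1) hs (by ring)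
  simpa using h

/-- A negative logarithmic moment and a finite first moment give a fractional moment below one. -/
theorem exists_lintegral_rpow_lt_one {Ω : Type*} [MeasurableSpace Ω] {μ : Measure Ω}
    [IsProbabilityMeasure μ] {Y : Ω → ℝ} (hY : Measurable Y) (hY0 : ∀ ω, 0 ≤ Y ω)
    (hint : Integrable Y μ) (hlog : ∫ ω, Real.log (Y ω) ∂μ < 0) :
    ∃ s : ℝ, 0 < s ∧ s ≤ 1 ∧ ∫⁻ ω, ENNReal.ofReal (Y ω) ^ s ∂μ < 1 := by
  have hL : Integrable (fun ω => Real.log (Y ω)) μ := by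
    -- The integral of a non-integrable function is 0 by convention, so a negative value forces
    -- integrability.
    by_contra h
    rw [integral_undef h] at hlog
    exact lt_irrefl _ hlog
  have hLm : Measurable fun ω => Real.log (Y ω) := hY.log
  -- Where Y = 0 the convention log 0 = 0 makes the left side 1, whence the added 1. This only
  -- enlarges the exponential moment, since 0^s = 0.
  have hexp : ∀ ω, Real.exp (Real.log (Y ω)) ≤ Y ω + 1 := fun ω => by
    rcases (hY0 ω).eq_or_lt with h | h
    · simp [← h]
    · rw [Real.exp_log h]; linarith
  set s : ℕ → ℝ := fun n => 1 / ((n : ℝ) + 1)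
  have hs0 : ∀ n, 0 < s n := fun n => by positivity
  have hs1 : ∀ n, s n ≤ 1 := fun n => by
    simp only [s]
    rw [div_le_one (by positivity)]
    linarith [(Nat.cast_nonneg n : (0 : ℝ) ≤ n)]
  have hexps : ∀ n ω, Real.exp (s n * Real.log (Y ω)) ≤ Y ω + 2 := fun n ω => by
    refine (exp_mul_le_of_le_one (hs0 n).le (hs1 n)).trans ?_
    nlinarith [hexp ω, hs0 n, hs1 n, hY0 ω]
  have hei : ∀ n, Integrable (fun ω => Real.exp (s n * Real.log (Y ω))) μ := fun n =>
    (hint.add (integrable_const 2)).mono' (hLm.const_mul _).exp.aestronglyMeasurable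
      (Eventually.of_forall fun ω => by
      rw [Real.norm_eq_abs, abs_of_pos (Real.exp_pos _)]
      exact hexps n ω)
  -- The derivative of s ↦ E exp(s log Y) at 0 is E log Y. With L = log Y the quotient lies between
  -- L and e^L - 1, which gives the dominating function.
  have hlim : Tendsto (fun n => ∫ ω, (Real.exp (s n * Real.log (Y ω)) - 1) / s n ∂μ) atTop
      (𝓝 (∫ ω, Real.log (Y ω) ∂μ)) := by
    refine tendsto_integral_of_dominated_convergence (fun ω => |Real.log (Y ω)| + (Y ω + 1))
      (fun n => (((hLm.const_mul _).exp.sub_const 1).div_const _).aestronglyMeasurable)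
      (hL.norm.add (hint.add (integrable_const 1)))
      (fun n => Eventually.of_forall fun ω => ?_) (Eventually.of_forall fun ω => ?_)
    · rw [Real.norm_eq_abs, abs_le]
      have a1 := Real.add_one_le_exp (s n * Real.log (Y ω))
      have a2 := exp_mul_le_of_le_one (L := Real.log (Y ω)) (hs0 n).le (hs1 n)
      have a3 := neg_abs_le (Real.log (Y ω))
      have a4 := abs_nonneg (Real.log (Y ω))
      constructor
      · rw [le_div_iff₀ (hs0 n)]
        nlinarith [hY0 ω, hs0 n]
      · rw [div_le_iff₀ (hs0 n)]
        nlinarith [hexp ω, hs0 n]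
    · have hd : HasDerivAt (fun r : ℝ => Real.exp (r * Real.log (Y ω))) (Real.log (Y ω)) 0 := by
        have := ((hasDerivAt_id (0 : ℝ)).mul_const (Real.log (Y ω))).exp
        simpa using this
      have hsn : Tendsto s atTop (𝓝[≠] 0) := by
        rw [tendsto_nhdsWithin_iff]
        exact ⟨tendsto_one_div_add_atTop_nhds_zero_nat,
          Eventually.of_forall fun n => (hs0 n).ne'⟩
      have h := hd.tendsto_slope.comp hsn
      refine h.congr fun n => ?_
      simp [slope_def_field]
  obtain ⟨n, hn⟩ := (hlim.eventually_lt_const hlog).exists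
  refine ⟨s n, hs0 n, hs1 n, ?_⟩
  rw [integral_div, div_lt_iff₀ (hs0 n), zero_mul, integral_sub (hei n) (integrable_const _)] at hn
  simp only [integral_const, probReal_univ, one_smul] at hn
  calc ∫⁻ ω, ENNReal.ofReal (Y ω) ^ s n ∂μ
      ≤ ∫⁻ ω, ENNReal.ofReal (Real.exp (s n * Real.log (Y ω))) ∂μ := by
        refine lintegral_mono fun ω => ?_
        rw [ENNReal.ofReal_rpow_of_nonneg (hY0 ω) (hs0 n).le]
        refine ENNReal.ofReal_le_ofReal ?_
        rcases (hY0 ω).eq_or_lt with h | h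
        · rw [← h, Real.zero_rpow (hs0 n).ne']
          exact (Real.exp_pos _).le
        · rw [Real.rpow_def_of_pos h, mul_comm]
    _ = ENNReal.ofReal (∫ ω, Real.exp (s n * Real.log (Y ω)) ∂μ) :=
        (ofReal_integral_eq_lintegral_ofReal (hei n)
          (Eventually.of_forall fun ω => (Real.exp_pos _).le)).symm
    _ < 1 := by
        rw [ENNReal.ofReal_lt_one]
        linarith

variable {Ω : Type*} [MeasurableSpace Ω] {μ : Measure Ω} [IsProbabilityMeasure μ]
  {ε : ℤ → Ω → ℝ} {p q : ℕ}

omit [IsProbabilityMeasure μ] in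
theorem IsInnovation.lintegral_sq_lt_top (hε : IsInnovation μ ε) :
    ∫⁻ e, ‖e ^ 2‖ₑ ∂(μ.map (ε 0)) < ∞ := by
  rw [lintegral_map (by fun_prop) (hε.measurable 0)]
  exact hε.memLp_two.integrable_sq.2

/-- A negative top Lyapunov exponent yields a fractional moment of some product of step matrices
that is less than one. -/
theorem exists_lintegral_matNorm_stepProd_rpow_lt_one (hε : IsInnovation μ ε) {θ : Param p q}
    (hγ : lyapunovExponent μ θ ε < 0) :
    ∃ (N : ℕ) (s : ℝ), 0 < s ∧ s ≤ 1 ∧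
      ∫⁻ x, matNorm (stepProd θ N x) ^ s ∂(pastLaw μ ε) < 1 := by
  have hp := hε.isProbabilityMeasure_map
  unfold lyapunovExponent at hγ
  obtain ⟨n, hn⟩ := iInf_lt_iff.1 hγ
  have hn0 : ((∫ ω, Real.log (matNorm (stepProd θ (n + 1) (past ε 0 ω))).toReal ∂μ)
      / (n + 1) : ℝ) < 0 := by
    rw [← EReal.coe_zero, EReal.coe_lt_coe_iff] at hn
    refine lt_of_le_of_lt (le_of_eq ?_) hn
    congr 2
    funext ω
    rw [toReal_matNorm, stepProd]
    simp [past, List.map_flatMap]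
    rw [List.map_eq_flatMap]
  rw [div_lt_iff₀ (by positivity), zero_mul] at hn0
  have hfin : ∫⁻ ω, matNorm (stepProd θ (n + 1) (past ε 0 ω)) ∂μ < ∞ := by
    rw [(hε.measurePreserving_past 0).lintegral_comp (measurable_matNorm_stepProd θ (n + 1))]
    exact lintegral_matNorm_stepProd_lt_top θ hε.lintegral_sq_lt_top (n + 1)
  have hmeas : Measurable fun ω => matNorm (stepProd θ (n + 1) (past ε 0 ω)) :=
    (measurable_matNorm_stepProd θ (n + 1)).comp (hε.measurable_past 0)
  obtain ⟨s, hs0, hs1, hs⟩ := exists_lintegral_rpow_lt_one hmeas.ennreal_toReal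
    (fun ω => ENNReal.toReal_nonneg) (integrable_toReal_of_lintegral_ne_top hmeas.aemeasurable
      hfin.ne) hn0
  refine ⟨n + 1, s, hs0, hs1, ?_⟩
  rw [← (hε.measurePreserving_past 0).lintegral_comp
    ((measurable_matNorm_stepProd θ (n + 1)).pow_const s)]
  refine lt_of_le_of_lt (le_of_eq (lintegral_congr fun ω => ?_)) hs
  rw [ENNReal.ofReal_toReal (matNorm_ne_top _)]

end FractionalMoment

/-! ### The state as a causal process with a fractional moment -/

section State

variable {Ω : Type*} [MeasurableSpace Ω] {μ : Measure Ω} {ε X σ : ℤ → Ω → ℝ} {p q : ℕ}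
  {θ : Param p q}

/-- The state `(X_t², …, X_{t-p+1}², σ_t², …, σ_{t-q+1}²)`. -/
def state (p q : ℕ) (X σ : ℤ → Ω → ℝ) (t : ℤ) (ω : Ω) : Fin p ⊕ Fin q → ℝ
  | Sum.inl i => X (t - i) ω ^ 2
  | Sum.inr j => σ (t - j) ω ^ 2

theorem IsStationaryGARCH.state_eq (hX : IsStationaryGARCH μ θ ε X σ) (t : ℤ) :
    ∀ᵐ ω ∂μ, state p q X σ t ω
      = stepMatrix θ (ε t ω) *ᵥ state p q X σ (t - 1) ω + stepVec θ (ε t ω) := by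
  filter_upwards [hX.eq_X t, hX.eq_σ t] with ω h1 h2
  have hlag : ∀ i : ℕ, t - 1 - (i : ℤ) = t - ((i : ℤ) + 1) := fun i => by ring
  ext a
  rcases a with ⟨i, hi⟩ | ⟨i, hi⟩ <;>
    simp only [Matrix.mulVec, dotProduct, Fintype.sum_sum_type, Pi.add_apply, stepMatrix, stepVec,
      state, hlag]
  · rcases i with _ | i
    · simp only [Nat.cast_zero, sub_zero, if_true, h1, mul_pow]
      rw [h2]
      simp only [mul_assoc, ← Finset.mul_sum]
      ring
    · have e : ∀ j : Fin p, i = (j : ℕ) ↔ j = ⟨i, by omega⟩ := fun j => by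
        rw [Fin.ext_iff]; simp [eq_comm]
      simp [e]
  · rcases i with _ | i
    · simp only [Nat.cast_zero, sub_zero, if_true]
      rw [h2]
      ring
    · have e : ∀ j : Fin q, i = (j : ℕ) ↔ j = ⟨i, by omega⟩ := fun j => by
        rw [Fin.ext_iff]; simp [eq_comm]
      simp [e]

/-- Unrolling the recursion separates a function of the last N innovations from a remainder in which
the product of N matrices acts on a state of fixed law. -/
theorem IsStationaryGARCH.state_eq_iterate (hX : IsStationaryGARCH μ θ ε X σ) (N : ℕ) (t : ℤ) :
    ∀ᵐ ω ∂μ, state p q X σ t ω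
      = stepProd θ N (past ε t ω) *ᵥ state p q X σ (t - N) ω + stepSum θ N (past ε t ω) := by
  induction N with
  | zero =>
    refine Eventually.of_forall fun ω => ?_
    simp [stepProd_zero, stepSum]
  | succ N ih =>
    filter_upwards [ih, hX.state_eq (t - N)] with ω h1 h2
    have e : t - ((N + 1 : ℕ) : ℤ) = t - N - 1 := by push_cast; ring
    rw [h1, h2, e, stepProd_succ, stepSum, stepSum, Finset.sum_range_succ, Matrix.mulVec_add,
      Matrix.mulVec_mulVec]
    simp only [past]
    abel

theorem IsStationaryGARCH.measurable_state (hX : IsStationaryGARCH μ θ ε X σ) (t : ℤ) :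
    Measurable (state p q X σ t) :=
  measurable_pi_lambda _ fun a => by
    rcases a with i | j
    · exact (hX.measurable_X _).pow_const 2
    · exact (hX.measurable_σ _).pow_const 2

theorem IsStationaryGARCH.identDistrib_state (hX : IsStationaryGARCH μ θ ε X σ) (t : ℤ) :
    IdentDistrib (state p q X σ t) (state p q X σ 0) μ μ := by
  set F : (ℤ → ℝ × ℝ) → (Fin p ⊕ Fin q → ℝ) := fun x a =>
    Sum.elim (fun i : Fin p => (x (-(i : ℤ))).1 ^ 2) (fun j : Fin q => (x (-(j : ℤ))).2 ^ 2) a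
    with hF
  have hFm : Measurable F := measurable_pi_lambda _ fun a => by
    rcases a with i | j
    · exact (measurable_fst.comp (measurable_pi_apply _)).pow_const 2
    · exact (measurable_snd.comp (measurable_pi_apply _)).pow_const 2
  have h := (hX.stationary t).comp hFm
  have e1 : F ∘ (fun ω (s : ℤ) => (X (s + t) ω, σ (s + t) ω)) = state p q X σ t := by
    funext ω a
    rcases a with i | j <;> simp [hF, state, neg_add_eq_sub]
  have e2 : F ∘ (fun ω (s : ℤ) => (X s ω, σ s ω)) = state p q X σ 0 := by
    funext ω a
    rcases a with i | j <;> simp [hF, state]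
  rwa [e1, e2] at h

/-- A random variable with values in the extended half-line that is finite is tight. -/
theorem exists_measure_ge_le [IsFiniteMeasure μ] {f : Ω → ℝ≥0∞} (hf : AEMeasurable f μ)
    (hfin : ∀ᵐ ω ∂μ, f ω < ∞) {η : ℝ≥0∞} (hη : 0 < η) :
    ∃ K : ℕ, 0 < K ∧ μ {ω | (K : ℝ≥0∞) ≤ f ω} ≤ η := by
  have h := tendsto_measure_iInter_atTop (μ := μ) (s := fun K : ℕ => {ω | (K : ℝ≥0∞) ≤ f ω})
    (fun K => nullMeasurableSet_le aemeasurable_const hf)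
    (fun a b hab ω (hω : (b : ℝ≥0∞) ≤ f ω) => le_trans (by exact_mod_cast hab) hω)
    ⟨0, measure_ne_top _ _⟩
  have h0 : μ (⋂ K : ℕ, {ω | (K : ℝ≥0∞) ≤ f ω}) = 0 := by
    refine measure_mono_null (fun ω hω => ?_) (ae_iff.1 hfin)
    have hω' : ∀ K : ℕ, (K : ℝ≥0∞) ≤ f ω := fun K => Set.mem_iInter.1 hω K
    change ¬ f ω < ∞
    intro hlt
    obtain ⟨K, hK⟩ := ENNReal.exists_nat_gt hlt.ne
    exact absurd hK (not_lt.2 (hω' K))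
  rw [h0] at h
  obtain ⟨K, h1, h2⟩ := ((h.eventually_lt_const hη).and (eventually_gt_atTop 0)).exists
  exact ⟨K, h2, h1.le⟩

variable [IsProbabilityMeasure μ]

/-- Along multiples of a block length with contracting fractional moment, the remainder of the
iterated state recursion vanishes in probability. -/
theorem IsStationaryGARCH.tendstoInMeasure_stepSum (hε : IsInnovation μ ε)
    (hX : IsStationaryGARCH μ θ ε X σ) {N : ℕ} {s : ℝ} (hs : 0 < s)
    (hκ : ∫⁻ x, matNorm (stepProd θ N x) ^ s ∂(pastLaw μ ε) < 1) (t : ℤ) (a : Fin p ⊕ Fin q) :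
    TendstoInMeasure μ (fun l ω => stepSum θ (N * l) (past ε t ω) a) atTop
      fun ω => state p q X σ t ω a := by
  have hp := hε.isProbabilityMeasure_map
  set κ := ∫⁻ x, matNorm (stepProd θ N x) ^ s ∂(pastLaw μ ε) with hκdef
  rw [tendstoInMeasure_iff_enorm]
  intro δ hδ hδtop
  rw [ENNReal.tendsto_nhds_zero]
  intro η hη
  have hη2 : 0 < η / 2 := ENNReal.half_pos hη.ne'
  -- By stationarity this K bounds the state at every earlier time t - N l with the same
  -- probability.
  obtain ⟨K, hK, hKη⟩ := exists_measure_ge_le (μ := μ) (f := fun ω => ‖state p q X σ 0 ω‖ₑ)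
    (hX.measurable_state 0).enorm.aemeasurable (Eventually.of_forall fun ω => enorm_lt_top) hη2
  have hK0 : (K : ℝ≥0∞) ≠ 0 := by exact_mod_cast hK.ne'
  have hKt : (K : ℝ≥0∞) ≠ ∞ := ENNReal.natCast_ne_top K
  -- If the matrix product has norm below δ / K and the old state norm below K, the remainder is
  -- below δ; the first event is handled by Markov's inequality for the s-th power.
  set c := (δ / K) ^ s with hc
  have hc0 : c ≠ 0 := by
    refine (ENNReal.rpow_pos (ENNReal.div_pos hδ.ne' hKt) ?_).ne'
    exact ENNReal.div_ne_top hδtop hK0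
  have hct : c ≠ ∞ := ENNReal.rpow_ne_top_of_nonneg hs.le (ENNReal.div_ne_top hδtop hK0)
  have hlim : Tendsto (fun l : ℕ => κ ^ l / c) atTop (𝓝 0) := by
    have := ENNReal.Tendsto.div_const (ENNReal.tendsto_pow_atTop_nhds_zero_of_lt_one hκ)
      (Or.inr hc0) (b := c)
    simpa using this
  filter_upwards [(ENNReal.tendsto_nhds_zero.1 hlim) _ hη2] with l hl
  have hset : {ω | δ ≤ ‖stepSum θ (N * l) (past ε t ω) a - state p q X σ t ω a‖ₑ}
      ≤ᵐ[μ] ({ω | c ≤ matNorm (stepProd θ (N * l) (past ε t ω)) ^ s}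
        ∪ {ω | (K : ℝ≥0∞) ≤ ‖state p q X σ (t - (N * l : ℕ)) ω‖ₑ} : Set Ω) := by
    filter_upwards [hX.state_eq_iterate (N * l) t] with ω hω
    intro hmem
    by_contra hcon
    have hcon' : ¬ (c ≤ matNorm (stepProd θ (N * l) (past ε t ω)) ^ s
        ∨ (K : ℝ≥0∞) ≤ ‖state p q X σ (t - (N * l : ℕ)) ω‖ₑ) := hcon
    push Not at hcon'
    obtain ⟨h1, h2⟩ := hcon'
    have h1' : matNorm (stepProd θ (N * l) (past ε t ω)) < δ / K := by
      rw [hc] at h1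
      exact (ENNReal.rpow_lt_rpow_iff hs).1 h1
    have hmem' : δ ≤ ‖stepSum θ (N * l) (past ε t ω) a - state p q X σ t ω a‖ₑ := hmem
    have h3 : ‖stepSum θ (N * l) (past ε t ω) a - state p q X σ t ω a‖ₑ
        ≤ matNorm (stepProd θ (N * l) (past ε t ω)) * ‖state p q X σ (t - (N * l : ℕ)) ω‖ₑ := by
      rw [hω]
      refine le_trans ?_ (enorm_mulVec_le _ _)
      rw [← enorm_neg]
      set v := stepProd θ (N * l) (past ε t ω) *ᵥ state p q X σ (t - (N * l : ℕ)) ω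
      have e : -(stepSum θ (N * l) (past ε t ω) a - (v + stepSum θ (N * l) (past ε t ω)) a)
          = v a := by
        simp
      rw [e]
      rw [← ofReal_norm, ← ofReal_norm]
      exact ENNReal.ofReal_le_ofReal (norm_le_pi_norm v a)
    have h4 := (ENNReal.lt_div_iff_mul_lt (Or.inl hK0) (Or.inl hKt)).1 h1'
    exact absurd (hmem'.trans (h3.trans (by gcongr))) (not_le.2 h4)
  refine (measure_mono_ae hset).trans ((measure_union_le _ _).trans ?_)
  rw [← ENNReal.add_halves η]
  refine add_le_add ?_ ?_
  · have hm : Measurable fun ω => matNorm (stepProd θ (N * l) (past ε t ω)) ^ s :=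
      ((measurable_matNorm_stepProd θ (N * l)).comp (hε.measurable_past t)).pow_const s
    refine (meas_ge_le_lintegral_div hm.aemeasurable hc0 hct).trans (le_trans ?_ hl)
    gcongr
    rw [(hε.measurePreserving_past t).lintegral_comp
      ((measurable_matNorm_stepProd θ (N * l)).pow_const s)]
    exact lintegral_matNorm_stepProd_mul_le θ hs.le N l
  · refine le_trans (le_of_eq ?_) hKη
    have hI := (hX.identDistrib_state (t - (N * l : ℕ))).comp
      (u := fun v : Fin p ⊕ Fin q → ℝ => ‖v‖ₑ) measurable_enorm
    exact hI.measure_mem_eq (measurableSet_Ici (a := (K : ℝ≥0∞)))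

/-- The approximating `stepSum` depends on finitely many past innovations through a function that
does not involve t. -/
theorem IsStationaryGARCH.isCausal_state (hε : IsInnovation μ ε)
    (hX : IsStationaryGARCH μ θ ε X σ) (hγ : lyapunovExponent μ θ ε < 0) (a : Fin p ⊕ Fin q) :
    IsCausal μ ε fun t ω => state p q X σ t ω a := by
  obtain ⟨N, s, hs, -, hκ⟩ := exists_lintegral_matNorm_stepProd_rpow_lt_one hε hγ
  refine isCausal_of_tendstoInMeasure hε
    (Yn := fun l t ω => stepSum θ (N * l) (past ε t ω) a) (fun l => ?_)
    fun t => hX.tendstoInMeasure_stepSum hε hs hκ t a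
  exact ⟨fun x => stepSum θ (N * l) x a,
    (measurable_pi_apply a).comp (measurable_stepSum θ (N * l)),
    fun t => Eventually.of_forall fun ω => rfl⟩

/-- The state has a finite fractional moment. -/
theorem IsStationaryGARCH.exists_moment_state (hε : IsInnovation μ ε)
    (hX : IsStationaryGARCH μ θ ε X σ) (hγ : lyapunovExponent μ θ ε < 0) :
    ∃ s : ℝ, 0 < s ∧ s ≤ 1 ∧ ∃ K : ℝ≥0∞, K < ∞ ∧ ∀ t a,
      ∫⁻ ω, ‖state p q X σ t ω a‖ₑ ^ s ∂μ ≤ K := by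
  have hp := hε.isProbabilityMeasure_map
  obtain ⟨N, s, hs, hs1, hκ⟩ := exists_lintegral_matNorm_stepProd_rpow_lt_one hε hγ
  set κ := ∫⁻ x, matNorm (stepProd θ N x) ^ s ∂(pastLaw μ ε) with hκdef
  set β := ∫⁻ x, ‖stepSum θ N x‖ₑ ^ s ∂(pastLaw μ ε) with hβ
  have hβt : β < ∞ := lintegral_enorm_stepSum_rpow_lt_top θ hε.lintegral_sq_lt_top hs.le hs1 N
  refine ⟨s, hs, hs1, β * (1 - κ)⁻¹, ENNReal.mul_lt_top hβt ?_, fun t a => ?_⟩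
  · rw [ENNReal.inv_lt_top]
    exact tsub_pos_of_lt hκ
  have hB : ∀ l, ∫⁻ ω, ‖stepSum θ (N * l) (past ε t ω) a‖ₑ ^ s ∂μ ≤ β * (1 - κ)⁻¹ := fun l => by
    calc ∫⁻ ω, ‖stepSum θ (N * l) (past ε t ω) a‖ₑ ^ s ∂μ
        ≤ ∫⁻ ω, ‖stepSum θ (N * l) (past ε t ω)‖ₑ ^ s ∂μ := by
          refine lintegral_mono fun ω => ENNReal.rpow_le_rpow ?_ hs.le
          rw [← ofReal_norm, ← ofReal_norm]
          exact ENNReal.ofReal_le_ofReal (norm_le_pi_norm _ a)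
      _ = ∫⁻ x, ‖stepSum θ (N * l) x‖ₑ ^ s ∂(pastLaw μ ε) :=
          (hε.measurePreserving_past t).lintegral_comp
            ((measurable_stepSum θ (N * l)).enorm.pow_const s)
      _ ≤ β * ∑ i ∈ Finset.range l, κ ^ i := lintegral_enorm_stepSum_mul_le θ hs hs1 N l
      _ ≤ β * (1 - κ)⁻¹ := by
          gcongr
          rw [← ENNReal.tsum_geometric]
          exact ENNReal.sum_le_tsum _
  -- Fatou's lemma along an almost surely convergent subsequence carries the uniform moment bound to
  -- the limit.
  obtain ⟨ns, -, hns⟩ := (hX.tendstoInMeasure_stepSum hε hs hκ t a).exists_seq_tendsto_ae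
  calc ∫⁻ ω, ‖state p q X σ t ω a‖ₑ ^ s ∂μ
      = ∫⁻ ω, liminf (fun i => ‖stepSum θ (N * ns i) (past ε t ω) a‖ₑ ^ s) atTop ∂μ := by
        refine lintegral_congr_ae ?_
        filter_upwards [hns] with ω hω
        exact (((ENNReal.continuous_rpow_const.tendsto _).comp
          (continuous_enorm.tendsto _ |>.comp hω)).liminf_eq).symm
    _ ≤ liminf (fun i => ∫⁻ ω, ‖stepSum θ (N * ns i) (past ε t ω) a‖ₑ ^ s ∂μ) atTop :=
        lintegral_liminf_le fun i => (((measurable_pi_apply a).comp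
          ((measurable_stepSum θ _).comp (hε.measurable_past t))).enorm.pow_const s)
    _ ≤ β * (1 - κ)⁻¹ := by
        refine (liminf_le_liminf (Eventually.of_forall fun i => hB (ns i))).trans ?_
        simp

end State

/-! ### Subexponential growth into the past -/

section Tempered

/-- A two-sided sequence growing subexponentially in the past. -/
def IsTempered (y : ℤ → ℝ) : Prop :=
  ∀ (t : ℤ) (r : ℝ), 0 < r → r < 1 → Summable fun l : ℕ => r ^ l * y (t - l)

/-- The inclusion of ℓ^s in ℓ^1: all terms are bounded, so a_l is at most a constant times a_l^s. -/
theorem tsum_lt_top_of_tsum_rpow_lt_top {a : ℕ → ℝ≥0∞} {s : ℝ} (hs : 0 < s) (hs1 : s ≤ 1)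
    (h : ∑' l, a l ^ s < ∞) : ∑' l, a l < ∞ := by
  set A := ∑' l, a l ^ s
  have ha : ∀ l, a l ≤ A ^ (1 / s) := fun l => by
    have h1 : a l ^ s ≤ A := ENNReal.le_tsum l
    have h2 := ENNReal.rpow_le_rpow h1 (one_div_pos.2 hs).le
    rwa [← ENNReal.rpow_mul, mul_one_div_cancel hs.ne', ENNReal.rpow_one] at h2
  have hb : ∀ l, a l ≤ a l ^ s * (A ^ (1 / s)) ^ (1 - s) := fun l => by
    calc a l = a l ^ s * a l ^ (1 - s) := by
          rw [← ENNReal.rpow_add_of_nonneg _ _ hs.le (by linarith)]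
          simp
      _ ≤ _ := by
          have : 0 ≤ 1 - s := by linarith
          gcongr
          exact ha l
  calc ∑' l, a l ≤ ∑' l, a l ^ s * (A ^ (1 / s)) ^ (1 - s) := ENNReal.tsum_le_tsum hb
    _ = A * (A ^ (1 / s)) ^ (1 - s) := ENNReal.tsum_mul_right
    _ < ∞ := ENNReal.mul_lt_top h (ENNReal.rpow_lt_top_of_nonneg (by linarith)
        (ENNReal.rpow_lt_top_of_nonneg (one_div_pos.2 hs).le h.ne).ne)

theorem summable_of_tsum_enorm_lt_top {f : ℕ → ℝ} (h : ∑' l, ‖f l‖ₑ < ∞) : Summable f := by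
  refine Summable.of_norm ?_
  simpa using ENNReal.summable_toReal h.ne

variable {Ω : Type*} [MeasurableSpace Ω] {μ : Measure Ω}

/-- The expectation of Σ (r^l Y_{t-l})^s is a convergent geometric series, and summable s-th powers
are summable. -/
theorem ae_isTempered_of_moment {Y : ℤ → Ω → ℝ} (hYm : ∀ t, AEMeasurable (Y t) μ)
    (hY0 : ∀ t ω, 0 ≤ Y t ω) {s : ℝ} (hs : 0 < s) (hs1 : s ≤ 1) {K : ℝ≥0∞} (hK : K < ∞)
    (hY : ∀ t, ∫⁻ ω, ‖Y t ω‖ₑ ^ s ∂μ ≤ K) : ∀ᵐ ω ∂μ, IsTempered fun t => Y t ω := by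
  have key : ∀ (r : ℝ), 0 < r → r < 1 → ∀ t : ℤ,
      ∀ᵐ ω ∂μ, Summable fun l : ℕ => r ^ l * Y (t - l) ω := by
    intro r hr hr1 t
    have hm : ∀ l : ℕ, AEMeasurable (fun ω => ‖r ^ l * Y (t - l) ω‖ₑ ^ s) μ := fun l =>
      ((hYm _).const_mul _).enorm.pow_const s
    have hfin : ∫⁻ ω, ∑' l : ℕ, ‖r ^ l * Y (t - l) ω‖ₑ ^ s ∂μ < ∞ := by
      rw [lintegral_tsum hm]
      calc ∑' l : ℕ, ∫⁻ ω, ‖r ^ l * Y (t - l) ω‖ₑ ^ s ∂μ ≤ ∑' l : ℕ, (‖r‖ₑ ^ s) ^ l * K := by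
            refine ENNReal.tsum_le_tsum fun l => ?_
            have e : ∀ ω, ‖r ^ l * Y (t - l) ω‖ₑ ^ s = (‖r‖ₑ ^ s) ^ l * ‖Y (t - l) ω‖ₑ ^ s := by
              intro ω
              rw [enorm_mul, ENNReal.mul_rpow_of_nonneg _ _ hs.le, enorm_pow,
                ← ENNReal.rpow_natCast, ← ENNReal.rpow_natCast, ← ENNReal.rpow_mul,
                ← ENNReal.rpow_mul, mul_comm s]
            simp only [e]
            rw [lintegral_const_mul'' _ ((hYm _).enorm.pow_const s)]
            gcongr
            exact hY _
        _ = (1 - ‖r‖ₑ ^ s)⁻¹ * K := by rw [ENNReal.tsum_mul_right, ENNReal.tsum_geometric]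
        _ < ∞ := by
            refine ENNReal.mul_lt_top ?_ hK
            rw [ENNReal.inv_lt_top]
            refine tsub_pos_of_lt (ENNReal.rpow_lt_one ?_ hs)
            rw [Real.enorm_eq_ofReal hr.le, ENNReal.ofReal_lt_one]
            exact hr1
    filter_upwards [ae_lt_top' (AEMeasurable.tsum hm) hfin.ne] with ω hω
    exact summable_of_tsum_enorm_lt_top (tsum_lt_top_of_tsum_rpow_lt_top hs hs1 hω)
  -- The null set depends on r, so it is taken for countably many rates increasing to 1, and smaller
  -- r follow by comparison. The 2 keeps the first rate positive.
  have hall : ∀ᵐ ω ∂μ, ∀ (n : ℕ) (t : ℤ),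
      Summable fun l : ℕ => (1 - 1 / ((n : ℝ) + 2)) ^ l * Y (t - l) ω := by
    rw [ae_all_iff]
    intro n
    rw [ae_all_iff]
    have h2 : (0 : ℝ) < (n : ℝ) + 2 := by positivity
    refine key _ ?_ ?_
    · rw [sub_pos, div_lt_one h2]
      linarith [(Nat.cast_nonneg n : (0 : ℝ) ≤ n)]
    · have : 0 < 1 / ((n : ℝ) + 2) := by positivity
      linarith
  filter_upwards [hall] with ω hω
  intro t r hr hr1
  obtain ⟨n, hn⟩ := exists_nat_one_div_lt (sub_pos.2 hr1)
  refine Summable.of_nonneg_of_le (fun l => mul_nonneg (by positivity) (hY0 _ _)) (fun l => ?_)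
    (hω n t)
  refine mul_le_mul_of_nonneg_right (pow_le_pow_left₀ hr.le ?_ l) (hY0 _ _)
  have : 1 / ((n : ℝ) + 2) ≤ 1 / ((n : ℝ) + 1) := by gcongr; norm_num
  linarith

end Tempered

/-! ### The volatility series as the unique tempered solution -/

section FullVariance

variable {p q : ℕ} {θ : Param p q}

/-- The series `c₀(θ) + ∑_{i ≥ 1} c_i(θ) y_{t-i}`. -/
noncomputable def fullVar (θ : Param p q) (y : ℤ → ℝ) (t : ℤ) : ℝ :=
  coeff θ 0 + ∑' i : ℕ, coeff θ (i + 1) * y (t - (i + 1 : ℕ))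

/-- The term-by-term differential of `fullVar` in direction `h`. -/
noncomputable def fullDeriv (θ h : Param p q) (y : ℤ → ℝ) (t : ℤ) : ℝ :=
  coeffDeriv θ 0 h + ∑' i : ℕ, coeffDeriv θ (i + 1) h * y (t - (i + 1 : ℕ))

theorem IsTempered.summable_lag {y : ℤ → ℝ} (hy : IsTempered y) (t : ℤ) {r : ℝ} (hr : 0 < r)
    (hr1 : r < 1) : Summable fun i : ℕ => r ^ (i + 1) * y (t - (i + 1 : ℕ)) :=
  (summable_nat_add_iff 1).2 (hy t r hr hr1)

theorem IsAdmissible.summable_coeff_mul (hθ : IsAdmissible θ) {y : ℤ → ℝ} (hy0 : ∀ t, 0 ≤ y t)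
    (hy : IsTempered y) (t : ℤ) :
    Summable fun i : ℕ => coeff θ (i + 1) * y (t - (i + 1 : ℕ)) := by
  obtain ⟨ρ, hρ, hρ1, hsum⟩ := hθ.exists_rate
  obtain ⟨C, hC, hc⟩ := hθ.coeff_le hρ hρ1 hsum
  refine Summable.of_nonneg_of_le (fun i => mul_nonneg (hθ.coeff_succ_nonneg i) (hy0 _))
    (fun i => ?_) ((hy.summable_lag t hρ hρ1).mul_left C)
  rw [← mul_assoc]
  exact mul_le_mul_of_nonneg_right (hc i) (hy0 _)

/-- A tempered solution of the homogeneous recursion vanishes. -/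
theorem eq_zero_of_recursion {β : Fin q → ℝ} (hβ : ∀ j, 0 ≤ β j) {ρ : ℝ} (hρ : 0 < ρ)
    (hsum : ∑ j : Fin q, β j * (ρ⁻¹) ^ ((j : ℕ) + 1) < 1) {d : ℤ → ℝ} {t : ℤ} {B : ℝ}
    (hB : ∀ l : ℕ, ρ ^ l * |d (t - l)| ≤ B)
    (hrec : ∀ t, d t = ∑ j : Fin q, β j * d (t - ((j : ℤ) + 1))) : d t = 0 := by
  set f := ∑ j : Fin q, β j * (ρ⁻¹) ^ ((j : ℕ) + 1) with hf
  have hf0 : 0 ≤ f := Finset.sum_nonneg fun j _ => mul_nonneg (hβ j) (by positivity)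
  -- Each use of the recursion contracts the ρ-weighted bound by f < 1; the claim must hold for all
  -- l at once because the recursion reaches further into the past.
  have key : ∀ n l : ℕ, ρ ^ l * |d (t - l)| ≤ f ^ n * B := by
    intro n
    induction n with
    | zero => simpa using hB
    | succ n ih =>
      intro l
      rw [hrec, pow_succ', hf, Finset.sum_mul, Finset.sum_mul]
      refine (mul_le_mul_of_nonneg_left (Finset.abs_sum_le_sum_abs _ _) (by positivity)).trans ?_
      rw [Finset.mul_sum]
      refine Finset.sum_le_sum fun j _ => ?_
      have h1 := ih (l + (j + 1))
      have e : t - ((l + ((j : ℕ) + 1) : ℕ) : ℤ) = t - l - ((j : ℤ) + 1) := by push_cast; ring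
      rw [e] at h1
      rw [abs_mul, abs_of_nonneg (hβ j)]
      calc ρ ^ l * (β j * |d (t - l - ((j : ℤ) + 1))|)
          = β j * (ρ⁻¹) ^ ((j : ℕ) + 1) * (ρ ^ (l + ((j : ℕ) + 1))
            * |d (t - l - ((j : ℤ) + 1))|) := by
            have hp : (ρ ^ ((j : ℕ) + 1))⁻¹ * ρ ^ ((j : ℕ) + 1) = 1 :=
              inv_mul_cancel₀ (by positivity)
            rw [pow_add ρ l, inv_pow]
            linear_combination (-(ρ ^ l * β j * |d (t - l - ((j : ℤ) + 1))|)) * hp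
        _ ≤ β j * (ρ⁻¹) ^ ((j : ℕ) + 1) * (f ^ n * B) :=
            mul_le_mul_of_nonneg_left h1 (mul_nonneg (hβ j) (by positivity))
        _ = _ := by ring
  have hlim : Tendsto (fun n => f ^ n * B) atTop (𝓝 (0 * B)) :=
    (tendsto_pow_atTop_nhds_zero_of_lt_one hf0 hsum).mul_const B
  rw [zero_mul] at hlim
  have h0 : |d t| ≤ 0 := ge_of_tendsto' hlim fun n => by simpa using key n 0
  exact abs_nonpos_iff.1 h0

/-- Insert the recursion of the coefficients into the series and re-index each t_j part as the
series at an earlier time. -/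
theorem IsAdmissible.fullVar_recursion (hθ : IsAdmissible θ) {y : ℤ → ℝ} (hy0 : ∀ t, 0 ≤ y t)
    (hy : IsTempered y) (t : ℤ) :
    fullVar θ y t = θ.1 0 + ∑ i : Fin p, θ.1 i.succ * y (t - ((i : ℤ) + 1))
      + ∑ j : Fin q, θ.2 j * fullVar θ y (t - ((j : ℤ) + 1)) := by
  have hW : ∀ t, HasSum (fun i : ℕ => coeff θ (i + 1) * y (t - (i + 1 : ℕ)))
      (fullVar θ y t - coeff θ 0) := fun t => by
    have := (hθ.summable_coeff_mul hy0 hy t).hasSum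
    simpa [fullVar] using this
  have h1 : HasSum (fun i : ℕ => archCoord i θ * y (t - (i + 1 : ℕ)))
      (∑ i : Fin p, θ.1 i.succ * y (t - ((i : ℤ) + 1))) := by
    have h : HasSum (fun i : ℕ => archCoord i θ * y (t - (i + 1 : ℕ)))
        (∑ i ∈ Finset.range p, archCoord i θ * y (t - (i + 1 : ℕ))) :=
      hasSum_sum_of_ne_finset_zero fun i hi => by
        rw [archCoord_apply, dif_neg (by simpa using hi), zero_mul]
    rw [← Fin.sum_univ_eq_sum_range (fun i : ℕ => archCoord i θ * y (t - (i + 1 : ℕ)))] at h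
    convert h using 2 with i
    rw [archCoord_apply, dif_pos i.2]
    push_cast
    rfl
  have h2 : ∀ j : Fin q, HasSum (fun i : ℕ => (if (j : ℕ) < i then θ.2 j * coeff θ (i - j) else 0)
      * y (t - (i + 1 : ℕ))) (θ.2 j * (fullVar θ y (t - ((j : ℤ) + 1)) - coeff θ 0)) := by
    intro j
    -- The first j + 1 terms vanish since c₀ does not enter the recursion of the c_i; what remains
    -- is the earlier series without its constant.
    have hz : ∑ i ∈ Finset.range ((j : ℕ) + 1),
        (if (j : ℕ) < i then θ.2 j * coeff θ (i - j) else 0) * y (t - (i + 1 : ℕ)) = 0 :=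
      Finset.sum_eq_zero fun i hi => by
        rw [if_neg (by have := Finset.mem_range.1 hi; omega), zero_mul]
    have := (hasSum_nat_add_iff (f := fun i : ℕ =>
      (if (j : ℕ) < i then θ.2 j * coeff θ (i - j) else 0) * y (t - (i + 1 : ℕ)))
      (g := θ.2 j * (fullVar θ y (t - ((j : ℤ) + 1)) - coeff θ 0)) ((j : ℕ) + 1)).1 ?_
    · rwa [hz, add_zero] at this
    · have h := (hW (t - ((j : ℤ) + 1))).mul_left (θ.2 j)
      refine h.congr_fun fun i => ?_
      have e1 : i + ((j : ℕ) + 1) - j = i + 1 := by omega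
      have e2 : t - ((i + ((j : ℕ) + 1) + 1 : ℕ) : ℤ) = t - ((j : ℤ) + 1) - (i + 1 : ℕ) := by
        push_cast; ring
      rw [if_pos (by omega), e1, e2, mul_assoc]
  have h3 := h1.add (hasSum_sum (s := Finset.univ) fun j _ => h2 j)
  have h4 : (fun i : ℕ => coeff θ (i + 1) * y (t - (i + 1 : ℕ)))
      = fun i : ℕ => archCoord i θ * y (t - (i + 1 : ℕ)) + ∑ j : Fin q,
        (if (j : ℕ) < i then θ.2 j * coeff θ (i - j) else 0) * y (t - (i + 1 : ℕ)) := by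
    funext i
    rw [coeff_succ, add_mul, Finset.sum_mul]
  have h5 := (hW t).unique (h4 ▸ h3)
  -- The definition of c₀ is exactly what makes the constants balance.
  have h6 : θ.1 0 = coeff θ 0 * (1 - ∑ j, θ.2 j) := by
    rw [coeff_zero, div_mul_cancel₀]
    linarith [hθ.sum_lt_one]
  simp only [mul_sub, Finset.sum_sub_distrib] at h5
  rw [← Finset.sum_mul] at h5
  linarith

/-- A tempered solution of the volatility recursion is the infinite series. -/
theorem IsAdmissible.eq_fullVar (hθ : IsAdmissible θ) {y v : ℤ → ℝ} (hy0 : ∀ t, 0 ≤ y t)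
    (hy : IsTempered y) (hv0 : ∀ t, 0 ≤ v t) (hv : IsTempered v)
    (hrec : ∀ t, v t = θ.1 0 + ∑ i : Fin p, θ.1 i.succ * y (t - ((i : ℤ) + 1))
      + ∑ j : Fin q, θ.2 j * v (t - ((j : ℤ) + 1))) (t : ℤ) : v t = fullVar θ y t := by
  obtain ⟨ρ, hρ, hρ1, hsum⟩ := hθ.exists_rate
  obtain ⟨C, hC, hc⟩ := hθ.coeff_le hρ hρ1 hsum
  have hc0 := hθ.coeff_zero_pos
  set S := ∑' l : ℕ, ρ ^ l * y (t - l)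
  set S' := ∑' l : ℕ, ρ ^ l * v (t - l)
  have hW0 : ∀ t, 0 ≤ fullVar θ y t := fun t =>
    add_nonneg hc0.le (tsum_nonneg fun i => mul_nonneg (hθ.coeff_succ_nonneg i) (hy0 _))
  -- The coefficients decay at rate ρ, so the ρ-discounted series at time t - l is a tail of one
  -- fixed convergent series, bounded uniformly in l.
  have hWle : ∀ l : ℕ, ρ ^ l * fullVar θ y (t - l) ≤ coeff θ 0 + C * S := by
    intro l
    rw [fullVar, mul_add]
    refine add_le_add (mul_le_of_le_one_left hc0.le (pow_le_one₀ hρ.le hρ1.le)) ?_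
    rw [← tsum_mul_left, ← tsum_mul_left]
    have hs := (hy t ρ hρ hρ1).mul_left C
    have hs2 := (summable_nat_add_iff (f := fun m : ℕ => C * (ρ ^ m * y (t - m))) (l + 1)).2 hs
    have hle : ∀ i : ℕ, ρ ^ l * (coeff θ (i + 1) * y (t - l - (i + 1 : ℕ)))
        ≤ C * (ρ ^ (i + (l + 1)) * y (t - (i + (l + 1) : ℕ))) := by
      intro i
      have e : t - ((i + (l + 1) : ℕ) : ℤ) = t - l - (i + 1 : ℕ) := by push_cast; ring
      rw [e, show i + (l + 1) = l + (i + 1) by ring, pow_add]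
      have h1 := mul_le_mul_of_nonneg_right (hc i) (hy0 (t - l - (i + 1 : ℕ)))
      have h2 := mul_le_mul_of_nonneg_left h1 (pow_nonneg hρ.le l)
      linarith
    refine (Summable.tsum_le_tsum hle (Summable.of_nonneg_of_le (fun i => ?_) hle hs2) hs2).trans ?_
    · exact mul_nonneg (by positivity) (mul_nonneg (hθ.coeff_succ_nonneg i) (hy0 _))
    · rw [← hs.sum_add_tsum_nat_add (l + 1)]
      exact le_add_of_nonneg_left (Finset.sum_nonneg fun m _ =>
        mul_nonneg hC.le (mul_nonneg (by positivity) (hy0 _)))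
  have hvle : ∀ l : ℕ, ρ ^ l * v (t - l) ≤ S' := fun l =>
    (hv t ρ hρ hρ1).le_tsum l fun m _ => mul_nonneg (by positivity) (hv0 _)
  have h := eq_zero_of_recursion (d := fun t => v t - fullVar θ y t) (t := t)
    (B := S' + (coeff θ 0 + C * S)) (fun j => (hθ.snd_pos j).le) hρ hsum (fun l => ?_) fun t => ?_
  · exact sub_eq_zero.1 h
  · have h1 := abs_sub (v (t - l)) (fullVar θ y (t - l))
    rw [abs_of_nonneg (hv0 _), abs_of_nonneg (hW0 _)] at h1
    have h2 := mul_le_mul_of_nonneg_left h1 (pow_nonneg hρ.le l)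
    have h3 := hWle l
    have h4 := hvle l
    linarith
  · simp only [mul_sub, Finset.sum_sub_distrib]
    rw [hrec t, hθ.fullVar_recursion hy0 hy t]
    ring

end FullVariance

/-! ### Expansion of the estimated variance around the volatility series -/

section Expansion

variable {p q : ℕ} {θ : Param p q}

/-- A random envelope for the relative size of the terms of the volatility series. -/
noncomputable def envelope (lam s : ℝ) (y : ℤ → ℝ) (t : ℤ) : ℝ :=
  1 + ∑' i : ℕ, (lam ^ 8) ^ (i + 1) * y (t - (i + 1 : ℕ)) ^ s

/-- The discounted sum of the unobserved values before time `0`. -/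
noncomputable def initialTail (lam : ℝ) (y : ℤ → ℝ) : ℝ :=
  ∑' i : ℕ, lam ^ (i + 1) * y (0 - (i + 1 : ℕ))

theorem rpow_le_one_add_self {s u : ℝ} (hu : 0 ≤ u) (hs : 0 ≤ s) (hs1 : s ≤ 1) :
    u ^ s ≤ 1 + u := by
  rcases le_total u 1 with h | h
  · exact (Real.rpow_le_one hu h hs).trans (by linarith)
  · calc u ^ s ≤ u ^ (1 : ℝ) := Real.rpow_le_rpow_of_exponent_le h hs1
      _ = u := Real.rpow_one u
      _ ≤ _ := by linarith

theorem IsTempered.summable_envelope {y : ℤ → ℝ} (hy0 : ∀ t, 0 ≤ y t) (hy : IsTempered y)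
    {lam s : ℝ} (hl : 0 < lam) (hl1 : lam < 1) (hs : 0 ≤ s) (hs1 : s ≤ 1) (t : ℤ) :
    Summable fun i : ℕ => (lam ^ 8) ^ (i + 1) * y (t - (i + 1 : ℕ)) ^ s := by
  have h8 : 0 < lam ^ 8 := by positivity
  have h81 : lam ^ 8 < 1 := pow_lt_one₀ hl.le hl1 (by norm_num)
  have h1 := (hy.summable_lag t h8 h81).add
    ((summable_nat_add_iff 1).2 (summable_geometric_of_lt_one h8.le h81))
  refine Summable.of_nonneg_of_le
    (fun i => mul_nonneg (by positivity) (Real.rpow_nonneg (hy0 _) s)) (fun i => ?_) h1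
  have := rpow_le_one_add_self (hy0 (t - (i + 1 : ℕ))) hs hs1
  calc _ ≤ (lam ^ 8) ^ (i + 1) * (1 + y (t - (i + 1 : ℕ))) := by gcongr
    _ = _ := by ring

theorem one_le_envelope {y : ℤ → ℝ} (hy0 : ∀ t, 0 ≤ y t) {lam s : ℝ} (hl : 0 < lam) (t : ℤ) :
    1 ≤ envelope lam s y t :=
  le_add_of_nonneg_right (tsum_nonneg fun _ =>
    mul_nonneg (by positivity) (Real.rpow_nonneg (hy0 _) s))

theorem IsAdmissible.coeff_zero_le_fullVar (hθ : IsAdmissible θ) {y : ℤ → ℝ}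
    (hy0 : ∀ t, 0 ≤ y t) (t : ℤ) : coeff θ 0 ≤ fullVar θ y t :=
  le_add_of_nonneg_right (tsum_nonneg fun i => mul_nonneg (hθ.coeff_succ_nonneg i) (hy0 _))

/-- Each term of the volatility series is a geometrically small fraction of the total, up to a
power of the envelope. -/
theorem IsAdmissible.coeff_mul_le (hθ : IsAdmissible θ) {ρ C s : ℝ} (hρ : 0 < ρ) (hρ1 : ρ < 1)
    (hC : 0 < C) (hc : ∀ m, coeff θ (m + 1) ≤ C * ρ ^ (m + 1)) (hs : 0 < s) (hs1 : s ≤ 1)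
    {y : ℤ → ℝ} (hy0 : ∀ t, 0 ≤ y t) (hy : IsTempered y) (t : ℤ) (i : ℕ) :
    coeff θ (i + 1) * y (t - (i + 1 : ℕ)) ≤ (C / coeff θ 0) ^ (s / 4)
      * ((ρ ^ (s / 16)) ^ 2) ^ (i + 1)
      * (envelope (ρ ^ (s / 16)) s y t ^ (1 / 4 : ℝ) * fullVar θ y t) := by
  set lam := ρ ^ (s / 16) with hlam
  have hl : 0 < lam := Real.rpow_pos_of_pos hρ _
  have hl1 : lam < 1 := Real.rpow_lt_one hρ.le hρ1 (by positivity)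
  have hc0 := hθ.coeff_zero_pos
  set c0 := coeff θ 0
  set Y := y (t - (i + 1 : ℕ)) with hY
  have hY0 : 0 ≤ Y := hy0 _
  set c := coeff θ (i + 1) with hcdef
  have hcn : 0 ≤ c := hθ.coeff_succ_nonneg i
  set W := fullVar θ y t with hW
  set Q := envelope lam s y t with hQ
  have hWc0 : c0 ≤ W := hθ.coeff_zero_le_fullVar hy0 t
  have hWc : c * Y ≤ W := by
    have := (hθ.summable_coeff_mul hy0 hy t).le_tsum i fun j _ =>
      mul_nonneg (hθ.coeff_succ_nonneg j) (hy0 _)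
    rw [hW, fullVar]
    linarith
  have hW0 : 0 ≤ W := hc0.le.trans hWc0
  set u := c * Y / c0 with hu
  have hu0 : 0 ≤ u := by positivity
  have hcu : c * Y = c0 * u := by rw [hu]; field_simp
  -- W dominates both c₀ and c Y, so c Y / W ≤ min(u, 1) ≤ u^(s/4); this lowers the power of Y to
  -- one with a moment.
  have h1 : c * Y ≤ u ^ (s / 4) * W := by
    rcases le_total u 1 with h | h
    · have : u ≤ u ^ (s / 4) := by
        rcases hu0.eq_or_lt with h0 | h0
        · rw [← h0]; exact Real.rpow_nonneg le_rfl _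
        · calc u = u ^ (1 : ℝ) := (Real.rpow_one u).symm
            _ ≤ u ^ (s / 4) := Real.rpow_le_rpow_of_exponent_ge h0 h (by linarith)
      rw [hcu, mul_comm]
      exact mul_le_mul this hWc0 hc0.le (Real.rpow_nonneg hu0 _)
    · have : 1 ≤ u ^ (s / 4) := Real.one_le_rpow h (by positivity)
      nlinarith
  have h2 : u ^ (s / 4) ≤ (C / c0) ^ (s / 4) * (lam ^ 2) ^ (i + 1) * Q ^ (1 / 4 : ℝ) := by
    have hle : u ≤ C / c0 * (ρ ^ (i + 1) * Y) := by
      rw [hu, div_mul_eq_mul_div]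
      refine div_le_div_of_nonneg_right ?_ hc0.le
      rw [← mul_assoc]
      exact mul_le_mul_of_nonneg_right (hc i) hY0
    have hterm : (lam ^ 8) ^ (i + 1) * Y ^ s ≤ Q := by
      have := (hy.summable_envelope hy0 hl hl1 hs.le hs1 t).le_tsum i fun j _ =>
        mul_nonneg (by positivity) (Real.rpow_nonneg (hy0 _) s)
      rw [hQ, envelope]
      linarith
    have hYs : 0 ≤ Y ^ s := Real.rpow_nonneg hY0 s
    have hlp : ∀ (a b : ℕ) (r : ℝ), (a : ℝ) * r = b →
        ((lam ^ a) ^ (i + 1)) ^ r = (lam ^ b) ^ (i + 1) := by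
      intro a b r hab
      rw [← pow_mul, ← pow_mul, ← Real.rpow_natCast lam, ← Real.rpow_natCast lam,
        ← Real.rpow_mul hl.le]
      congr 1
      push_cast
      rw [← hab]
      ring
    -- The choice λ = ρ^(s/16) gives λ⁴, split as λ² · (λ⁸)^(1/4): one part remains as decay, the
    -- other weights Y^s inside the envelope.
    have hρl : (ρ ^ (i + 1)) ^ (s / 4) = (lam ^ 4) ^ (i + 1) := by
      rw [hlam, ← Real.rpow_natCast ρ, ← Real.rpow_mul hρ.le, ← pow_mul,
        ← Real.rpow_natCast (ρ ^ (s / 16)), ← Real.rpow_mul hρ.le]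
      congr 1
      push_cast
      ring
    calc u ^ (s / 4) ≤ (C / c0 * (ρ ^ (i + 1) * Y)) ^ (s / 4) :=
          Real.rpow_le_rpow hu0 hle (by positivity)
      _ = (C / c0) ^ (s / 4) * ((lam ^ 2) ^ (i + 1)
          * ((lam ^ 8) ^ (i + 1) * Y ^ s) ^ (1 / 4 : ℝ)) := by
          rw [Real.mul_rpow (by positivity) (by positivity), Real.mul_rpow (by positivity) hY0,
            Real.mul_rpow (by positivity) hYs, hρl, hlp 8 2 (1 / 4) (by norm_num),
            ← Real.rpow_mul hY0, show s * (1 / 4 : ℝ) = s / 4 by ring]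
          ring
      _ ≤ (C / c0) ^ (s / 4) * ((lam ^ 2) ^ (i + 1) * Q ^ (1 / 4 : ℝ)) := by
          gcongr
      _ = _ := by ring
  calc c * Y ≤ u ^ (s / 4) * W := h1
    _ ≤ ((C / c0) ^ (s / 4) * (lam ^ 2) ^ (i + 1) * Q ^ (1 / 4 : ℝ)) * W :=
        mul_le_mul_of_nonneg_right h2 hW0
    _ = _ := by ring

theorem sum_Icc_one_eq_sum_range (f : ℕ → ℝ) (t : ℕ) :
    ∑ i ∈ Finset.Icc 1 t, f i = ∑ i ∈ Finset.range t, f (i + 1) := by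
  induction t with
  | zero => simp
  | succ t ih => rw [Finset.sum_Icc_succ_top (by omega), ih, Finset.sum_range_succ]

theorem condVarEst_eq (u : Param p q) (x : ℤ → ℝ) (t : ℕ) :
    condVarEst u x t
      = coeff u 0 + ∑ i ∈ Finset.range t, coeff u (i + 1) * x ((t : ℤ) - (i + 1 : ℕ)) ^ 2 := by
  rw [condVarEst, sum_Icc_one_eq_sum_range]

set_option maxHeartbeats 1600000 in
/-- First order expansion of the truncated conditional variance estimate around the volatility
series, with explicit control of the remainder. -/
theorem IsAdmissible.exists_expansion (hθ : IsAdmissible θ) {a : ℝ} (ha : 0 < a)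
    (h1 : ∀ i, a ≤ θ.1 i) (h2 : ∀ j, a ≤ θ.2 j) {s : ℝ} (hs : 0 < s) (hs1 : s ≤ 1) :
    ∃ lam K δ : ℝ, 0 < lam ∧ lam < 1 ∧ 0 < K ∧ 0 < δ ∧ δ ≤ 1 ∧
      ∀ x : ℤ → ℝ, IsTempered (fun t => x t ^ 2) →
        (∀ (t : ℤ) (h : Param p q),
          Summable fun i : ℕ => coeffDeriv θ (i + 1) h * x (t - (i + 1 : ℕ)) ^ 2) ∧
        (∀ (t : ℤ) (h : Param p q), |fullDeriv θ h (fun t => x t ^ 2) t|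
          ≤ K * (‖h‖ * (envelope lam s (fun t => x t ^ 2) t ^ (1 / 4 : ℝ)
            * fullVar θ (fun t => x t ^ 2) t))) ∧
        ∀ h : Param p q, ‖h‖ ≤ δ → ∀ t : ℕ, coeff θ 0 / 2 ≤ condVarEst (θ + h) x t ∧
          |condVarEst (θ + h) x t - fullVar θ (fun t => x t ^ 2) t
            - fullDeriv θ h (fun t => x t ^ 2) t|
          ≤ K * (‖h‖ ^ 2 * (envelope lam s (fun t => x t ^ 2) t ^ (1 / 4 : ℝ)
            * fullVar θ (fun t => x t ^ 2) t) + lam ^ t * initialTail lam (fun t => x t ^ 2)) := by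
  obtain ⟨ρ, hρ, hρ1, hsum⟩ := hθ.exists_rate
  obtain ⟨C, hC, hc⟩ := hθ.coeff_le hρ hρ1 hsum
  obtain ⟨δ0, hδ0, B, hB, hexp0⟩ := hθ.exists_abs_coeff_zero_sub_le
  obtain ⟨B', hB', hder0⟩ := hθ.exists_abs_coeffDeriv_zero_le
  have hc0 := hθ.coeff_zero_pos
  set lam := ρ ^ (s / 16) with hlam
  have hl : 0 < lam := Real.rpow_pos_of_pos hρ _
  have hl1 : lam < 1 := Real.rpow_lt_one hρ.le hρ1 (by positivity)
  have hρlam : ρ ≤ lam ^ 2 := by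
    rw [hlam, ← Real.rpow_natCast, ← Real.rpow_mul hρ.le]
    calc ρ = ρ ^ (1 : ℝ) := (Real.rpow_one ρ).symm
      _ ≤ _ := Real.rpow_le_rpow_of_exponent_ge hρ hρ1.le (by push_cast; linarith)
  set K1 := (C / coeff θ 0) ^ (s / 4) with hK1
  have hK1p : 0 < K1 := Real.rpow_pos_of_pos (by positivity) _
  have hsq : Summable fun i : ℕ => ((i + 1 : ℕ) : ℝ) ^ 2 * lam ^ (i + 1) :=
    (summable_nat_add_iff (f := fun n : ℕ => (n : ℝ) ^ 2 * lam ^ n) 1).2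
      (summable_pow_mul_geometric_of_norm_lt_one 2 (by
        rw [Real.norm_eq_abs, abs_of_pos hl]; exact hl1))
  set S := ∑' i : ℕ, ((i + 1 : ℕ) : ℝ) ^ 2 * lam ^ (i + 1) with hS
  have hSterm : ∀ i : ℕ, ((i + 1 : ℕ) : ℝ) ^ 2 * lam ^ (i + 1) ≤ S := fun i =>
    hsq.le_tsum i fun j _ => by positivity
  have hS0 : 0 < S := lt_of_lt_of_le (by positivity) (hSterm 0)
  have hli : 1 < lam⁻¹ := (one_lt_inv₀ hl).2 hl1
  -- With η = ‖h‖ / a, the last two bounds give η ≤ 1 and (1 + η) λ ≤ 1; δ0 is the range of the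
  -- expansion of c₀.
  set δ := min (min δ0 1) (min a (a * (lam⁻¹ - 1))) with hδ
  have hδp : 0 < δ := by
    have : 0 < lam⁻¹ - 1 := by linarith
    positivity
  set K := B' / coeff θ 0 + a⁻¹ * K1 * S + (B / coeff θ 0 + a⁻¹ ^ 2 * K1 * S)
    + C * (lam⁻¹ * S) with hK
  have hKp : 0 < K := by positivity
  refine ⟨lam, K, δ, hl, hl1, hKp, hδp, (min_le_left _ _).trans (min_le_right _ _),
    fun x hx => ?_⟩
  set y : ℤ → ℝ := fun t => x t ^ 2 with hy
  have hy0 : ∀ t, 0 ≤ y t := fun t => sq_nonneg _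
  have hterm := fun t i => hθ.coeff_mul_le hρ hρ1 hC hc hs hs1 hy0 hx t i
  rw [← hlam, ← hK1] at hterm
  set G : ℤ → ℝ := fun t => envelope lam s y t ^ (1 / 4 : ℝ) with hG
  have hG1 : ∀ t, 1 ≤ G t := fun t =>
    Real.one_le_rpow (one_le_envelope hy0 hl t) (by norm_num)
  set W : ℤ → ℝ := fullVar θ y with hW
  have hWc : ∀ t, coeff θ 0 ≤ W t := fun t => hθ.coeff_zero_le_fullVar hy0 t
  have hW0 : ∀ t, 0 < W t := fun t => hc0.trans_le (hWc t)
  have hGW : ∀ t, 1 ≤ (coeff θ 0)⁻¹ * (G t * W t) := fun t => by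
    rw [← div_eq_inv_mul, one_le_div hc0]
    nlinarith [hG1 t, hWc t]
  have hGW0 : ∀ t, 0 < G t * W t := fun t => mul_pos (by linarith [hG1 t]) (hW0 t)
  have hn1 : ∀ i : ℕ, (1 : ℝ) ≤ ((i + 1 : ℕ) : ℝ) := fun i => by
    push_cast; linarith [(Nat.cast_nonneg i : (0 : ℝ) ≤ i)]
  -- The index factor from the derivative is enlarged to its square, so that the single sum S serves
  -- for first and second order terms.
  have hdb : ∀ (t : ℤ) (h : Param p q) (i : ℕ), ‖coeffDeriv θ (i + 1) h * y (t - (i + 1 : ℕ))‖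
      ≤ (‖h‖ * a⁻¹ * K1 * (G t * W t)) * (((i + 1 : ℕ) : ℝ) ^ 2 * lam ^ (i + 1)) := by
    intro t h i
    have hrel : IsRelSmall θ h (‖h‖ * a⁻¹) := isRelSmall_of_norm_le h1 h2 (by positivity)
      (by rw [inv_mul_cancel_right₀ ha.ne'])
    rw [Real.norm_eq_abs, abs_mul, abs_of_nonneg (hy0 _)]
    calc |coeffDeriv θ (i + 1) h| * y (t - (i + 1 : ℕ))
        ≤ ((i + 1 : ℕ) * (‖h‖ * a⁻¹) * coeff θ (i + 1)) * y (t - (i + 1 : ℕ)) :=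
          mul_le_mul_of_nonneg_right (hrel.abs_coeffDeriv_le hθ (by positivity) i) (hy0 _)
      _ = ((i + 1 : ℕ) * (‖h‖ * a⁻¹)) * (coeff θ (i + 1) * y (t - (i + 1 : ℕ))) := by ring
      _ ≤ ((i + 1 : ℕ) ^ 2 * (‖h‖ * a⁻¹)) * (K1 * lam ^ (i + 1) * (G t * W t)) := by
          refine mul_le_mul ?_ ((hterm t i).trans ?_)
            (mul_nonneg (hθ.coeff_succ_nonneg i) (hy0 _)) (by positivity)
          · refine mul_le_mul_of_nonneg_right ?_ (by positivity)
            nlinarith [hn1 i]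
          · have : (lam ^ 2) ^ (i + 1) ≤ lam ^ (i + 1) :=
              pow_le_pow_left₀ (by positivity) (by nlinarith) _
            have := hGW0 t
            gcongr
      _ = _ := by ring
  have hdsum : ∀ (t : ℤ) (h : Param p q),
      Summable fun i : ℕ => coeffDeriv θ (i + 1) h * y (t - (i + 1 : ℕ)) := fun t h =>
    Summable.of_norm_bounded (hsq.mul_left _) (hdb t h)
  refine ⟨hdsum, fun t h => ?_, fun h hh t => ?_⟩
  · have e1 : |coeffDeriv θ 0 h| ≤ B' / coeff θ 0 * (‖h‖ * (G t * W t)) := by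
      refine (hder0 h).trans ?_
      have := mul_le_mul_of_nonneg_left (hGW t) (by positivity : 0 ≤ B' * ‖h‖)
      calc B' * ‖h‖ = B' * ‖h‖ * 1 := by ring
        _ ≤ _ := this
        _ = _ := by ring
    have e2 := tsum_of_norm_bounded (hsq.hasSum.mul_left (‖h‖ * a⁻¹ * K1 * (G t * W t))) (hdb t h)
    rw [Real.norm_eq_abs, ← hS] at e2
    rw [fullDeriv]
    have hp := hGW0 t
    calc _ ≤ B' / coeff θ 0 * (‖h‖ * (G t * W t)) + ‖h‖ * a⁻¹ * K1 * (G t * W t) * S :=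
          (abs_add_le _ _).trans (add_le_add e1 e2)
      _ = (B' / coeff θ 0 + a⁻¹ * K1 * S) * (‖h‖ * (G t * W t)) := by ring
      _ ≤ K * (‖h‖ * (G t * W t)) := by
          refine mul_le_mul_of_nonneg_right ?_ (by positivity)
          rw [hK]
          have : 0 < B / coeff θ 0 + a⁻¹ ^ 2 * K1 * S + C * (lam⁻¹ * S) := by positivity
          linarith
  · set η := ‖h‖ * a⁻¹ with hη
    have hη0 : 0 ≤ η := by positivity
    have hη1 : η ≤ 1 := by
      rw [hη, ← div_eq_mul_inv, div_le_one ha]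
      exact hh.trans ((min_le_right _ _).trans (min_le_left _ _))
    have hη2 : (1 + η) * lam ≤ 1 := by
      have : η ≤ lam⁻¹ - 1 := by
        rw [hη, ← div_eq_mul_inv, div_le_iff₀ ha, mul_comm]
        exact hh.trans ((min_le_right _ _).trans (min_le_right _ _))
      calc (1 + η) * lam ≤ lam⁻¹ * lam := by
            refine mul_le_mul_of_nonneg_right (by linarith) hl.le
        _ = 1 := inv_mul_cancel₀ hl.ne'
    have hrel : IsRelSmall θ h η := isRelSmall_of_norm_le h1 h2 hη0
      (by rw [hη, inv_mul_cancel_right₀ ha.ne'])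
    obtain ⟨hq0, hlow⟩ := hexp0 h (hh.trans ((min_le_left _ _).trans (min_le_left _ _)))
    have hu1 : ∀ i, 0 ≤ (θ + h).1 i := fun i => by
      have := (abs_le.1 (hrel.1 i)).1
      have h3 : η * θ.1 i ≤ 1 * θ.1 i := mul_le_mul_of_nonneg_right hη1 (hθ.fst_pos i).le
      change 0 ≤ θ.1 i + h.1 i
      linarith
    have hu2 : ∀ j, 0 ≤ (θ + h).2 j := fun j => by
      have := (abs_le.1 (hrel.2 j)).1
      have h3 : η * θ.2 j ≤ 1 * θ.2 j := mul_le_mul_of_nonneg_right hη1 (hθ.snd_pos j).le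
      change 0 ≤ θ.2 j + h.2 j
      linarith
    rw [condVarEst_eq]
    refine ⟨hlow.trans (le_add_of_nonneg_right (Finset.sum_nonneg fun i _ =>
      mul_nonneg (GARCH.coeff_succ_nonneg hu1 hu2 i) (hy0 _))), ?_⟩
    have hcs := hθ.summable_coeff_mul hy0 hx t
    have hf := hcs.add (hdsum t h)
    have hsplit := hf.sum_add_tsum_nat_add t
    rw [hcs.tsum_add (hdsum t h)] at hsplit
    -- Second order errors of the coefficients that are used, minus the tails of both series that
    -- the truncation omits.
    have e : coeff (θ + h) 0 + ∑ i ∈ Finset.range t, coeff (θ + h) (i + 1)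
          * x ((t : ℤ) - (i + 1 : ℕ)) ^ 2 - W t - fullDeriv θ h y t
        = (coeff (θ + h) 0 - coeff θ 0 - coeffDeriv θ 0 h)
          + ∑ i ∈ Finset.range t, (coeff (θ + h) (i + 1) - coeff θ (i + 1)
            - coeffDeriv θ (i + 1) h) * y ((t : ℤ) - (i + 1 : ℕ))
          - ∑' i : ℕ, (coeff θ (i + t + 1) * y (t - (i + t + 1 : ℕ))
            + coeffDeriv θ (i + t + 1) h * y (t - (i + t + 1 : ℕ))) := by
      simp only [sub_mul, Finset.sum_sub_distrib, Finset.sum_add_distrib] at hsplit ⊢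
      simp only [hW, fullVar, fullDeriv]
      have hyx : ∀ t, y t = x t ^ 2 := fun t => rfl
      simp only [hyx] at hsplit ⊢
      linarith
    rw [e]
    have p1 : |coeff (θ + h) 0 - coeff θ 0 - coeffDeriv θ 0 h|
        ≤ B / coeff θ 0 * (‖h‖ ^ 2 * (G t * W t)) := by
      refine hq0.trans ?_
      have := mul_le_mul_of_nonneg_left (hGW t) (by positivity : 0 ≤ B * ‖h‖ ^ 2)
      calc B * ‖h‖ ^ 2 = B * ‖h‖ ^ 2 * 1 := by ring
        _ ≤ _ := this
        _ = _ := by ring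
    have p2 : |∑ i ∈ Finset.range t, (coeff (θ + h) (i + 1) - coeff θ (i + 1)
            - coeffDeriv θ (i + 1) h) * y ((t : ℤ) - (i + 1 : ℕ))|
        ≤ a⁻¹ ^ 2 * K1 * S * (‖h‖ ^ 2 * (G t * W t)) := by
      refine (Finset.abs_sum_le_sum_abs _ _).trans ?_
      calc ∑ i ∈ Finset.range t, |(coeff (θ + h) (i + 1) - coeff θ (i + 1)
            - coeffDeriv θ (i + 1) h) * y ((t : ℤ) - (i + 1 : ℕ))|
          ≤ ∑ i ∈ Finset.range t, (η ^ 2 * K1 * (G t * W t))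
            * (((i + 1 : ℕ) : ℝ) ^ 2 * lam ^ (i + 1)) := by
            refine Finset.sum_le_sum fun i _ => ?_
            rw [abs_mul, abs_of_nonneg (hy0 _)]
            have b1 := hrel.abs_coeff_sub_sub_le hθ hη0 i
            have b2 := one_add_pow_sub_one_sub_le hη0 (i + 1)
            have b3 := hterm t i
            -- One of the two powers of λ pays for the growth of the perturbed coefficients.
            have b4 : (1 + η) ^ (i + 1) * (lam ^ 2) ^ (i + 1) ≤ lam ^ (i + 1) := by
              rw [← mul_pow]
              refine pow_le_pow_left₀ (by positivity) ?_ _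
              calc (1 + η) * lam ^ 2 = ((1 + η) * lam) * lam := by ring
                _ ≤ 1 * lam := mul_le_mul_of_nonneg_right hη2 hl.le
                _ = lam := one_mul lam
            have hp := hGW0 t
            calc _ ≤ (((1 + η) ^ (i + 1) - 1 - (i + 1 : ℕ) * η) * coeff θ (i + 1))
                    * y ((t : ℤ) - (i + 1 : ℕ)) := mul_le_mul_of_nonneg_right b1 (hy0 _)
              _ = ((1 + η) ^ (i + 1) - 1 - (i + 1 : ℕ) * η) * (coeff θ (i + 1)
                    * y ((t : ℤ) - (i + 1 : ℕ))) := by ring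
              _ ≤ ((i + 1 : ℕ) ^ 2 * η ^ 2 * (1 + η) ^ (i + 1)) * (K1 * (lam ^ 2) ^ (i + 1)
                    * (G t * W t)) :=
                  mul_le_mul b2 b3 (mul_nonneg (hθ.coeff_succ_nonneg i) (hy0 _)) (by positivity)
              _ = (η ^ 2 * K1 * (G t * W t)) * (i + 1 : ℕ) ^ 2
                    * ((1 + η) ^ (i + 1) * (lam ^ 2) ^ (i + 1)) := by ring
              _ ≤ (η ^ 2 * K1 * (G t * W t)) * (i + 1 : ℕ) ^ 2 * lam ^ (i + 1) :=
                  mul_le_mul_of_nonneg_left b4 (by positivity)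
              _ = _ := by ring
        _ = (η ^ 2 * K1 * (G t * W t)) * ∑ i ∈ Finset.range t,
            (((i + 1 : ℕ) : ℝ) ^ 2 * lam ^ (i + 1)) := by rw [Finset.mul_sum]
        _ ≤ (η ^ 2 * K1 * (G t * W t)) * S := by
            have hp := hGW0 t
            refine mul_le_mul_of_nonneg_left ?_ (by positivity)
            exact hsq.sum_le_tsum _ fun i _ => by positivity
        _ = _ := by rw [hη]; ring
    -- In the tail ρ^n ≤ λ^(2n) with n = i + t + 1. One λ^n absorbs the factor 1 + n; the other is
    -- λ^t λ^(i+1), leaving the discounted sum before time 0.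
    have p3 : |∑' i : ℕ, (coeff θ (i + t + 1) * y (t - (i + t + 1 : ℕ))
            + coeffDeriv θ (i + t + 1) h * y (t - (i + t + 1 : ℕ)))|
        ≤ C * (lam⁻¹ * S) * (lam ^ t * initialTail lam y) := by
      have hs' := (hx.summable_lag 0 hl hl1).hasSum.mul_left (C * (lam⁻¹ * S) * lam ^ t)
      have := tsum_of_norm_bounded hs' (f := fun i : ℕ => coeff θ (i + t + 1)
        * y (t - (i + t + 1 : ℕ)) + coeffDeriv θ (i + t + 1) h * y (t - (i + t + 1 : ℕ)))
        fun i => ?_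
      · rw [Real.norm_eq_abs, mul_assoc] at this
        exact this
      · have ey : (t : ℤ) - (i + t + 1 : ℕ) = 0 - (i + 1 : ℕ) := by push_cast; ring
        rw [ey, ← add_mul, Real.norm_eq_abs, abs_mul, abs_of_nonneg (hy0 _)]
        have b1 := hrel.abs_coeffDeriv_le hθ hη0 (i + t)
        have b2 := hc (i + t)
        have b3 := hθ.coeff_succ_nonneg (i + t)
        have b4 := hSterm (i + t)
        have b5 := hn1 (i + t)
        set n := i + t + 1 with hn
        clear_value n
        have c1 : |coeff θ n + coeffDeriv θ n h| ≤ (1 + n) * coeff θ n := by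
          refine (abs_add_le _ _).trans ?_
          rw [abs_of_nonneg b3]
          have : (n : ℝ) * η * coeff θ n ≤ n * 1 * coeff θ n := by gcongr
          linarith
        have c2 : (1 + n) * ρ ^ n ≤ lam⁻¹ * S * lam ^ n := by
          have d1 : ρ ^ n ≤ lam ^ n * lam ^ n := by
            rw [← mul_pow, ← sq]
            exact pow_le_pow_left₀ hρ.le hρlam n
          have d2 := hSterm n
          have d3 : (1 + (n : ℝ)) * lam ^ (n + 1) ≤ S := by
            refine le_trans ?_ d2
            refine mul_le_mul_of_nonneg_right ?_ (by positivity)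
            push_cast
            nlinarith
          calc (1 + n) * ρ ^ n ≤ (1 + n) * (lam ^ n * lam ^ n) := by gcongr
            _ = lam⁻¹ * ((1 + n) * lam ^ (n + 1)) * lam ^ n := by
              rw [pow_succ]; field_simp
            _ ≤ _ := by gcongr
        calc |coeff θ n + coeffDeriv θ n h| * y (0 - (i + 1 : ℕ))
            ≤ ((1 + n) * (C * ρ ^ n)) * y (0 - (i + 1 : ℕ)) := by
              refine mul_le_mul_of_nonneg_right (c1.trans ?_) (hy0 _)
              gcongr
          _ = C * ((1 + n) * ρ ^ n) * y (0 - (i + 1 : ℕ)) := by ring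
          _ ≤ C * (lam⁻¹ * S * lam ^ n) * y (0 - (i + 1 : ℕ)) := by
              have := hy0 (0 - (i + 1 : ℕ))
              gcongr
          _ = _ := by
              rw [hn, show i + t + 1 = t + (i + 1) by ring, pow_add]
              ring
    have hT0 : 0 ≤ initialTail lam y := tsum_nonneg fun i => mul_nonneg (by positivity) (hy0 _)
    have hp := hGW0 t
    calc _ ≤ B / coeff θ 0 * (‖h‖ ^ 2 * (G t * W t))
          + a⁻¹ ^ 2 * K1 * S * (‖h‖ ^ 2 * (G t * W t))
          + C * (lam⁻¹ * S) * (lam ^ t * initialTail lam y) :=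
          (abs_sub _ _).trans (add_le_add ((abs_add_le _ _).trans (add_le_add p1 p2)) p3)
      _ = (B / coeff θ 0 + a⁻¹ ^ 2 * K1 * S) * (‖h‖ ^ 2 * (G t * W t))
          + C * (lam⁻¹ * S) * (lam ^ t * initialTail lam y) := by ring
      _ ≤ K * (‖h‖ ^ 2 * (G t * W t)) + K * (lam ^ t * initialTail lam y) := by
          have k1 : B / coeff θ 0 + a⁻¹ ^ 2 * K1 * S ≤ K := by
            rw [hK]
            have : 0 < B' / coeff θ 0 + a⁻¹ * K1 * S + C * (lam⁻¹ * S) := by positivity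
            linarith
          have k2 : C * (lam⁻¹ * S) ≤ K := by
            rw [hK]
            have : 0 < B' / coeff θ 0 + a⁻¹ * K1 * S + (B / coeff θ 0 + a⁻¹ ^ 2 * K1 * S) := by
              positivity
            linarith
          gcongr
      _ = _ := by ring

end Expansion

/-! ### Expansion of powers of the residuals -/

section Residuals

theorem exists_abs_pow_sub_le (k : ℕ) : ∃ D : ℝ, 0 ≤ D ∧ ∀ y : ℝ, 0 ≤ y → y ≤ 2 →
    |y ^ k - 1 - k * (y - 1)| ≤ D * (y - 1) ^ 2 := by
  induction k with
  | zero => exact ⟨0, le_rfl, fun y _ _ => by simp⟩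
  | succ k ih =>
    obtain ⟨D, hD, h⟩ := ih
    refine ⟨2 * D + k, by positivity, fun y hy hy2 => ?_⟩
    have e : y ^ (k + 1) - 1 - ((k + 1 : ℕ) : ℝ) * (y - 1)
        = y * (y ^ k - 1 - k * (y - 1)) + k * (y - 1) ^ 2 := by
      push_cast; ring
    rw [e]
    refine (abs_add_le _ _).trans ?_
    rw [abs_mul, abs_of_nonneg hy, abs_of_nonneg (by positivity : 0 ≤ (k : ℝ) * (y - 1) ^ 2),
      add_mul]
    refine add_le_add ?_ le_rfl
    calc y * |y ^ k - 1 - k * (y - 1)| ≤ 2 * (D * (y - 1) ^ 2) :=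
          mul_le_mul hy2 (h y hy hy2) (abs_nonneg _) (by norm_num)
      _ = 2 * D * (y - 1) ^ 2 := by ring

/-- Second order expansion of `r ↦ (1 + r)^{-k/2}` at zero. -/
theorem exists_abs_inv_sqrt_pow_sub_le (k : ℕ) : ∃ C : ℝ, 0 < C ∧ ∀ r : ℝ, |r| ≤ 1 / 2 →
    |(1 / √(1 + r)) ^ k - 1 + k / 2 * r| ≤ C * r ^ 2 := by
  obtain ⟨D, hD, h⟩ := exists_abs_pow_sub_le k
  refine ⟨4 * (D + 10 * k) + 1, by positivity, fun r hr => ?_⟩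
  obtain ⟨hr1, hr2⟩ := abs_le.1 hr
  have hpos : 0 < 1 + r := by linarith
  have hs : 0 < √(1 + r) := Real.sqrt_pos.2 hpos
  have hss : √(1 + r) ^ 2 = 1 + r := Real.sq_sqrt hpos.le
  set y := 1 / √(1 + r) with hy
  have hy0 : 0 < y := by positivity
  -- Every estimate on y = (1 + r)^(-1/2) is derived algebraically from this identity.
  have hy2 : y ^ 2 * (1 + r) = 1 := by
    rw [hy, div_pow, one_pow, hss, one_div, inv_mul_cancel₀ hpos.ne']
  have hyle : y ≤ 2 := by
    by_contra hcon
    push Not at hcon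
    nlinarith
  have hyge : 1 / 4 ≤ y ^ 2 := by
    by_contra hcon
    push Not at hcon
    nlinarith
  have hsqle : (y - 1) ^ 2 ≤ 4 * r ^ 2 := by
    have e : (1 - y) * (1 + y) = y ^ 2 * r := by linear_combination -hy2
    have e2 : (y - 1) ^ 2 * (1 + y) ^ 2 = y ^ 2 * (y ^ 2 * r ^ 2) := by
      linear_combination (y ^ 2 * r + (1 - y) * (1 + y)) * e
    have h3 : y ^ 2 * r ^ 2 ≤ 4 * r ^ 2 := mul_le_mul_of_nonneg_right (by nlinarith) (sq_nonneg r)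
    have h4 : y ^ 2 ≤ (1 + y) ^ 2 := by nlinarith
    have h5 : (y - 1) ^ 2 * (1 + y) ^ 2 ≤ (4 * r ^ 2) * (1 + y) ^ 2 := by
      rw [e2, mul_comm (4 * r ^ 2)]
      exact mul_le_mul h4 h3 (by positivity) (by positivity)
    exact le_of_mul_le_mul_right h5 (by positivity)
  -- After multiplication by 2y² the left side becomes 2y³ - 3y² + 1, which has a double root at 1.
  have hlin : |y - 1 + r / 2| ≤ 10 * (y - 1) ^ 2 := by
    have e : (y - 1 + r / 2) * (2 * y ^ 2) = (y - 1) ^ 2 * (2 * y + 1) := by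
      linear_combination hy2
    have e2 : y - 1 + r / 2 = (y - 1) ^ 2 * (2 * y + 1) / (2 * y ^ 2) := by
      rw [← e]; field_simp
    rw [e2, abs_of_nonneg (by positivity), div_le_iff₀ (by positivity)]
    nlinarith [mul_nonneg (sq_nonneg (y - 1)) (by linarith : 0 ≤ y ^ 2 - 1 / 4),
      mul_nonneg (sq_nonneg (y - 1)) (by linarith : 0 ≤ 2 - y)]
  have e : y ^ k - 1 + k / 2 * r = (y ^ k - 1 - k * (y - 1)) + k * (y - 1 + r / 2) := by ring
  rw [e]
  refine (abs_add_le _ _).trans ?_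
  rw [abs_mul, Nat.abs_cast]
  have hk : (0 : ℝ) ≤ k := Nat.cast_nonneg k
  calc _ ≤ D * (y - 1) ^ 2 + k * (10 * (y - 1) ^ 2) := by
        gcongr
        exact h y hy0.le hyle
    _ = (D + 10 * k) * (y - 1) ^ 2 := by ring
    _ ≤ (D + 10 * k) * (4 * r ^ 2) := by gcongr
    _ ≤ _ := by nlinarith [sq_nonneg r]

/-- First order expansion of a power of a residual around the innovation. -/
theorem exists_abs_residual_pow_sub_le (k : ℕ) : ∃ C : ℝ, 0 < C ∧ ∀ V W D e sg b d : ℝ, 0 ≤ sg →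
    sg ^ 2 = W → 0 < W → |V - W - D| ≤ b * W → |D| ≤ d * W → b ≤ 1 / 4 → d ≤ 1 / 4 →
    |(sg * e / √V) ^ k - e ^ k + k / 2 * (e ^ k * (D / W))| ≤ C * (|e| ^ k * (d ^ 2 + b)) := by
  obtain ⟨C, hC, h⟩ := exists_abs_inv_sqrt_pow_sub_le k
  refine ⟨2 * C + k, by positivity, fun V W D e sg b d hsg hsgW hW hV hD hb hd => ?_⟩
  have hb0 : 0 ≤ b := by
    by_contra hcon
    push Not at hcon
    have := (abs_nonneg _).trans hV
    nlinarith
  have hd0 : 0 ≤ d := by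
    by_contra hcon
    push Not at hcon
    have := (abs_nonneg _).trans hD
    nlinarith
  -- The residual is e (1 + r)^(-1/2), with r equal to D / W up to b, so |r| ≤ d + b ≤ 1/2.
  set r := V / W - 1 with hr
  have hDW : |D / W| ≤ d := by
    rw [abs_div, abs_of_pos hW, div_le_iff₀ hW]; exact hD
  have hrD : |r - D / W| ≤ b := by
    have : r - D / W = (V - W - D) / W := by rw [hr]; field_simp
    rw [this, abs_div, abs_of_pos hW, div_le_iff₀ hW]; exact hV
  have hrle : |r| ≤ d + b := by
    have : r = D / W + (r - D / W) := by ring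
    rw [this]
    exact (abs_add_le _ _).trans (add_le_add hDW hrD)
  have hr2 : |r| ≤ 1 / 2 := by linarith
  have hpos : 0 < 1 + r := by linarith [(abs_le.1 hr2).1]
  have hVr : V = W * (1 + r) := by rw [hr]; field_simp; ring
  have hres : sg * e / √V = e * (1 / √(1 + r)) := by
    have hsgpos : 0 < sg := lt_of_le_of_ne hsg fun h0 => by
      rw [← h0] at hsgW; simp at hsgW; linarith
    rw [hVr, Real.sqrt_mul hW.le, ← hsgW, Real.sqrt_sq hsg]
    field_simp
  rw [hres, mul_pow]
  have e1 : e ^ k * (1 / √(1 + r)) ^ k - e ^ k + k / 2 * (e ^ k * (D / W))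
      = e ^ k * (((1 / √(1 + r)) ^ k - 1 + k / 2 * r) - k / 2 * (r - D / W)) := by ring
  rw [e1, abs_mul, abs_pow]
  have hk : (0 : ℝ) ≤ k := Nat.cast_nonneg k
  have h1 : |(1 / √(1 + r)) ^ k - 1 + k / 2 * r - k / 2 * (r - D / W)|
      ≤ C * (d + b) ^ 2 + k / 2 * b := by
    refine (abs_sub _ _).trans (add_le_add ((h r hr2).trans ?_) ?_)
    · rw [← sq_abs r]
      gcongr
    · rw [abs_mul, abs_of_nonneg (by positivity : 0 ≤ (k : ℝ) / 2)]
      gcongr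
  calc |e| ^ k * _ ≤ |e| ^ k * (C * (d + b) ^ 2 + k / 2 * b) := by gcongr
    _ ≤ |e| ^ k * ((2 * C + k) * (d ^ 2 + b)) := by
        gcongr
        have h2 : (d + b) ^ 2 ≤ 2 * (d ^ 2 + b) := by nlinarith [sq_nonneg (d - b)]
        have h3 := mul_le_mul_of_nonneg_left h2 hC.le
        nlinarith [mul_nonneg hk (sq_nonneg d), mul_nonneg hk hb0]
    _ = _ := by ring

variable {p q : ℕ} {θ : Param p q}

/-- The path of a `GARCH` process for which the volatility series represents the volatility. -/
structure IsRegularPath (θ : Param p q) (x sg e : ℤ → ℝ) : Prop where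
  tempered : IsTempered fun t => x t ^ 2
  nonneg : ∀ t, 0 ≤ sg t
  eq_mul : ∀ t, x t = sg t * e t
  sq_eq : ∀ t, sg t ^ 2 = fullVar θ (fun t => x t ^ 2) t

/-- Both the first and the second power of the fourth root are dominated by the integrable envelope.
-/
theorem rpow_quarter_bounds {Q : ℝ} (hQ : 1 ≤ Q) :
    1 ≤ Q ^ (1 / 4 : ℝ) ∧ Q ^ (1 / 4 : ℝ) ≤ Q ∧ (Q ^ (1 / 4 : ℝ)) ^ 2 ≤ Q := by
  have h0 : 0 ≤ Q := by linarith
  refine ⟨Real.one_le_rpow hQ (by norm_num), ?_, ?_⟩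
  · calc _ ≤ Q ^ (1 : ℝ) := Real.rpow_le_rpow_of_exponent_le hQ (by norm_num)
      _ = Q := Real.rpow_one Q
  · rw [← Real.rpow_natCast, ← Real.rpow_mul h0]
    calc _ ≤ Q ^ (1 : ℝ) := Real.rpow_le_rpow_of_exponent_le hQ (by norm_num)
      _ = Q := Real.rpow_one Q

set_option maxHeartbeats 1000000 in
/-- Uniform first order expansion of the partial sums of powers of residuals. -/
theorem IsAdmissible.exists_residual_expansion (hθ : IsAdmissible θ) {a : ℝ} (ha : 0 < a)
    (h1 : ∀ i, a ≤ θ.1 i) (h2 : ∀ j, a ≤ θ.2 j) {s : ℝ} (hs : 0 < s) (hs1 : s ≤ 1) (k : ℕ) :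
    ∃ lam K δ : ℝ, 0 < lam ∧ lam < 1 ∧ 0 < K ∧ 0 < δ ∧
      ∀ x sg e : ℤ → ℝ, IsRegularPath θ x sg e →
        (∀ (t : ℤ) (h : Param p q),
          Summable fun i : ℕ => coeffDeriv θ (i + 1) h * x (t - (i + 1 : ℕ)) ^ 2) ∧
        (∀ (t : ℤ) (h : Param p q), |fullDeriv θ h (fun t => x t ^ 2) t
            / fullVar θ (fun t => x t ^ 2) t|
          ≤ K * ‖h‖ * envelope lam s (fun t => x t ^ 2) t) ∧
        ∀ (h : Param p q) (T n : ℕ), ‖h‖ ≤ δ →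
          (∀ i < n, K * (‖h‖ * envelope lam s (fun t => x t ^ 2) (i + 1 : ℕ) ^ (1 / 4 : ℝ)) ≤ 1) →
          K * (lam ^ T * initialTail lam (fun t => x t ^ 2)) ≤ 1 →
          ∀ j ≤ n, |∑ i ∈ Finset.range j, (residual (θ + h) x (i + 1) ^ k
              - e (i + 1 : ℕ) ^ k)
              + k / 2 * ∑ i ∈ Finset.range j, e (i + 1 : ℕ) ^ k
                * (fullDeriv θ h (fun t => x t ^ 2) (i + 1 : ℕ)
                  / fullVar θ (fun t => x t ^ 2) (i + 1 : ℕ))|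
            ≤ K * ((∑ i ∈ Finset.range T, (|x (i + 1 : ℕ)| ^ k
                + |e (i + 1 : ℕ)| ^ k * envelope lam s (fun t => x t ^ 2) (i + 1 : ℕ)))
              + ‖h‖ ^ 2 * (∑ i ∈ Finset.range n,
                |e (i + 1 : ℕ)| ^ k * envelope lam s (fun t => x t ^ 2) (i + 1 : ℕ))
              + initialTail lam (fun t => x t ^ 2)
                * ∑ i ∈ Finset.range n, lam ^ (i + 1) * |e (i + 1 : ℕ)| ^ k) := by
  obtain ⟨lam, K0, δ, hl, hl1, hK0, hδ, hδ1, hexp⟩ := hθ.exists_expansion ha h1 h2 hs hs1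
  obtain ⟨C, hC, hres⟩ := exists_abs_residual_pow_sub_le k
  have hc0 := hθ.coeff_zero_pos
  set c0 := coeff θ 0 with hc0def
  have hk : (0 : ℝ) ≤ k := Nat.cast_nonneg k
  set cs := √(c0 / 2) with hcs
  have hcs0 : 0 < cs := Real.sqrt_pos.2 (by linarith)
  -- The summands 8 K0 and 8 K0 / c0 turn the hypotheses "at most 1" into d ≤ 1/8 and b ≤ 1/4, as
  -- the residual expansion requires.
  set K := (cs⁻¹) ^ k + (1 + k / 2 * K0) + C * (K0 ^ 2 + K0) + C * (K0 / c0) + 8 * K0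
    + 8 * K0 / c0 with hK
  have hKp : 0 < K := by positivity
  have kk1 : 0 < (cs⁻¹) ^ k := by positivity
  have kk2 : 0 < 1 + k / 2 * K0 := by positivity
  have kk3 : 0 < C * (K0 ^ 2 + K0) := by positivity
  have kk4 : 0 < C * (K0 / c0) := by positivity
  have kk5 : 0 < 8 * K0 / c0 := by positivity
  replace kk1 : (cs⁻¹) ^ k ≤ K ∧ 1 + k / 2 * K0 ≤ K ∧ C * (K0 ^ 2 + K0) ≤ K ∧ C * (K0 / c0) ≤ K ∧
      8 * K0 ≤ K ∧ 8 * K0 / c0 ≤ K := by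
    refine ⟨?_, ?_, ?_, ?_, ?_, ?_⟩ <;> linarith
  obtain ⟨kk1, kk2, kk3, kk4, kk5, kk6⟩ := kk1
  refine ⟨lam, K, δ, hl, hl1, hKp, hδ, fun x sg e hpath => ?_⟩
  obtain ⟨hsum, hder, hmain⟩ := hexp x hpath.tempered
  set y : ℤ → ℝ := fun t => x t ^ 2 with hy
  have hy0 : ∀ t, 0 ≤ y t := fun t => sq_nonneg _
  set Q : ℤ → ℝ := envelope lam s y with hQ
  have hQ1 : ∀ t, 1 ≤ Q t := fun t => one_le_envelope hy0 hl t
  set W : ℤ → ℝ := fullVar θ y with hW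
  have hWc : ∀ t, c0 ≤ W t := fun t => hθ.coeff_zero_le_fullVar hy0 t
  have hW0 : ∀ t, 0 < W t := fun t => hc0.trans_le (hWc t)
  set Q0 := initialTail lam y with hQ0
  have hQ00 : 0 ≤ Q0 := tsum_nonneg fun i => mul_nonneg (by positivity) (hy0 _)
  have hderW : ∀ (t : ℤ) (h : Param p q),
      |fullDeriv θ h y t / W t| ≤ K0 * (‖h‖ * Q t ^ (1 / 4 : ℝ)) := fun t h => by
    rw [abs_div, abs_of_pos (hW0 t), div_le_iff₀ (hW0 t)]
    calc _ ≤ K0 * (‖h‖ * (Q t ^ (1 / 4 : ℝ) * W t)) := hder t h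
      _ = _ := by ring
  refine ⟨hsum, fun t h => ?_, fun h T n hh hmax htail j hj => ?_⟩
  · refine (hderW t h).trans ?_
    rw [mul_assoc]
    have := (rpow_quarter_bounds (hQ1 t)).2.1
    have hK0K : K0 ≤ K := by linarith
    have h0 := (rpow_quarter_bounds (hQ1 t)).1
    have h3 : 0 ≤ ‖h‖ * Q t ^ (1 / 4 : ℝ) := by positivity
    gcongr
  · set term : ℕ → ℝ := fun i => residual (θ + h) x (i + 1) ^ k - e (i + 1 : ℕ) ^ k
      + k / 2 * (e (i + 1 : ℕ) ^ k * (fullDeriv θ h y (i + 1 : ℕ) / W (i + 1 : ℕ))) with hterm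
    set E : ℕ → ℝ := fun i => |e (i + 1 : ℕ)| ^ k with hE
    have hE0 : ∀ i, 0 ≤ E i := fun i => by positivity
    have hh1 : ‖h‖ ≤ 1 := hh.trans hδ1
    -- From time T on the truncation error is small against c₀ ≤ W, so the second order expansion
    -- applies.
    have hbig : ∀ i, T ≤ i → i < n →
        |term i| ≤ K * (‖h‖ ^ 2 * (E i * Q (i + 1 : ℕ)) + Q0 * (lam ^ (i + 1) * E i)) := by
      intro i hTi hin
      obtain ⟨-, hV⟩ := hmain h hh (i + 1)
      obtain ⟨q1, q2, q3⟩ := rpow_quarter_bounds (hQ1 (i + 1 : ℕ))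
      set G := Q (i + 1 : ℕ) ^ (1 / 4 : ℝ) with hG
      have hWi := hW0 (i + 1 : ℕ)
      set b := K0 * (‖h‖ ^ 2 * G + lam ^ (i + 1) * Q0 / c0) with hb
      set d := K0 * (‖h‖ * G) with hd
      have hVb : |condVarEst (θ + h) x (i + 1) - W (i + 1 : ℕ) - fullDeriv θ h y (i + 1 : ℕ)|
          ≤ b * W (i + 1 : ℕ) := by
        refine hV.trans ?_
        have : lam ^ (i + 1) * Q0 ≤ lam ^ (i + 1) * Q0 / c0 * W (i + 1 : ℕ) := by
          rw [div_mul_eq_mul_div, le_div_iff₀ hc0]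
          exact mul_le_mul_of_nonneg_left (hWc _) (by positivity)
        calc _ ≤ K0 * (‖h‖ ^ 2 * (G * W (i + 1 : ℕ))
              + lam ^ (i + 1) * Q0 / c0 * W (i + 1 : ℕ)) := by gcongr
          _ = _ := by rw [hb]; ring
      have hDd : |fullDeriv θ h y (i + 1 : ℕ)| ≤ d * W (i + 1 : ℕ) := by
        refine (hder _ h).trans (le_of_eq ?_)
        rw [hd]; ring
      have hm := hmax i hin
      have hd8 : d ≤ 1 / 8 := by
        have : 8 * K0 * (‖h‖ * G) ≤ K * (‖h‖ * G) := by gcongr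
        rw [hd]; linarith
      have hG0 : 0 ≤ G := by linarith
      have hb4 : b ≤ 1 / 4 := by
        have b1 : K0 * (‖h‖ ^ 2 * G) ≤ 1 / 8 := by
          refine le_trans ?_ hd8
          rw [hd]
          have : ‖h‖ ^ 2 ≤ ‖h‖ := by nlinarith [norm_nonneg h]
          gcongr
        have b2 : K0 * (lam ^ (i + 1) * Q0 / c0) ≤ 1 / 8 := by
          have c1 : lam ^ (i + 1) ≤ lam ^ T := pow_le_pow_of_le_one hl.le hl1.le (by omega)
          have c2 : 8 * K0 / c0 * (lam ^ (i + 1) * Q0) ≤ K * (lam ^ T * Q0) := by gcongr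
          have c3 : 8 * K0 / c0 * (lam ^ (i + 1) * Q0)
              = 8 * (K0 * (lam ^ (i + 1) * Q0 / c0)) := by ring
          linarith
        rw [hb, mul_add]
        linarith
      have hr := hres (condVarEst (θ + h) x (i + 1)) (W (i + 1 : ℕ))
        (fullDeriv θ h y (i + 1 : ℕ)) (e (i + 1 : ℕ)) (sg (i + 1 : ℕ)) b d
        (hpath.nonneg _) (hpath.sq_eq _) hWi hVb hDd hb4 (by linarith)
      rw [← hpath.eq_mul] at hr
      refine (le_trans (le_of_eq ?_) hr).trans ?_
      · rfl
      · have g1 : d ^ 2 + b ≤ (K0 ^ 2 + K0) * (‖h‖ ^ 2 * Q (i + 1 : ℕ))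
            + K0 / c0 * (Q0 * lam ^ (i + 1)) := by
          have t1 : d ^ 2 ≤ K0 ^ 2 * (‖h‖ ^ 2 * Q (i + 1 : ℕ)) := by
            rw [hd, mul_pow, mul_pow]
            gcongr
          have t2 : b ≤ K0 * (‖h‖ ^ 2 * Q (i + 1 : ℕ)) + K0 / c0 * (Q0 * lam ^ (i + 1)) := by
            have : K0 * (‖h‖ ^ 2 * G) ≤ K0 * (‖h‖ ^ 2 * Q (i + 1 : ℕ)) := by gcongr
            have e3 : b = K0 * (‖h‖ ^ 2 * G) + K0 / c0 * (Q0 * lam ^ (i + 1)) := by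
              rw [hb]; ring
            linarith
          linarith
        have hq0 : 0 ≤ Q (i + 1 : ℕ) := by linarith [hQ1 (i + 1 : ℕ)]
        have hEi := hE0 i
        calc C * (E i * (d ^ 2 + b))
            ≤ C * (E i * ((K0 ^ 2 + K0) * (‖h‖ ^ 2 * Q (i + 1 : ℕ))
              + K0 / c0 * (Q0 * lam ^ (i + 1)))) := by gcongr
          _ = C * (K0 ^ 2 + K0) * (‖h‖ ^ 2 * (E i * Q (i + 1 : ℕ)))
              + C * (K0 / c0) * (Q0 * (lam ^ (i + 1) * E i)) := by ring
          _ ≤ K * (‖h‖ ^ 2 * (E i * Q (i + 1 : ℕ))) + K * (Q0 * (lam ^ (i + 1) * E i)) := by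
              gcongr
          _ = _ := by ring
    -- For the first T terms only the lower bound c₀ / 2 on the estimated variance is used; their
    -- number does not grow with n.
    have hsmall : ∀ i, |term i| ≤ K * (|x (i + 1 : ℕ)| ^ k + E i * Q (i + 1 : ℕ)) := by
      intro i
      obtain ⟨hlow, -⟩ := hmain h hh (i + 1)
      have hsqrt : cs ≤ √(condVarEst (θ + h) x (i + 1)) := Real.sqrt_le_sqrt hlow
      obtain ⟨q1, q2, q3⟩ := rpow_quarter_bounds (hQ1 (i + 1 : ℕ))
      have r1 : |residual (θ + h) x (i + 1) ^ k| ≤ (cs⁻¹) ^ k * |x (i + 1 : ℕ)| ^ k := by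
        rw [residual, abs_pow, abs_div, abs_of_pos (hcs0.trans_le hsqrt), ← mul_pow,
          div_eq_inv_mul]
        gcongr
      have r2 : |e (i + 1 : ℕ) ^ k * (fullDeriv θ h y (i + 1 : ℕ) / W (i + 1 : ℕ))|
          ≤ E i * (K0 * Q (i + 1 : ℕ)) := by
        rw [abs_mul, abs_pow]
        have := hderW (i + 1 : ℕ) h
        have h5 : K0 * (‖h‖ * Q (i + 1 : ℕ) ^ (1 / 4 : ℝ)) ≤ K0 * (1 * Q (i + 1 : ℕ)) := by
          gcongr
        rw [one_mul] at h5
        exact mul_le_mul_of_nonneg_left (this.trans h5) (hE0 i)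
      have hEi := hE0 i
      have r3 : E i ≤ E i * Q (i + 1 : ℕ) := le_mul_of_one_le_right hEi (hQ1 _)
      have hq0 : 0 ≤ Q (i + 1 : ℕ) := by linarith [hQ1 (i + 1 : ℕ)]
      calc |term i| ≤ |residual (θ + h) x (i + 1) ^ k| + |e (i + 1 : ℕ) ^ k|
            + |k / 2 * (e (i + 1 : ℕ) ^ k * (fullDeriv θ h y (i + 1 : ℕ) / W (i + 1 : ℕ)))| :=
            (abs_add_le _ _).trans (add_le_add_left (abs_sub _ _) _)
        _ ≤ (cs⁻¹) ^ k * |x (i + 1 : ℕ)| ^ k + E i * Q (i + 1 : ℕ)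
            + k / 2 * (E i * (K0 * Q (i + 1 : ℕ))) := by
            rw [abs_mul, abs_of_nonneg (by positivity : 0 ≤ (k : ℝ) / 2), abs_pow (e _)]
            gcongr
        _ = (cs⁻¹) ^ k * |x (i + 1 : ℕ)| ^ k + (1 + k / 2 * K0) * (E i * Q (i + 1 : ℕ)) := by
            ring
        _ ≤ K * |x (i + 1 : ℕ)| ^ k + K * (E i * Q (i + 1 : ℕ)) := by gcongr
        _ = _ := by ring
    set A : ℕ → ℝ := fun i => |x (i + 1 : ℕ)| ^ k + E i * Q (i + 1 : ℕ) with hA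
    have hA0 : ∀ i, 0 ≤ A i := fun i => by
      have hq0 : 0 ≤ Q (i + 1 : ℕ) := by linarith [hQ1 (i + 1 : ℕ)]
      have := hE0 i
      positivity
    set Bt : ℕ → ℝ := fun i => ‖h‖ ^ 2 * (E i * Q (i + 1 : ℕ)) + Q0 * (lam ^ (i + 1) * E i)
      with hBt
    have hB0 : ∀ i, 0 ≤ Bt i := fun i => by
      have hq0 : 0 ≤ Q (i + 1 : ℕ) := by linarith [hQ1 (i + 1 : ℕ)]
      have := hE0 i
      positivity
    have hall : ∀ i < n, |term i| ≤ K * ((if i < T then A i else 0) + Bt i) := by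
      intro i hin
      split_ifs with hiT
      · exact (hsmall i).trans (mul_le_mul_of_nonneg_left (le_add_of_nonneg_right (hB0 i)) hKp.le)
      · rw [zero_add]
        exact hbig i (not_lt.1 hiT) hin
    have hfin : |∑ i ∈ Finset.range j, term i| ≤ K * (∑ i ∈ Finset.range T, A i
        + ∑ i ∈ Finset.range n, Bt i) := by
      refine (Finset.abs_sum_le_sum_abs _ _).trans ?_
      calc ∑ i ∈ Finset.range j, |term i| ≤ ∑ i ∈ Finset.range n, |term i| :=
            Finset.sum_le_sum_of_subset_of_nonneg (Finset.range_mono hj)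
              fun _ _ _ => abs_nonneg _
        _ ≤ ∑ i ∈ Finset.range n, K * ((if i < T then A i else 0) + Bt i) :=
            Finset.sum_le_sum fun i hi => hall i (Finset.mem_range.1 hi)
        _ = K * (∑ i ∈ Finset.range n, (if i < T then A i else 0)
            + ∑ i ∈ Finset.range n, Bt i) := by
            rw [← Finset.mul_sum, Finset.sum_add_distrib]
        _ ≤ _ := by
            gcongr
            rw [← Finset.sum_filter]
            exact Finset.sum_le_sum_of_subset_of_nonneg
              (fun i hi => Finset.mem_range.2 (Finset.mem_filter.1 hi).2) fun i _ _ => hA0 i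
    refine (le_of_eq ?_).trans (hfin.trans (le_of_eq ?_))
    · simp only [hterm, Finset.sum_add_distrib, Finset.mul_sum]
    · simp only [hBt, Finset.sum_add_distrib, Finset.mul_sum, hA, hE, add_assoc]

end Residuals

/-! ### Almost every path is represented by the volatility series -/

section RegularPaths

variable {Ω : Type*} [MeasurableSpace Ω] {μ : Measure Ω} {ε X σ : ℤ → Ω → ℝ} {p q : ℕ}
  {θ : Param p q}

theorem IsStationaryGARCH.ae_isTempered_state (hε : IsInnovation μ ε)
    [IsProbabilityMeasure μ] (hX : IsStationaryGARCH μ θ ε X σ) (hγ : lyapunovExponent μ θ ε < 0) :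
    ∀ᵐ ω ∂μ, ∀ a, IsTempered fun t => state p q X σ t ω a := by
  obtain ⟨s, hs, hs1, K, hK, hm⟩ := hX.exists_moment_state hε hγ
  refine ae_all_iff.2 fun a => ae_isTempered_of_moment
    (fun t => (measurable_pi_apply a |>.comp (hX.measurable_state t)).aemeasurable) (fun t ω => ?_)
    hs hs1 hK fun t => hm t a
  rcases a with i | j <;> exact sq_nonneg _

/-- Almost every path of a stationary solution is represented by the volatility series. -/
theorem IsStationaryGARCH.ae_isRegularPath (hθ : IsAdmissible θ) (hp : 1 ≤ p)
    (hε : IsInnovation μ ε) [IsProbabilityMeasure μ] (hX : IsStationaryGARCH μ θ ε X σ)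
    (hγ : lyapunovExponent μ θ ε < 0) :
    ∀ᵐ ω ∂μ, IsRegularPath θ (fun t => X t ω) (fun t => σ t ω) fun t => ε t ω := by
  filter_upwards [hX.ae_isTempered_state hε hγ, ae_all_iff.2 hX.eq_X, ae_all_iff.2 hX.eq_σ,
    ae_all_iff.2 hX.σ_nonneg] with ω htemp hmul hsq hnn
  have hx : IsTempered fun t => X t ω ^ 2 := by
    have := htemp (Sum.inl ⟨0, hp⟩)
    simpa [state] using this
  -- The state has no volatility coordinate when q = 0, so σ² is expressed through the recursion by
  -- the state one step earlier.
  have hv : IsTempered fun t => σ t ω ^ 2 := by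
    intro t r hr hr1
    have e : ∀ l : ℕ, r ^ l * σ (t - l) ω ^ 2 = θ.1 0 * r ^ l
        + ∑ i : Fin p, θ.1 i.succ * (r ^ l * state p q X σ (t - 1 - l) ω (Sum.inl i))
        + ∑ j : Fin q, θ.2 j * (r ^ l * state p q X σ (t - 1 - l) ω (Sum.inr j)) := by
      intro l
      have hlag : ∀ i : ℕ, t - 1 - (l : ℤ) - i = t - l - ((i : ℤ) + 1) := fun i => by ring
      rw [hsq]
      simp only [state, hlag, mul_add, Finset.mul_sum]
      congr 1
      · congr 1
        · ring
        · exact Finset.sum_congr rfl fun i _ => by ring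
      · exact Finset.sum_congr rfl fun i _ => by ring
    simp only [e]
    exact (((summable_geometric_of_lt_one hr.le hr1).mul_left _).add
      (summable_sum fun i _ => (htemp (Sum.inl i) (t - 1) r hr hr1).mul_left _)).add
      (summable_sum fun j _ => (htemp (Sum.inr j) (t - 1) r hr hr1).mul_left _)
  exact ⟨hx, hnn, hmul, hθ.eq_fullVar (fun t => sq_nonneg _) hx (fun t => sq_nonneg _) hv hsq⟩

theorem IsStationaryGARCH.isCausal_sq (hp : 1 ≤ p) (hε : IsInnovation μ ε)
    [IsProbabilityMeasure μ] (hX : IsStationaryGARCH μ θ ε X σ)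
    (hγ : lyapunovExponent μ θ ε < 0) : IsCausal μ ε fun t ω => X t ω ^ 2 := by
  simpa [state] using hX.isCausal_state hε hγ (Sum.inl ⟨0, hp⟩)

end RegularPaths

/-! ### Functions of the strict past -/

section Predictable

variable {Ω : Type*} [MeasurableSpace Ω] {μ : Measure Ω} {ε : ℤ → Ω → ℝ}

/-- The process `Y` is a fixed measurable function of `(ε_{t-1}, ε_{t-2}, …)`, for every `t`. -/
def IsPredictable (μ : Measure Ω) (ε : ℤ → Ω → ℝ) (Y : ℤ → Ω → ℝ) : Prop :=
  IsCausal μ ε fun t => Y (t + 1)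

variable {Y : ℤ → Ω → ℝ}

theorem IsPredictable.isCausal (hY : IsPredictable μ ε Y) : IsCausal μ ε Y := by
  have := IsCausal.lag hY 1
  simpa using this

theorem IsPredictable.indepFun [IsProbabilityMeasure μ] (hε : IsInnovation μ ε)
    (hY : IsPredictable μ ε Y) (t : ℤ) : IndepFun (ε t) (Y t) μ := by
  have := IsCausal.indepFun_innovation hε hY t
  simpa using this

/-- The series starts at lag one, so shifting time by one makes its partial sums causal, and
causality survives the almost sure limit. -/
theorem IsCausal.isPredictable_tsum [IsProbabilityMeasure μ] (hε : IsInnovation μ ε)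
    (hY : IsCausal μ ε Y) {w : ℕ → ℝ → ℝ} (hw : ∀ i, Measurable (w i))
    (hsum : ∀ᵐ ω ∂μ, ∀ t : ℤ, Summable fun i : ℕ => w i (Y (t - (i + 1 : ℕ)) ω)) :
    IsPredictable μ ε fun t ω => ∑' i : ℕ, w i (Y (t - (i + 1 : ℕ)) ω) := by
  refine isCausal_of_tendsto_ae hε
    (Yn := fun n t ω => ∑ i ∈ Finset.range n, w i (Y (t + 1 - (i + 1 : ℕ)) ω)) (fun n => ?_)
    fun t => hsum.mono fun ω hω => (hω (t + 1)).hasSum.tendsto_sum_nat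
  refine isCausal_sum _ fun i => ?_
  have h := (hY.lag i).comp (hw i)
  have e : ∀ t : ℤ, t + 1 - (i + 1 : ℕ) = t - i := fun t => by push_cast; ring
  simpa only [e] using h

end Predictable

/-! ### Integrability of the envelope and of its product with innovations -/

section Moments

variable {Ω : Type*} [MeasurableSpace Ω] {μ : Measure Ω} [IsProbabilityMeasure μ]
  {ε : ℤ → Ω → ℝ} {Y : ℤ → Ω → ℝ}

theorem isPredictable_envelope (hε : IsInnovation μ ε) (hY : IsCausal μ ε Y)
    (hY0 : ∀ t ω, 0 ≤ Y t ω) (hYt : ∀ᵐ ω ∂μ, IsTempered fun t => Y t ω) {lam s : ℝ}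
    (hl : 0 < lam) (hl1 : lam < 1) (hs : 0 ≤ s) (hs1 : s ≤ 1) :
    IsPredictable μ ε fun t ω => envelope lam s (fun t => Y t ω) t := by
  refine IsCausal.add (isCausal_const 1) (hY.isPredictable_tsum hε
    (w := fun i y => (lam ^ 8) ^ (i + 1) * y ^ s) (fun i => by fun_prop) ?_)
  exact hYt.mono fun ω hω t => hω.summable_envelope (fun t => hY0 t ω) hl hl1 hs hs1 t

/-- The envelope contains only s-th powers, whose means are uniformly bounded, with geometric
weights. -/
theorem integrable_envelope (hε : IsInnovation μ ε) (hY : IsCausal μ ε Y)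
    (hY0 : ∀ t ω, 0 ≤ Y t ω) (hYt : ∀ᵐ ω ∂μ, IsTempered fun t => Y t ω) {lam s : ℝ}
    (hl : 0 < lam) (hl1 : lam < 1) (hs : 0 < s) (hs1 : s ≤ 1) {K : ℝ≥0∞} (hK : K < ∞)
    (hm : ∀ t, ∫⁻ ω, ‖Y t ω‖ₑ ^ s ∂μ ≤ K) (t : ℤ) :
    Integrable (fun ω => envelope lam s (fun t => Y t ω) t) μ := by
  have hmeas : AEStronglyMeasurable (fun ω => ∑' i : ℕ, (lam ^ 8) ^ (i + 1)
      * Y (t - (i + 1 : ℕ)) ω ^ s) μ :=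
    ((hY.isPredictable_tsum hε (w := fun i y => (lam ^ 8) ^ (i + 1) * y ^ s)
      (fun i => by fun_prop) (hYt.mono fun ω hω t => hω.summable_envelope (fun t => hY0 t ω)
        hl hl1 hs.le hs1 t)).isCausal.aemeasurable hε t).aestronglyMeasurable
  refine (integrable_const (1 : ℝ)).add ⟨hmeas, ?_⟩
  have hr1 : ‖lam ^ 8‖ₑ < 1 := by
    rw [← ofReal_norm, Real.norm_of_nonneg (by positivity), ENNReal.ofReal_lt_one]
    exact pow_lt_one₀ hl.le hl1 (by norm_num)
  have hterm : ∀ (i : ℕ) ω, ‖(lam ^ 8) ^ (i + 1) * Y (t - (i + 1 : ℕ)) ω ^ s‖ₑ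
      = ‖lam ^ 8‖ₑ ^ (i + 1) * ‖Y (t - (i + 1 : ℕ)) ω‖ₑ ^ s := fun i ω => by
    rw [enorm_mul, enorm_pow, Real.enorm_rpow_of_nonneg (hY0 _ _) hs.le]
  calc ∫⁻ ω, ‖∑' i : ℕ, (lam ^ 8) ^ (i + 1) * Y (t - (i + 1 : ℕ)) ω ^ s‖ₑ ∂μ
      ≤ ∫⁻ ω, ∑' i : ℕ, ‖lam ^ 8‖ₑ ^ (i + 1) * ‖Y (t - (i + 1 : ℕ)) ω‖ₑ ^ s ∂μ := by
        refine lintegral_mono fun ω => ?_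
        simp only [← hterm]
        exact enorm_tsum_le_tsum_enorm
    _ = ∑' i : ℕ, ‖lam ^ 8‖ₑ ^ (i + 1) * ∫⁻ ω, ‖Y (t - (i + 1 : ℕ)) ω‖ₑ ^ s ∂μ := by
        rw [lintegral_tsum fun i =>
          (((hY.aemeasurable hε _).enorm.pow_const s).const_mul _)]
        refine tsum_congr fun i => ?_
        rw [lintegral_const_mul' _ _ (by finiteness)]
    _ ≤ ∑' i : ℕ, ‖lam ^ 8‖ₑ ^ (i + 1) * K := by
        gcongr with i
        exact hm _
    _ < ∞ := by
        rw [ENNReal.tsum_mul_right]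
        refine ENNReal.mul_lt_top ?_ hK
        simp only [pow_succ, ENNReal.tsum_mul_right, ENNReal.tsum_geometric]
        refine ENNReal.mul_lt_top ?_ (hr1.trans ENNReal.one_lt_top)
        rw [ENNReal.inv_lt_top]
        exact tsub_pos_of_lt hr1

/-- Independence of ε_t and the strict past makes first moments of the two factors enough. -/
theorem IsPredictable.integrable_abs_pow_mul (hε : IsInnovation μ ε) (hY : IsPredictable μ ε Y)
    {t : ℤ} (hint : Integrable (Y t) μ) {k : ℕ} (hmom : Integrable (fun ω => |ε 0 ω| ^ k) μ) :
    Integrable (fun ω => |ε t ω| ^ k * Y t ω) μ := by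
  have hg : Measurable fun y : ℝ => |y| ^ k := by fun_prop
  have h := (hY.indepFun hε t).comp hg measurable_id
  exact h.integrable_mul (((hε.identDistrib t).comp hg).integrable_iff.2 hmom) hint

end Moments

/-! ### Linearity in the direction -/

section Linear

variable {p q : ℕ} {θ : Param p q}

theorem fullDeriv_sum_smul {ι : Type*} [Fintype ι] (c : ι → ℝ) (v : ι → Param p q) {y : ℤ → ℝ}
    {t : ℤ} (hsum : ∀ h : Param p q,
      Summable fun i : ℕ => coeffDeriv θ (i + 1) h * y (t - (i + 1 : ℕ))) :
    fullDeriv θ (∑ a, c a • v a) y t = ∑ a, c a * fullDeriv θ (v a) y t := by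
  simp only [fullDeriv, map_sum, map_smul, smul_eq_mul, mul_add, Finset.sum_add_distrib,
    Finset.sum_mul, ← tsum_mul_left]
  rw [Summable.tsum_finsetSum fun a _ => ?_]
  · simp only [mul_assoc]
  · simpa only [mul_assoc] using (hsum (v a)).mul_left (c a)

/-- The standard basis of the parameter space. -/
noncomputable def paramBasis (p q : ℕ) : Module.Basis (Fin (p + 1) ⊕ Fin q) ℝ (Param p q) :=
  (Pi.basisFun ℝ (Fin (p + 1))).prod (Pi.basisFun ℝ (Fin q))

theorem abs_paramBasis_repr_le (h : Param p q) (a : Fin (p + 1) ⊕ Fin q) :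
    |(paramBasis p q).repr h a| ≤ ‖h‖ := by
  rcases a with i | j
  · simpa [paramBasis] using (norm_le_pi_norm h.1 i).trans (norm_fst_le h)
  · simpa [paramBasis] using (norm_le_pi_norm h.2 j).trans (norm_snd_le h)

/-- Separates the random direction θ̂_n - θ from finitely many fixed processes, to each of which the
law of large numbers applies. -/
theorem fullDeriv_eq_sum_basis (h : Param p q) {y : ℤ → ℝ} {t : ℤ} (hsum : ∀ h : Param p q,
      Summable fun i : ℕ => coeffDeriv θ (i + 1) h * y (t - (i + 1 : ℕ))) :
    fullDeriv θ h y t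
      = ∑ a, (paramBasis p q).repr h a * fullDeriv θ (paramBasis p q a) y t := by
  rw [← fullDeriv_sum_smul _ _ hsum, (paramBasis p q).sum_repr]

end Linear

/-! ### Events of high probability -/

section Likely

variable {Ω : Type*} [MeasurableSpace Ω] {μ : Measure Ω}

/-- The exceptional probability of `G n` is eventually at most `η`. -/
def EventuallyLikely (μ : Measure Ω) (η : ℝ) (G : ℕ → Ω → Prop) : Prop :=
  ∀ᶠ n in atTop, μ.real {ω | ¬ G n ω} ≤ η

variable [IsFiniteMeasure μ] {G G' : ℕ → Ω → Prop} {η η' : ℝ}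

theorem EventuallyLikely.and (h : EventuallyLikely μ η G) (h' : EventuallyLikely μ η' G') :
    EventuallyLikely μ (η + η') fun n ω => G n ω ∧ G' n ω := by
  filter_upwards [h, h'] with n hn hn'
  refine (measureReal_mono (s₂ := {ω | ¬ G n ω} ∪ {ω | ¬ G' n ω}) (fun ω hω => ?_)
    (measure_ne_top _ _)).trans ((measureReal_union_le _ _).trans (add_le_add hn hn'))
  exact not_and_or.1 hω

theorem EventuallyLikely.forall {ι : Type*} [Fintype ι] {G : ι → ℕ → Ω → Prop} (hη : 0 < η)
    (h : ∀ a, ∀ η : ℝ, 0 < η → EventuallyLikely μ η (G a)) :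
    EventuallyLikely μ η fun n ω => ∀ a, G a n ω := by
  have h' := fun a => h a (η / (Fintype.card ι + 1)) (by positivity)
  filter_upwards [eventually_all.2 h'] with n hn
  calc μ.real {ω | ¬ ∀ a, G a n ω} ≤ μ.real (⋃ a ∈ Finset.univ, {ω | ¬ G a n ω}) := by
        refine measureReal_mono (fun ω hω => ?_) (measure_ne_top _ _)
        obtain ⟨a, ha⟩ := not_forall.1 hω
        exact Set.mem_biUnion (Finset.mem_coe.2 (Finset.mem_univ a)) ha
    _ ≤ ∑ a, μ.real {ω | ¬ G a n ω} := measureReal_biUnion_finset_le _ _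
    _ ≤ ∑ _a : ι, η / (Fintype.card ι + 1) := Finset.sum_le_sum fun a _ => hn a
    _ ≤ η := by
        rw [Finset.sum_const, nsmul_eq_mul, Finset.card_univ, mul_div_assoc', div_le_iff₀
          (by positivity)]
        nlinarith

theorem exists_measureReal_not_le_le {f : Ω → ℝ} (hf : AEMeasurable f μ) (hη : 0 < η) :
    ∃ K : ℝ, 0 < K ∧ μ.real {ω | ¬ f ω ≤ K} ≤ η := by
  obtain ⟨K, hK, hle⟩ := exists_measure_ge_le hf.enorm (μ := μ)
    (Eventually.of_forall fun ω => enorm_lt_top) (ENNReal.ofReal_pos.2 hη)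
  refine ⟨K, by exact_mod_cast hK, ENNReal.toReal_le_of_le_ofReal hη.le (le_trans ?_ hle)⟩
  refine measure_mono fun ω hω => ?_
  have hω' : (K : ℝ) < f ω := not_le.1 hω
  change (K : ℝ≥0∞) ≤ ‖f ω‖ₑ
  rw [← ENNReal.ofReal_natCast, ← ofReal_norm]
  exact ENNReal.ofReal_le_ofReal (hω'.le.trans (le_abs_self _))

theorem measureReal_not_le_le {f : Ω → ℝ} (hf0 : 0 ≤ᵐ[μ] f) (hf : Integrable f μ) {C c : ℝ}
    (hC : ∫ ω, f ω ∂μ ≤ C) (hc : 0 < c) : μ.real {ω | ¬ f ω ≤ c} ≤ C / c := by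
  have h : μ.real {ω | ¬ f ω ≤ c} ≤ μ.real {ω | c ≤ f ω} :=
    measureReal_mono (fun ω hω => (not_le.1 hω).le) (measure_ne_top _ _)
  rw [le_div_iff₀' hc]
  exact (mul_le_mul_of_nonneg_left h hc.le).trans
    ((mul_meas_ge_le_integral_of_nonneg hf0 hf c).trans hC)

/-- The maximum of `n` identically bounded integrable variables is eventually below `n²`. -/
theorem eventuallyLikely_forall_le_sq {Q : ℕ → Ω → ℝ} (hQ0 : ∀ i, 0 ≤ᵐ[μ] Q i)
    (hQ : ∀ i, Integrable (Q i) μ) {m : ℝ} (hm : ∀ i, ∫ ω, Q i ω ∂μ ≤ m) (hη : 0 < η) :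
    EventuallyLikely μ η fun n ω => ∀ i < n, Q i ω ≤ (n : ℝ) ^ 2 := by
  have hlim : Tendsto (fun n : ℕ => m / (n : ℝ)) atTop (𝓝 0) :=
    tendsto_const_nhds.div_atTop tendsto_natCast_atTop_atTop
  filter_upwards [hlim.eventually_lt_const hη, eventually_gt_atTop 0] with n hn hn0
  have hn0' : (0 : ℝ) < n := by exact_mod_cast hn0
  -- A union of n events, each of probability at most m / n² by Markov's inequality.
  calc μ.real {ω | ¬ ∀ i < n, Q i ω ≤ (n : ℝ) ^ 2}
      ≤ μ.real (⋃ i ∈ Finset.range n, {ω | ¬ Q i ω ≤ (n : ℝ) ^ 2}) := by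
        refine measureReal_mono (fun ω hω => ?_) (measure_ne_top _ _)
        have h : ∃ i, i < n ∧ ¬ Q i ω ≤ (n : ℝ) ^ 2 := by
          by_contra! hcon
          exact hω hcon
        obtain ⟨i, hin, hi⟩ := h
        exact Set.mem_iUnion₂.2 ⟨i, Finset.mem_range.2 hin, hi⟩
    _ ≤ ∑ i ∈ Finset.range n, μ.real {ω | ¬ Q i ω ≤ (n : ℝ) ^ 2} :=
        measureReal_biUnion_finset_le (Finset.range n) fun i => {ω | ¬ Q i ω ≤ (n : ℝ) ^ 2}
    _ ≤ ∑ _i ∈ Finset.range n, m / (n : ℝ) ^ 2 :=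
        Finset.sum_le_sum fun i _ => measureReal_not_le_le (hQ0 i) (hQ i) (hm i) (by positivity)
    _ = m / n := by
        rw [Finset.sum_const, Finset.card_range, nsmul_eq_mul]; field_simp
    _ ≤ η := hn.le

/-- Partial sums of nonnegative variables with bounded means are bounded in probability at
linear rate. -/
theorem exists_eventuallyLikely_sum_le {Q : ℕ → Ω → ℝ} (hQ0 : ∀ i, 0 ≤ᵐ[μ] Q i)
    (hQ : ∀ i, Integrable (Q i) μ) {m : ℝ} (hm0 : 0 ≤ m) (hm : ∀ i, ∫ ω, Q i ω ∂μ ≤ m)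
    (hη : 0 < η) :
    ∃ K : ℝ, 0 < K ∧ EventuallyLikely μ η fun n ω => ∑ i ∈ Finset.range n, Q i ω ≤ n * K := by
  -- Markov's inequality needs m / η; the added 1 keeps the constant positive when m = 0.
  refine ⟨m / η + 1, by positivity, ?_⟩
  filter_upwards [eventually_gt_atTop 0] with n hn0
  have hn0' : (0 : ℝ) < n := by exact_mod_cast hn0
  have h := measureReal_not_le_le (μ := μ) (f := fun ω => ∑ i ∈ Finset.range n, Q i ω)
    (C := n * m) (c := n * (m / η + 1)) ?_ (integrable_finsetSum _ fun i _ => hQ i) ?_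
    (by positivity)
  · refine h.trans ?_
    rw [mul_div_mul_left _ _ hn0'.ne', div_le_iff₀ (by positivity), mul_add,
      mul_div_cancel₀ _ hη.ne']
    linarith
  · filter_upwards [ae_all_iff.2 hQ0] with ω hω
    exact Finset.sum_nonneg fun i _ => hω i
  · rw [integral_finsetSum _ fun i _ => hQ i]
    refine (Finset.sum_le_sum fun i _ => hm i).trans (le_of_eq ?_)
    rw [Finset.sum_const, Finset.card_range, nsmul_eq_mul]

/-- Geometrically discounted sums of nonnegative variables with bounded means are bounded in
probability. -/
theorem exists_eventuallyLikely_discounted_sum_le {Q : ℕ → Ω → ℝ} (hQ0 : ∀ i, 0 ≤ᵐ[μ] Q i)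
    (hQ : ∀ i, Integrable (Q i) μ) {m : ℝ} (hm0 : 0 ≤ m) (hm : ∀ i, ∫ ω, Q i ω ∂μ ≤ m)
    {lam : ℝ} (hl : 0 < lam) (hl1 : lam < 1) (hη : 0 < η) :
    ∃ K : ℝ, 0 < K ∧ EventuallyLikely μ η fun n ω =>
      ∑ i ∈ Finset.range n, lam ^ (i + 1) * Q i ω ≤ K := by
  have h1 : 0 < 1 - lam := by linarith
  refine ⟨(1 - lam)⁻¹ * m / η + 1, by positivity, Eventually.of_forall fun n => ?_⟩
  have h := measureReal_not_le_le (μ := μ)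
    (f := fun ω => ∑ i ∈ Finset.range n, lam ^ (i + 1) * Q i ω)
    (C := (1 - lam)⁻¹ * m) (c := (1 - lam)⁻¹ * m / η + 1) ?_
    (integrable_finsetSum _ fun i _ => (hQ i).const_mul _) ?_ (by positivity)
  · refine h.trans ?_
    rw [div_le_iff₀ (by positivity), mul_add, mul_div_cancel₀ _ hη.ne']
    linarith
  · filter_upwards [ae_all_iff.2 hQ0] with ω hω
    exact Finset.sum_nonneg fun i _ => mul_nonneg (by positivity) (hω i)
  · rw [integral_finsetSum _ fun i _ => (hQ i).const_mul _]
    simp only [integral_const_mul]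
    calc ∑ i ∈ Finset.range n, lam ^ (i + 1) * ∫ ω, Q i ω ∂μ
        ≤ ∑ i ∈ Finset.range n, lam ^ i * m := by
          refine Finset.sum_le_sum fun i _ => mul_le_mul ?_ (hm i) (integral_nonneg_of_ae (hQ0 i))
            (by positivity)
          exact pow_le_pow_of_le_one hl.le hl1.le (Nat.le_succ i)
      _ = (∑ i ∈ Finset.range n, lam ^ i) * m := by rw [Finset.sum_mul]
      _ ≤ (1 - lam)⁻¹ * m := by
          gcongr
          rw [← tsum_geometric_of_lt_one hl.le hl1]
          exact (summable_geometric_of_lt_one hl.le hl1).sum_le_tsum _ fun i _ => by positivity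

end Likely

/-! ### Cancellation of the linear term -/

section Cusum

theorem momentSum_eq (f : ℕ → ℝ) (k n : ℕ) (u : ℝ) :
    momentSum f k n u = ∑ i ∈ Finset.range ⌊(n : ℝ) * u⌋₊, f (i + 1) ^ k :=
  sum_Icc_one_eq_sum_range _ _

/-- The linear term of an expansion of partial sums cancels in the `CUSUM` process when its partial
sums obey a law of large numbers. -/
theorem abs_cusum_sub_le {f g G : ℕ → ℝ} {k n : ℕ} {c m D R u : ℝ} (hc : 0 ≤ c)
    (hR : ∀ j ≤ n, |∑ i ∈ Finset.range j, (f (i + 1) ^ k - g (i + 1) ^ k)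
      + c * ∑ i ∈ Finset.range j, G i| ≤ R)
    (hG : ∀ j ≤ n, |∑ i ∈ Finset.range j, G i - j * m| ≤ D) (hu0 : 0 ≤ u) (hu1 : u ≤ 1) :
    |cusum f k n u - cusum g k n u| ≤ c * (2 * D + |m|) + 2 * R := by
  have hn : (0 : ℝ) ≤ n := Nat.cast_nonneg n
  set J := ⌊(n : ℝ) * u⌋₊ with hJ
  have hJn : J ≤ n := Nat.floor_le_of_le (mul_le_of_le_one_right hn hu1)
  have hJ1 : (J : ℝ) ≤ n * u := Nat.floor_le (by positivity)
  have hJ2 : (n : ℝ) * u < J + 1 := Nat.lt_floor_add_one _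
  set A : ℕ → ℝ := fun j => ∑ i ∈ Finset.range j, (f (i + 1) ^ k - g (i + 1) ^ k) with hA
  set S : ℕ → ℝ := fun j => ∑ i ∈ Finset.range j, G i with hS
  -- Subtracting and adding the linear drift j m leaves only (J - n u) m of it, at most |m| because
  -- J is the integer part of n u.
  have e : cusum f k n u - cusum g k n u = (A J + c * S J) - u * (A n + c * S n)
      - c * ((S J - J * m) - u * (S n - n * m) + (J - n * u) * m) := by
    simp only [cusum, momentSum_eq, mul_one, Nat.floor_natCast, hA, Finset.sum_sub_distrib]
    ring
  have hsc : ∀ z b : ℝ, |z| ≤ b → |u * z| ≤ b := fun z b hz => by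
    rw [abs_mul, abs_of_nonneg hu0]
    exact (mul_le_of_le_one_left (abs_nonneg _) hu1).trans hz
  have h1 : |(S J - J * m) - u * (S n - n * m) + (J - n * u) * m| ≤ 2 * D + |m| := by
    refine (abs_add_le _ _).trans (add_le_add ?_ ?_)
    · rw [two_mul]
      exact (abs_sub _ _).trans (add_le_add (hG J hJn) (hsc _ _ (hG n le_rfl)))
    · rw [abs_mul]
      refine mul_le_of_le_one_left (abs_nonneg _) ?_
      rw [abs_le]
      constructor <;> linarith
  have h2 : |(A J + c * S J) - u * (A n + c * S n)| ≤ 2 * R := by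
    rw [two_mul]
    exact (abs_sub _ _).trans (add_le_add (hR J hJn) (hsc _ _ (hR n le_rfl)))
  rw [e]
  refine (abs_sub _ _).trans ?_
  rw [abs_mul, abs_of_nonneg hc]
  have := mul_le_mul_of_nonneg_left h1 hc
  linarith

end Cusum

theorem isAdmissible_of_mem_paramSpace {p q : ℕ} {ulow uupp ρ₀ : ℝ} (hulow : 0 < ulow)
    (hρ₀ : ρ₀ < 1) {θ : Param p q} (hθ : θ ∈ paramSpace p q ulow uupp ρ₀) : IsAdmissible θ :=
  ⟨fun i => hulow.trans_le (hθ.2.1 i).1, fun j => hulow.trans_le (hθ.2.2 j).1,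
    hθ.1.trans_lt hρ₀⟩

/-- Uniform bound for the difference of two `CUSUM` processes whose partial sums differ, up to `R`,
by a linear combination of sequences obeying a law of large numbers. -/
theorem iSup_cusum_sub_le {ι : Type*} [Fintype ι] {f g : ℕ → ℝ} {k n : ℕ} (hn : 0 < n)
    {Y : ι → ℕ → ℝ} {b m : ι → ℝ} {c r M δ R : ℝ} (hc : 0 ≤ c)
    (hb : ∀ a, |b a| ≤ r) (hr : √(n : ℝ) * r ≤ M) (hM : 0 ≤ M)
    (hR : ∀ j ≤ n, |∑ i ∈ Finset.range j, (f (i + 1) ^ k - g (i + 1) ^ k)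
      + c * ∑ i ∈ Finset.range j, ∑ a, b a * Y a i| ≤ R)
    (hY : ∀ a, ∀ j ≤ n, |∑ i ∈ Finset.range j, Y a i - j * m a| ≤ δ * n) :
    ⨆ u : Set.Icc (0 : ℝ) 1, (1 / √(n : ℝ)) * |cusum f k n u - cusum g k n u|
      ≤ 2 * c * Fintype.card ι * M * δ + (c * (M * ∑ a, |m a|) + 2 * R) / √(n : ℝ) := by
  have hn1 : (1 : ℝ) ≤ n := by exact_mod_cast hn
  have hsq : √(n : ℝ) * √(n : ℝ) = n := Real.mul_self_sqrt (by linarith)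
  have hs1 : 1 ≤ √(n : ℝ) := Real.one_le_sqrt.2 hn1
  have hs0 : 0 < √(n : ℝ) := by linarith
  have hrd : r ≤ M / √(n : ℝ) := by rwa [le_div_iff₀' hs0]
  have hrM : r ≤ M := hrd.trans (div_le_self hM hs1)
  -- Coefficients of size M / √n against errors δ n give a multiple of δ √n, of the order of the
  -- normalisation.
  have hG : ∀ j ≤ n, |∑ i ∈ Finset.range j, ∑ a, b a * Y a i - j * ∑ a, b a * m a|
      ≤ M / √(n : ℝ) * Fintype.card ι * (δ * n) := by
    intro j hj
    have e : ∑ i ∈ Finset.range j, ∑ a, b a * Y a i - j * ∑ a, b a * m a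
        = ∑ a, b a * (∑ i ∈ Finset.range j, Y a i - j * m a) := by
      rw [Finset.sum_comm, Finset.mul_sum, ← Finset.sum_sub_distrib]
      refine Finset.sum_congr rfl fun a _ => ?_
      rw [← Finset.mul_sum]
      ring
    rw [e]
    refine (Finset.abs_sum_le_sum_abs _ _).trans ?_
    calc ∑ a, |b a * (∑ i ∈ Finset.range j, Y a i - j * m a)|
        ≤ ∑ _a : ι, M / √(n : ℝ) * (δ * n) := Finset.sum_le_sum fun a _ => by
          rw [abs_mul]
          exact mul_le_mul ((hb a).trans hrd) (hY a j hj) (abs_nonneg _)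
            (div_nonneg hM hs0.le)
      _ = _ := by rw [Finset.sum_const, Finset.card_univ, nsmul_eq_mul]; ring
  have hm : |∑ a, b a * m a| ≤ M * ∑ a, |m a| := by
    rw [Finset.mul_sum]
    refine (Finset.abs_sum_le_sum_abs _ _).trans (Finset.sum_le_sum fun a _ => ?_)
    rw [abs_mul]
    exact mul_le_mul_of_nonneg_right ((hb a).trans hrM) (abs_nonneg _)
  have : Nonempty (Set.Icc (0 : ℝ) 1) := ⟨⟨0, by simp⟩⟩
  refine ciSup_le fun u => ?_
  have h := abs_cusum_sub_le hc hR hG u.2.1 u.2.2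
  have h2 : c * (2 * (M / √(n : ℝ) * Fintype.card ι * (δ * n)) + |∑ a, b a * m a|) + 2 * R
      ≤ c * (2 * (M / √(n : ℝ) * Fintype.card ι * (δ * n)) + M * ∑ a, |m a|) + 2 * R := by
    gcongr
  calc _ ≤ (1 / √(n : ℝ)) * (c * (2 * (M / √(n : ℝ) * Fintype.card ι * (δ * n))
        + M * ∑ a, |m a|) + 2 * R) := by
        gcongr
        exact h.trans h2
    _ = _ := by
        have e : (M / √(n : ℝ)) * n = M * √(n : ℝ) := by
          rw [div_mul_eq_mul_div, div_eq_iff hs0.ne', mul_assoc, hsq]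
        have e2 : M / √(n : ℝ) * Fintype.card ι * (δ * n)
            = M * √(n : ℝ) * (Fintype.card ι * δ) := by rw [← e]; ring
        rw [e2]
        field_simp
        ring

/-- A maximum of order n² has fourth root of order √n, exactly compensating the rate n^{-1/2} of the
estimator. -/
theorem mul_rpow_quarter_le_one {K M r Q : ℝ} {n : ℕ} (hn : 0 < n) (hK : 0 ≤ K)
    (hQ : 0 ≤ Q) (hr : √(n : ℝ) * r ≤ M) (hle : (K * M) ^ 4 * Q ≤ (n : ℝ) ^ 2) :
    K * (r * Q ^ (1 / 4 : ℝ)) ≤ 1 := by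
  have hs0 : 0 < √(n : ℝ) := Real.sqrt_pos.2 (by exact_mod_cast hn)
  have hq : 0 ≤ Q ^ (1 / 4 : ℝ) := Real.rpow_nonneg hQ _
  have h4 : (Q ^ (1 / 4 : ℝ)) ^ 4 = Q := by
    rw [← Real.rpow_natCast, ← Real.rpow_mul hQ]
    norm_num
  have hn4 : √(n : ℝ) ^ 4 = (n : ℝ) ^ 2 := by
    rw [show 4 = 2 * 2 from rfl, pow_mul, Real.sq_sqrt (Nat.cast_nonneg n)]
  have h : K * M * Q ^ (1 / 4 : ℝ) ≤ √(n : ℝ) := by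
    refine le_of_pow_le_pow_left₀ (n := 4) (by norm_num) hs0.le ?_
    rw [mul_pow, h4, hn4]
    exact hle
  refine le_of_mul_le_mul_left ?_ hs0
  calc √(n : ℝ) * (K * (r * Q ^ (1 / 4 : ℝ))) = K * (√(n : ℝ) * r) * Q ^ (1 / 4 : ℝ) := by ring
    _ ≤ K * M * Q ^ (1 / 4 : ℝ) := by gcongr
    _ ≤ √(n : ℝ) * 1 := by rwa [mul_one]

/-! ### Asymptotic equivalence of the two CUSUM processes -/

section Main

variable {Ω : Type*} [MeasurableSpace Ω] {μ : Measure Ω} [IsProbabilityMeasure μ]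
  {ε X σ : ℤ → Ω → ℝ} {p q : ℕ} {θ : Param p q}

theorem tendstoInMeasure_zero_of_eventuallyLikely {F : ℕ → Ω → ℝ} (hF0 : ∀ n ω, 0 ≤ F n ω)
    (h : ∀ ξ η : ℝ, 0 < ξ → 0 < η → EventuallyLikely μ η fun n ω => F n ω < ξ) :
    TendstoInMeasure μ F atTop fun _ => 0 := by
  rw [tendstoInMeasure_iff_measureReal_norm]
  intro ξ hξ
  refine tendsto_order.2 ⟨fun a ha => Eventually.of_forall fun n =>
    ha.trans_le measureReal_nonneg, fun a ha => ?_⟩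
  filter_upwards [h ξ (a / 2) hξ (by positivity)] with n hn
  refine lt_of_le_of_lt ?_ (by linarith : a / 2 < a)
  refine le_trans (le_of_eq ?_) hn
  congr 1
  ext ω
  change ξ ≤ ‖F n ω - 0‖ ↔ ¬ F n ω < ξ
  rw [sub_zero, Real.norm_of_nonneg (hF0 n ω), not_lt]

theorem IsCausal.isPredictable_fullVar (hε : IsInnovation μ ε) (hθ : IsAdmissible θ)
    {Y : ℤ → Ω → ℝ} (hY : IsCausal μ ε Y) (hY0 : ∀ t ω, 0 ≤ Y t ω)
    (hYt : ∀ᵐ ω ∂μ, IsTempered fun t => Y t ω) :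
    IsPredictable μ ε fun t ω => fullVar θ (fun t => Y t ω) t :=
  IsCausal.add (isCausal_const _) (hY.isPredictable_tsum hε
    (w := fun i y => coeff θ (i + 1) * y) (fun i => by fun_prop)
    (hYt.mono fun ω hω t => hθ.summable_coeff_mul (fun t => hY0 t ω) hω t))

theorem IsCausal.isPredictable_fullDeriv (hε : IsInnovation μ ε) {h : Param p q}
    {Y : ℤ → Ω → ℝ} (hY : IsCausal μ ε Y)
    (hsum : ∀ᵐ ω ∂μ, ∀ t : ℤ,
      Summable fun i : ℕ => coeffDeriv θ (i + 1) h * Y (t - (i + 1 : ℕ)) ω) :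
    IsPredictable μ ε fun t ω => fullDeriv θ h (fun t => Y t ω) t :=
  IsCausal.add (isCausal_const _) (hY.isPredictable_tsum hε
    (w := fun i y => coeffDeriv θ (i + 1) h * y) (fun i => by fun_prop) hsum)

set_option maxHeartbeats 1000000 in
/-- The `CUSUM` processes of powers of residuals and of innovations are asymptotically
equivalent. -/
theorem IsStationaryGARCH.tendstoInMeasure_cusum (hp : 1 ≤ p) (hθ : IsAdmissible θ) {a : ℝ}
    (ha : 0 < a) (h1 : ∀ i, a ≤ θ.1 i) (h2 : ∀ j, a ≤ θ.2 j) (hε : IsInnovation μ ε)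
    (hX : IsStationaryGARCH μ θ ε X σ) (hγ : lyapunovExponent μ θ ε < 0)
    {θhat : ℕ → Ω → Param p q}
    (hθhat : IsBoundedInProb μ fun n ω => √(n : ℝ) * ‖θhat n ω - θ‖)
    (k : ℕ) (hmom : Integrable (fun ω => |ε 0 ω| ^ k) μ) :
    TendstoInMeasure μ (fun (n : ℕ) ω => ⨆ u : Set.Icc (0 : ℝ) 1, (1 / √(n : ℝ)) *
      |cusum (residual (θhat n ω) fun t => X t ω) k n u - cusum (fun t => ε t ω) k n u|)
      atTop (fun _ => 0) := by
  obtain ⟨s, hs, hs1, Ks, hKs, hms⟩ := hX.exists_moment_state hε hγ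
  obtain ⟨lam, K, δ, hl, hl1, hK, hδ, hexp⟩ := hθ.exists_residual_expansion ha h1 h2 hs hs1 k
  have hreg := hX.ae_isRegularPath hθ hp hε hγ
  have hXc := hX.isCausal_sq hp hε hγ
  have hX0 : ∀ t ω, 0 ≤ X t ω ^ 2 := fun t ω => sq_nonneg _
  have hXt : ∀ᵐ ω ∂μ, IsTempered fun t => X t ω ^ 2 := hreg.mono fun ω h => h.tempered
  have hXm : ∀ t, ∫⁻ ω, ‖X t ω ^ 2‖ₑ ^ s ∂μ ≤ Ks := fun t => by
    simpa [state] using hms t (Sum.inl ⟨0, hp⟩)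
  set Q : ℤ → Ω → ℝ := fun t ω => envelope lam s (fun t => X t ω ^ 2) t with hQ
  have hQp : IsPredictable μ ε Q := isPredictable_envelope hε hXc hX0 hXt hl hl1 hs.le hs1
  have hQi : ∀ t, Integrable (Q t) μ :=
    integrable_envelope hε hXc hX0 hXt hl hl1 hs hs1 hKs hXm
  have hQ1 : ∀ t ω, 1 ≤ Q t ω := fun t ω => one_le_envelope (fun t => hX0 t ω) hl t
  set EQ : ℤ → Ω → ℝ := fun t ω => |ε t ω| ^ k * Q t ω with hEQ
  have hpowc : IsCausal μ ε fun t ω => |ε t ω| ^ k :=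
    isCausal_innovation.comp (g := fun y : ℝ => |y| ^ k) (by fun_prop)
  have hEQc : IsCausal μ ε EQ := hpowc.mul hQp.isCausal
  have hEQi : ∀ t, Integrable (EQ t) μ := fun t => hQp.integrable_abs_pow_mul hε (hQi t) hmom
  have hEQ0 : ∀ t ω, 0 ≤ EQ t ω := fun t ω => by
    have := hQ1 t ω
    positivity
  set b := paramBasis p q with hb
  set Y : (Fin (p + 1) ⊕ Fin q) → ℤ → Ω → ℝ := fun a t ω => ε t ω ^ k
    * (fullDeriv θ (b a) (fun t => X t ω ^ 2) t / fullVar θ (fun t => X t ω ^ 2) t) with hY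
  have hYc : ∀ a, IsCausal μ ε (Y a) := fun a =>
    (isCausal_innovation.comp (g := fun y : ℝ => y ^ k) (by fun_prop)).mul
      ((hXc.isPredictable_fullDeriv hε (hreg.mono fun ω hω t =>
        (hexp (fun t => X t ω) (fun t => σ t ω) (fun t => ε t ω) hω).1 t (b a))).isCausal.div
        (hXc.isPredictable_fullVar hε hθ hX0 hXt).isCausal)
  have hYi : ∀ a, Integrable (Y a 0) μ := fun a => by
    refine ((hEQi 0).const_mul (K * ‖b a‖)).mono'
      ((hYc a).aemeasurable hε 0).aestronglyMeasurable ?_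
    filter_upwards [hreg] with ω hω
    rw [Real.norm_eq_abs, hY, abs_mul, abs_pow]
    calc _ ≤ |ε 0 ω| ^ k * (K * ‖b a‖ * Q 0 ω) :=
          mul_le_mul_of_nonneg_left ((hexp (fun t => X t ω) (fun t => σ t ω) (fun t => ε t ω)
            hω).2.1 0 (b a)) (by positivity)
      _ = _ := by rw [hEQ]; ring
  refine tendstoInMeasure_zero_of_eventuallyLikely
    (fun n ω => Real.iSup_nonneg fun u => by positivity) fun ξ η' hξ hη' => ?_
  -- Seven exceptional events share the allowed probability.
  obtain ⟨η, hη, hηη⟩ : ∃ η : ℝ, 0 < η ∧ η + (η + (η + (η + (η + (η + η))))) = η' :=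
    ⟨η' / 7, by positivity, by ring⟩
  obtain ⟨M', hM'⟩ := hθhat η hη
  set M := max M' 1 with hM
  have hM1 : 1 ≤ M := le_max_right _ _
  have ev1 : EventuallyLikely μ η fun n ω => √(n : ℝ) * ‖θhat n ω - θ‖ ≤ M := by
    refine hM'.mono fun n hn => (measureReal_mono (fun ω hω => ?_) (measure_ne_top _ _)).trans hn
    change M' < |_|
    rw [abs_of_nonneg (by positivity)]
    exact (le_max_left _ _).trans_lt (not_le.1 hω)
  have hT0m : AEMeasurable (fun ω => initialTail lam fun t => X t ω ^ 2) μ :=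
    (hXc.isPredictable_tsum hε (w := fun i y => lam ^ (i + 1) * y) (fun i => by fun_prop)
      (hXt.mono fun ω hω t => hω.summable_lag t hl hl1)).isCausal.aemeasurable hε 0
  obtain ⟨K0, hK0, hK0η⟩ := exists_measureReal_not_le_le hT0m hη
  have ev2 : EventuallyLikely μ η fun _ ω => (initialTail lam fun t => X t ω ^ 2) ≤ K0 :=
    Eventually.of_forall fun _ => hK0η
  -- T depends on the tail bound K0 but not on n, so the first T terms form one fixed finite random
  -- variable.
  obtain ⟨T, hT⟩ := exists_pow_lt_of_lt_one (show 0 < (K * K0)⁻¹ by positivity) hl1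
  have hT' : K * (lam ^ T * K0) ≤ 1 := by
    have := mul_le_mul_of_nonneg_right hT.le (by positivity : 0 ≤ K * K0)
    rw [inv_mul_cancel₀ (by positivity)] at this
    linarith
  have hZm : AEMeasurable (fun ω => ∑ i ∈ Finset.range T,
      (|X (i + 1 : ℕ) ω| ^ k + EQ (i + 1 : ℕ) ω)) μ := by
    refine Finset.aemeasurable_fun_sum _ fun i _ => ?_
    exact (((hX.measurable_X _).abs.pow_const k).aemeasurable).add (hEQi _).aemeasurable
  obtain ⟨K2, hK2, hK2η⟩ := exists_measureReal_not_le_le hZm hη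
  have ev3 : EventuallyLikely μ η fun _ ω => ∑ i ∈ Finset.range T,
      (|X (i + 1 : ℕ) ω| ^ k + EQ (i + 1 : ℕ) ω) ≤ K2 := Eventually.of_forall fun _ => hK2η
  obtain ⟨K3, hK3, ev4⟩ := exists_eventuallyLikely_sum_le (μ := μ)
    (Q := fun i : ℕ => EQ (i + 1 : ℕ)) (fun i => Eventually.of_forall fun ω => hEQ0 _ ω)
    (fun i => hEQi _) (integral_nonneg fun ω => hEQ0 0 ω)
    (fun i => (hEQc.identDistrib hε _ 0).integral_eq.le) hη
  obtain ⟨K4, hK4, ev5⟩ := exists_eventuallyLikely_discounted_sum_le (μ := μ)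
    (Q := fun (i : ℕ) ω => |ε (i + 1 : ℕ) ω| ^ k)
    (fun i => Eventually.of_forall fun ω => by positivity)
    (fun i => (hpowc.identDistrib hε _ 0).integrable_iff.2 hmom)
    (integral_nonneg fun ω => by positivity)
    (fun i => (hpowc.identDistrib hε _ 0).integral_eq.le) hl hl1 hη
  -- The factor (K M)⁴ is what `mul_rpow_quarter_le_one` needs to keep every time up to n in the
  -- range of the expansion.
  have ev6 := eventuallyLikely_forall_le_sq (μ := μ)
    (Q := fun (i : ℕ) ω => (K * M) ^ 4 * Q (i + 1 : ℕ) ω)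
    (fun i => Eventually.of_forall fun ω =>
      mul_nonneg (by positivity) (by linarith [hQ1 (i + 1 : ℕ) ω]))
    (fun i => (hQi _).const_mul _) (m := (K * M) ^ 4 * ∫ ω, Q 0 ω ∂μ)
    (fun i => by
      rw [integral_const_mul, (hQp.isCausal.identDistrib hε (i + 1 : ℕ) 0).integral_eq]) hη
  set c : ℝ := k / 2 with hc
  have hc0 : 0 ≤ c := by positivity
  set N : ℝ := ((Fintype.card (Fin (p + 1) ⊕ Fin q) : ℕ) : ℝ) with hN
  -- Precision for the law of large numbers, chosen so that the linear term costs at most ξ / 4.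
  set δ' := ξ / (4 * (2 * c * N * M + 1)) with hδ'
  have hδ'0 : 0 < δ' := by positivity
  have hδ'le : 2 * c * N * M * δ' ≤ ξ / 4 := by
    rw [hδ', mul_div_assoc', div_le_div_iff₀ (by positivity) (by norm_num)]
    nlinarith
  have ev7 : EventuallyLikely μ η fun n ω => ∀ a, ∀ j ≤ n,
      |∑ i ∈ Finset.range j, Y a (i + 1 : ℕ) ω - j * ∫ ω, Y a 0 ω ∂μ| ≤ δ' * n :=
    EventuallyLikely.forall hη fun a η hη => by
      refine ((hYc a).eventually_measureReal_max_le hε (hYi a) hδ'0 hη).mono fun n hn => ?_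
      refine (measureReal_mono (fun ω hω => ?_) (measure_ne_top _ _)).trans hn
      have h : ∃ j, j ≤ n ∧
          ¬ |∑ i ∈ Finset.range j, Y a (i + 1 : ℕ) ω - j * ∫ ω, Y a 0 ω ∂μ| ≤ δ' * n := by
        by_contra! hcon
        exact hω hcon
      obtain ⟨j, hj, hlt⟩ := h
      refine ⟨j, hj, ?_⟩
      push_cast at hlt
      exact not_le.1 hlt
  set R := K * (K2 + M ^ 2 * K3 + K0 * K4) with hR
  set B := c * (M * ∑ a, |∫ ω, Y a 0 ω ∂μ|) + 2 * R with hB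
  have hsqrt : Tendsto (fun n : ℕ => √(n : ℝ)) atTop atTop :=
    Real.tendsto_sqrt_atTop.comp tendsto_natCast_atTop_atTop
  have hlim : Tendsto (fun n : ℕ => B / √(n : ℝ)) atTop (𝓝 0) :=
    tendsto_const_nhds.div_atTop hsqrt
  have hall := ev1.and (ev2.and (ev3.and (ev4.and (ev5.and (ev6.and ev7)))))
  rw [hηη] at hall
  filter_upwards [hall, hlim.eventually_lt_const (show 0 < ξ / 4 by positivity),
    hsqrt.eventually_ge_atTop (M / δ), eventually_gt_atTop 0] with n hn hnB hnδ hn0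
  refine le_trans (ENNReal.toReal_mono (measure_ne_top _ _) (measure_mono_ae ?_)) hn
  filter_upwards [hreg] with ω hω hnot hgood
  refine hnot ?_
  obtain ⟨g1, g2, g3, g4, g5, g6, g7⟩ := hgood
  obtain ⟨hsum, -, hmain⟩ := hexp (fun t => X t ω) (fun t => σ t ω) (fun t => ε t ω) hω
  have hs0 : 0 < √(n : ℝ) := Real.sqrt_pos.2 (by exact_mod_cast hn0)
  have hhδ : ‖θhat n ω - θ‖ ≤ δ := by
    rw [div_le_iff₀ hδ] at hnδ
    exact le_of_mul_le_mul_left (g1.trans hnδ) hs0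
  have hlin : ∀ t, ∑ a, b.repr (θhat n ω - θ) a * Y a t ω = ε t ω ^ k
      * (fullDeriv θ (θhat n ω - θ) (fun t => X t ω ^ 2) t
        / fullVar θ (fun t => X t ω ^ 2) t) := fun t => by
    rw [fullDeriv_eq_sum_basis (y := fun t => X t ω ^ 2) _ (hsum t), Finset.sum_div, Finset.mul_sum]
    refine Finset.sum_congr rfl fun a _ => ?_
    rw [mul_div_assoc, mul_left_comm]
  have htail0 : 0 ≤ initialTail lam fun t => X t ω ^ 2 :=
    tsum_nonneg fun i => mul_nonneg (by positivity) (hX0 _ ω)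
  have hbound := hmain (θhat n ω - θ) T n hhδ
    (fun i hi => mul_rpow_quarter_le_one hn0 hK.le (by linarith [hQ1 (i + 1 : ℕ) ω])
      g1 (g6 i hi))
    (le_trans (by gcongr) hT')
  have hRle : ∀ j ≤ n, |∑ i ∈ Finset.range j,
      (residual (θhat n ω) (fun t => X t ω) (i + 1) ^ k - ε ((i + 1 : ℕ) : ℤ) ω ^ k)
      + c * ∑ i ∈ Finset.range j, ∑ a, b.repr (θhat n ω - θ) a * Y a (i + 1 : ℕ) ω| ≤ R := by
    intro j hj
    have h := hbound j hj
    rw [add_sub_cancel] at h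
    simp only [hlin]
    refine h.trans ?_
    -- The squared rate 1 / n cancels the linear growth of the sum of |ε|^k Q, so the quadratic
    -- errors stay bounded.
    have hsq : ‖θhat n ω - θ‖ ^ 2 * (n * K3) ≤ M ^ 2 * K3 := by
      have := pow_le_pow_left₀ (by positivity) g1 2
      rw [mul_pow, Real.sq_sqrt (Nat.cast_nonneg n)] at this
      calc _ = n * ‖θhat n ω - θ‖ ^ 2 * K3 := by ring
        _ ≤ _ := mul_le_mul_of_nonneg_right this hK3.le
    refine mul_le_mul_of_nonneg_left (add_le_add (add_le_add g3
      ((mul_le_mul_of_nonneg_left g4 (by positivity)).trans hsq)) ?_) hK.le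
    exact mul_le_mul g2 g5 (Finset.sum_nonneg fun i _ => by positivity) hK0.le
  have hfin := iSup_cusum_sub_le (f := residual (θhat n ω) fun t => X t ω)
    (g := fun t => ε t ω) (k := k) hn0 (Y := fun a i => Y a (i + 1 : ℕ) ω)
    (m := fun a => ∫ ω, Y a 0 ω ∂μ) hc0
    (fun a => abs_paramBasis_repr_le (θhat n ω - θ) a) g1 (by linarith) hRle g7
  -- ξ / 4 from the law of large numbers and less than ξ / 4 from the bounded terms divided by √n.
  exact hfin.trans_lt (by linarith)

end Main

end GARCH

theorem theorem1p2 {Ω : Type*} [MeasurableSpace Ω] (μ : Measure Ω) [IsProbabilityMeasure μ]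
    (p q : ℕ) (hp : 1 ≤ p)
    (ulow uupp ρ₀ : ℝ) (hulow : 0 < ulow) (huupp : ulow < uupp) (hρ₀ : 0 < ρ₀) (hρ₀' : ρ₀ < 1)
    (hqρ₀ : q * ulow < ρ₀)
    (θ : GARCH.Param p q) (hθ : θ ∈ interior (GARCH.paramSpace p q ulow uupp ρ₀))
    (ε X σ : ℤ → Ω → ℝ) (hε : GARCH.IsInnovation μ ε)
    (hγ : GARCH.lyapunovExponent μ θ ε < 0)
    (hX : GARCH.IsStationaryGARCH μ θ ε X σ)
    (hsmall : ∃ ζ : ℝ, 0 < ζ ∧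
      Tendsto (fun x : ℝ => x ^ (-ζ) * μ.real {ω | |ε 0 ω| ≤ x}) (𝓝[>] 0) (𝓝 0))
    (θhat : ℕ → Ω → GARCH.Param p q) (hθhat_meas : ∀ n, AEMeasurable (θhat n) μ)
    (hθhat : GARCH.IsBoundedInProb μ fun n ω => √(n : ℝ) * ‖θhat n ω - θ‖)
    (k : ℕ) (hk : 1 ≤ k) (hmom : Integrable (fun ω => |ε 0 ω| ^ k) μ) :
    TendstoInMeasure μ
      (fun (n : ℕ) ω => ⨆ u : Set.Icc (0 : ℝ) 1,
        (1 / √(n : ℝ)) *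
          |GARCH.cusum (GARCH.residual (θhat n ω) fun t => X t ω) k n u
            - GARCH.cusum (fun t => ε t ω) k n u|)
      atTop (fun _ => 0) := by
  have hmem := interior_subset hθ
  exact hX.tendstoInMeasure_cusum hp (GARCH.isAdmissible_of_mem_paramSpace hulow hρ₀' hmem) hulow
    (fun i => (hmem.2.1 i).1) (fun j => (hmem.2.2 j).1) hε hγ hθhat k hmom
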